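/- Let $\Omega\subset\mathbb{R}^3$ be a bounded, simply connected Lipschitz polyhedral domain with simply connected boundary $\Gamma=\partial\Omega$, let $k\ge 0$ be an integer, and let $\sigma,\rho>0$ and $N\in\mathbb{N}$. There is a constant $C>0$, depending only on $\Omega,k,\sigma,\rho,N$, such that the following holds. Let $\mathcal{T}_h$ be a conforming tetrahedral mesh of $\overline\Omega$ with mesh size $h=\max_T h_T$, $h_T=\operatorname{diam}T$, which is shape regular (each $T\in\mathcal{T}_h$ contains a ball of diameter at least $h_T/\sigma$) and quasi-uniform ($h\le\rho\,h_T$ for every $T$). Let $\mathcal{T}_h^\Gamma$ be the set of elements with at least one face contained in $\Gamma$, and let $\mathcal{W}_h$ be a partition of $\mathcal{T}_h^\Gamma$ into patches (a patch $\omega$ being identified with the union of its elements) satisfying the isolated patch condition: 1. each $\omega\in\mathcal{W}_h$ consists of at most $N$ elements and is simply connected; 2. for each $\omega\in\mathcal{W}_h$ the set $\Gamma_\omega:=\partial\omega\cap\Gamma$ is contained in a plane and is simply connected; 3. $(\partial\omega\cap\partial\omega')\setminus\Gamma=\emptyset$ for all $\omega\ne\omega'$ in $\mathcal{W}_h$.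 Let $\mathcal{P}_k$ be the polynomials in three variables of total degree at most $k$ and let $$\Sigma_h=\{v\in H(\mathrm{curl},\Omega): v|_T\in(\mathcal{P}_k)^3+x\times(\mathcal{P}_k)^3\ \ \forall\,T\in\mathcal{T}_h\}$$ be the Nédélec space of the first kind. For $\omega\in\mathcal{W}_h$ let $P_h(\omega)=\{v\in H^1(\omega): v|_T\in\mathcal{P}_{k+1}\ \forall\,T\subset\omega\}$, with $H^1(\omega)$ defined by weak derivatives in the interior of $\omega$. Let $\gamma_t u=n\times(u\times n)$ denote the tangential trace, with $n$ the outward unit normal, let $\mathrm{grad}_\Gamma$ denote the surface gradient, and let $\Pi_h^\Gamma$ denote the projection that on each $\Gamma_\omega$ is the $L^2(\Gamma_\omega)$-orthogonal projection onto $\mathrm{grad}_\Gamma\big(P_h(\omega)|_{\Gamma_\omega}\big)$. Then for every patch $\omega\in\mathcal{W}_h$ and every $u_h\in\Sigma_h$, $$\|\gamma_t u_h-\Pi_h^\Gamma\gamma_t u_h\|_{L^2(\Gamma_\omega)}\le C\,h^{1/2}\,\|\mathrm{curl}\,u_h\|_{L^2(\omega)}.$$ -/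

import Mathlib

open MeasureTheory Set
open scoped Matrix

noncomputable section

namespace EdgeElement

/-- Euclidean three-space. -/
abbrev E3 : Type := EuclideanSpace ℝ (Fin 3)

/-! ### Domains -/

/-- A bounded Lipschitz domain of trivial topology: a bounded open set, simply connected (in
particular nonempty and path connected) with simply connected boundary, which near each of its
boundary points is the set of points above the graph of a Lipschitz function over the plane
orthogonal to some unit direction `d`. (That the domain is a polyhedron is part of the existence
of a tetrahedral mesh of its closure, see `TetMesh`.) -/
structure IsLipschitzDomain (Ω : Set E3) : Prop where
  isOpen : IsOpen Ω
  isBounded : Bornology.IsBounded Ω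
  simplyConnected : IsSimplyConnected Ω
  boundary_simplyConnected : IsSimplyConnected (frontier Ω)
  lipschitz : ∀ x ∈ frontier Ω, ∃ (d : E3) (φ : E3 → ℝ) (K : NNReal), ‖d‖ = 1 ∧
    LipschitzWith K φ ∧
    ∃ U : Set E3, IsOpen U ∧ x ∈ U ∧
      ∀ y ∈ U, y ∈ Ω ↔ φ (y - inner ℝ d y • d) < inner ℝ d y

/-! ### Weak derivatives and Sobolev spaces -/

/-- `g` is the weak `i`-th partial derivative of `v` on the open set `U`. -/
def IsWeakPartial (U : Set E3) (i : Fin 3) (v g : E3 → ℝ) : Prop :=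
  ∀ φ : E3 → ℝ, ContDiff ℝ (⊤ : ℕ∞) φ → HasCompactSupport φ → tsupport φ ⊆ U →
    ∫ x in U, v x * fderiv ℝ φ x (EuclideanSpace.single i 1) = -∫ x in U, g x * φ x

/-- `v ∈ H¹(U)`. -/
def MemH1 (U : Set E3) (v : E3 → ℝ) : Prop :=
  MemLp v 2 (volume.restrict U) ∧
    ∀ i, ∃ g : E3 → ℝ, MemLp g 2 (volume.restrict U) ∧ IsWeakPartial U i v g

/-- The classical curl of a vector field. -/
def classicalCurl (ψ : E3 → E3) (x : E3) : E3 :=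
  let D : Fin 3 → Fin 3 → ℝ := fun j i => fderiv ℝ ψ x (EuclideanSpace.single j 1) i
  !₂[D 1 2 - D 2 1, D 2 0 - D 0 2, D 0 1 - D 1 0]

/-- `w` is the weak curl of `u` on the open set `U`. -/
def IsWeakCurl (U : Set E3) (u w : E3 → E3) : Prop :=
  ∀ ψ : E3 → E3, ContDiff ℝ (⊤ : ℕ∞) ψ → HasCompactSupport ψ → tsupport ψ ⊆ U →
    ∫ x in U, inner ℝ (u x) (classicalCurl ψ x) = ∫ x in U, inner ℝ (w x) (ψ x)

/-- `u ∈ H(curl, U)`. -/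
def MemHCurl (U : Set E3) (u : E3 → E3) : Prop :=
  MemLp u 2 (volume.restrict U) ∧
    ∃ w : E3 → E3, MemLp w 2 (volume.restrict U) ∧ IsWeakCurl U u w

lemma MemH1.zero (U : Set E3) : MemH1 U 0 :=
  ⟨MemLp.zero, fun _ => ⟨0, MemLp.zero, fun φ _ _ _ => by simp⟩⟩

lemma MemH1.add {U : Set E3} {v w : E3 → ℝ} (hv : MemH1 U v) (hw : MemH1 U w) :
    MemH1 U (v + w) := by
  refine ⟨hv.1.add hw.1, fun i => ?_⟩
  obtain ⟨g, hg, hg'⟩ := hv.2 i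
  obtain ⟨g', hg1, hg1'⟩ := hw.2 i
  refine ⟨g + g', hg.add hg1, fun φ h1 h2 h3 => ?_⟩
  have hφ : MemLp φ 2 (volume.restrict U) :=
    (h1.continuous.memLp_of_hasCompactSupport h2).restrict U
  have hdφ : MemLp (fun x => fderiv ℝ φ x (EuclideanSpace.single i 1)) 2 (volume.restrict U) := by
    have hc : Continuous (fun x => fderiv ℝ φ x (EuclideanSpace.single i 1)) :=
      (h1.continuous_fderiv (by simp)).clm_apply continuous_const
    exact (hc.memLp_of_hasCompactSupport (h2.fderiv_apply (𝕜 := ℝ) _)).restrict U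
  have e1 : Integrable (fun x => v x * fderiv ℝ φ x (EuclideanSpace.single i 1))
      (volume.restrict U) := MemLp.integrable_mul hv.1 hdφ
  have e2 : Integrable (fun x => w x * fderiv ℝ φ x (EuclideanSpace.single i 1))
      (volume.restrict U) := MemLp.integrable_mul hw.1 hdφ
  have e3 : Integrable (fun x => g x * φ x) (volume.restrict U) := MemLp.integrable_mul hg hφ
  have e4 : Integrable (fun x => g' x * φ x) (volume.restrict U) := MemLp.integrable_mul hg1 hφ
  simp only [Pi.add_apply, add_mul]
  rw [integral_add e1 e2, integral_add e3 e4, hg' φ h1 h2 h3, hg1' φ h1 h2 h3]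
  ring

lemma MemH1.smul {U : Set E3} {v : E3 → ℝ} (c : ℝ) (hv : MemH1 U v) : MemH1 U (c • v) := by
  refine ⟨hv.1.const_smul c, fun i => ?_⟩
  obtain ⟨g, hg, hg'⟩ := hv.2 i
  refine ⟨c • g, hg.const_smul c, fun φ h1 h2 h3 => ?_⟩
  simp only [Pi.smul_apply, smul_eq_mul, mul_assoc]
  rw [integral_const_mul, integral_const_mul, hg' φ h1 h2 h3]
  ring

/-! ### Polynomials and polynomial vector fields -/

/-- Polynomials in three variables. -/
abbrev Poly : Type := MvPolynomial (Fin 3) ℝ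

/-- Polynomial vector fields. -/
abbrev VPoly : Type := Fin 3 → Poly

/-- The function on `E3` given by a polynomial. -/
def evalS : Poly →ₗ[ℝ] (E3 → ℝ) where
  toFun p x := MvPolynomial.eval x.ofLp p
  map_add' p q := by ext x; simp
  map_smul' c p := by ext x; simp

/-- The vector field on `E3` given by a polynomial vector field. -/
def evalV : VPoly →ₗ[ℝ] (E3 → E3) where
  toFun p x := WithLp.toLp 2 fun i => MvPolynomial.eval x.ofLp (p i)
  map_add' p q := by ext x i; simp
  map_smul' c p := by ext x i; simp

/-- The gradient of a polynomial. -/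
def grad : Poly →ₗ[ℝ] VPoly where
  toFun p i := MvPolynomial.pderiv i p
  map_add' p q := by ext1 i; simp
  map_smul' c p := by ext1 i; simp

/-- The curl of a polynomial vector field. -/
def curl (u : VPoly) : VPoly :=
  ![MvPolynomial.pderiv 1 (u 2) - MvPolynomial.pderiv 2 (u 1),
    MvPolynomial.pderiv 2 (u 0) - MvPolynomial.pderiv 0 (u 2),
    MvPolynomial.pderiv 0 (u 1) - MvPolynomial.pderiv 1 (u 0)]

/-- The shape functions `𝓟_k³ + x × 𝓟_k³` of the Nédélec element of the first kind. -/
def nedelec (k : ℕ) : Set VPoly :=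
  {u | ∃ p q : VPoly, (∀ i, (p i).totalDegree ≤ k) ∧ (∀ i, (q i).totalDegree ≤ k) ∧
    u = p + (fun i => (MvPolynomial.X i : Poly)) ⨯₃ q}

/-! ### Tetrahedral meshes -/

/-- A (conforming) tetrahedral mesh of `Ω`. An element is given by its four vertices and is,
as a closed domain, their convex hull; two elements meet in the convex hull of their common
vertices (which may be empty); the elements cover the closure of `Ω`. -/
structure TetMesh (Ω : Set E3) where
  elems : Finset (Finset E3)
  card_eq : ∀ T ∈ elems, T.card = 4
  affineIndependent : ∀ T ∈ elems, AffineIndependent ℝ ((↑) : T → E3)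
  inter_eq : ∀ T ∈ elems, ∀ T' ∈ elems,
    convexHull ℝ (T : Set E3) ∩ convexHull ℝ (T' : Set E3) =
      convexHull ℝ ((T : Set E3) ∩ (T' : Set E3))
  cover : ⋃ T ∈ elems, convexHull ℝ (T : Set E3) = closure Ω

/-- The face, opposite to the vertex `a`, of the simplex with vertex set `T`. -/
def face (T : Finset E3) (a : E3) : Set E3 := convexHull ℝ ((T : Set E3) \ {a})

/-- The unit normal, pointing out of the simplex with vertex set `T`, on the face opposite to
`a`: the normalized component, orthogonal to that face, of the sum of the edge vectors from `a`
to the other vertices. -/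
def outwardNormal (T : Finset E3) (a : E3) : E3 :=
  let m : E3 := (vectorSpan ℝ (face T a))ᗮ.starProjection (∑ b ∈ T, (b - a))
  ‖m‖⁻¹ • m

/-- The tangential component `n × (v × n)` of a vector `v`. -/
def tangential (n v : E3) : E3 := WithLp.toLp 2 (n.ofLp ⨯₃ (v.ofLp ⨯₃ n.ofLp))

namespace TetMesh

variable {Ω : Set E3} (M : TetMesh Ω)

/-- The elements of the mesh. -/
abbrev Elem : Type := M.elems

/-- The closed domain of an element. -/
def dom (T : M.Elem) : Set E3 := convexHull ℝ (T.1 : Set E3)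

/-- The element diameter `h_T`. -/
def diam (T : M.Elem) : ℝ := Metric.diam (M.dom T)

/-- The mesh size `h = max_T h_T`. -/
def meshSize : ℝ := ⨆ T : M.Elem, M.diam T

/-- Shape regularity with constant `σ`: each element contains a ball whose diameter `2r`
satisfies `h_T ≤ σ * (2r)`. -/
def ShapeRegular (σ : ℝ) : Prop :=
  ∀ T : M.Elem, ∃ (x : E3) (r : ℝ), 0 < r ∧ Metric.closedBall x r ⊆ M.dom T ∧
    M.diam T ≤ σ * (2 * r)

/-- Quasi-uniformity with constant `ρ`. -/
def QuasiUniform (ρ : ℝ) : Prop := ∀ T : M.Elem, M.meshSize ≤ ρ * M.diam T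

/-- The elements with at least one face on the boundary of `Ω`. -/
def boundaryElems : Set M.Elem := {T | ∃ a ∈ T.1, face T.1 a ⊆ frontier Ω}

/-- The closed set covered by the elements of `ω`. -/
def region (ω : Finset M.Elem) : Set E3 := ⋃ T ∈ ω, M.dom T

/-- The boundary part `Γ_ω = ∂ω ∩ Γ`. -/
def surf (ω : Finset M.Elem) : Set E3 := frontier (M.region ω) ∩ frontier Ω

/-- `𝒲` is a patch decomposition of the boundary elements which satisfies the isolated patch
condition, with at most `N` elements in each patch. -/
structure IsolatedPatches (N : ℕ) (𝒲 : Finset (Finset M.Elem)) : Prop where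
  cover : ∀ T : M.Elem, T ∈ M.boundaryElems ↔ ∃ ω ∈ 𝒲, T ∈ ω
  disjoint : ∀ ω ∈ 𝒲, ∀ ω' ∈ 𝒲, ω ≠ ω' → Disjoint ω ω'
  card_le : ∀ ω ∈ 𝒲, ω.card ≤ N
  simplyConnected : ∀ ω ∈ 𝒲, IsSimplyConnected (M.region ω)
  coplanar : ∀ ω ∈ 𝒲, Coplanar ℝ (M.surf ω)
  surf_simplyConnected : ∀ ω ∈ 𝒲, IsSimplyConnected (M.surf ω)
  isolated : ∀ ω ∈ 𝒲, ∀ ω' ∈ 𝒲, ω ≠ ω' →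
    (frontier (M.region ω) ∩ frontier (M.region ω')) \ frontier Ω = ∅

/-! ### Finite element spaces

A piecewise polynomial function on a set `ω` of elements is given by its polynomials on the
elements of `ω`. As a function on `E3`, determined up to a null set, it is `glue`. -/

/-- The function which is `f T` in the interior of each element `T` of `ω`, and zero elsewhere. -/
def glue {V : Type*} [AddCommMonoid V] (ω : Finset M.Elem) (f : ω → E3 → V) : E3 → V :=
  fun x => ∑ T : ω, (interior (M.dom T.1)).indicator (f T) x

lemma glue_add {V : Type*} [AddCommMonoid V] (ω : Finset M.Elem) (f g : ω → E3 → V) :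
    M.glue ω (f + g) = M.glue ω f + M.glue ω g := by
  ext x
  simp only [glue, Pi.add_apply, ← Finset.sum_add_distrib]
  refine Finset.sum_congr rfl fun T _ => ?_
  by_cases hx : x ∈ interior (M.dom T.1) <;> simp [hx]

lemma glue_smul {V : Type*} [AddCommMonoid V] [Module ℝ V] (ω : Finset M.Elem) (c : ℝ)
    (f : ω → E3 → V) : M.glue ω (c • f) = c • M.glue ω f := by
  ext x
  simp only [glue, Pi.smul_apply, Finset.smul_sum]
  refine Finset.sum_congr rfl fun T _ => ?_
  by_cases hx : x ∈ interior (M.dom T.1) <;> simp [hx]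

/-- The global Nédélec space of the first kind `Σ_h`: the fields in `H(curl, Ω)` which are in
`𝓟_k³ + x × 𝓟_k³` on each element. -/
def edgeSpace (k : ℕ) : Set (M.Elem → VPoly) :=
  {u | (∀ T, u T ∈ nedelec k) ∧
    MemHCurl Ω (M.glue Finset.univ fun T => evalV (u T.1))}

/-- The Lagrange space `P_h(ω)`: the functions in `H¹(ω)` (weak derivatives are taken in the
interior of `ω`) which are polynomials of degree at most `k + 1` on each element of `ω`. -/
def lagrangeSpace (k : ℕ) (ω : Finset M.Elem) : Submodule ℝ (ω → Poly) where
  carrier := {v | (∀ T, (v T).totalDegree ≤ k + 1) ∧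
    MemH1 (interior (M.region ω)) (M.glue ω fun T => evalS (v T))}
  zero_mem' := by
    refine ⟨fun T => by simp, ?_⟩
    have : (M.glue ω fun T => evalS ((0 : ω → Poly) T)) = 0 := by
      ext x
      simp [glue]
    rw [this]
    exact MemH1.zero _
  add_mem' := by
    rintro v w ⟨hv, hv'⟩ ⟨hw, hw'⟩
    refine ⟨fun T => (MvPolynomial.totalDegree_add _ _).trans (max_le (hv T) (hw T)), ?_⟩
    have : (M.glue ω fun T => evalS ((v + w) T)) =
        (M.glue ω fun T => evalS (v T)) + M.glue ω fun T => evalS (w T) := by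
      rw [← glue_add]
      congr 1
      ext1 T
      simp
    rw [this]
    exact hv'.add hw'
  smul_mem' := by
    rintro c v ⟨hv, hv'⟩
    refine ⟨fun T => (MvPolynomial.totalDegree_smul_le _ _).trans (hv T), ?_⟩
    have : (M.glue ω fun T => evalS ((c • v) T)) = c • M.glue ω fun T => evalS (v T) := by
      rw [← glue_smul]
      congr 1
      ext1 T
      simp
    rw [this]
    exact hv'.smul c

instance (k : ℕ) (ω : Finset M.Elem) : FiniteDimensional ℝ (M.lagrangeSpace k ω) := by
  have hle : M.lagrangeSpace k ω ≤
      Submodule.pi Set.univ fun _ : ω => MvPolynomial.restrictTotalDegree (Fin 3) ℝ (k + 1) := by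
    intro v hv T _
    exact (MvPolynomial.mem_restrictTotalDegree _ _ _).2 (hv.1 T)
  have hfin : FiniteDimensional ℝ (Submodule.pi Set.univ fun _ : ω =>
      MvPolynomial.restrictTotalDegree (Fin 3) ℝ (k + 1)) := by
    let f : (ω → MvPolynomial.restrictTotalDegree (Fin 3) ℝ (k + 1)) →ₗ[ℝ] (ω → Poly) :=
      LinearMap.pi fun T => (Submodule.subtype _).comp (LinearMap.proj T)
    have : (Submodule.pi Set.univ fun _ : ω =>
        MvPolynomial.restrictTotalDegree (Fin 3) ℝ (k + 1)) ≤ LinearMap.range f := by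
      intro v hv
      exact ⟨fun T => ⟨v T, hv T (Set.mem_univ _)⟩, by ext1 T; simp [f]⟩
    exact Submodule.finiteDimensional_of_le this
  exact Submodule.finiteDimensional_of_le hle

/-! ### Traces on `Γ_ω` -/

/-- The surface measure on `Γ_ω`. -/
def surfMeasure (ω : Finset M.Elem) : Measure E3 := μHE[2].restrict (M.surf ω)

open Classical in
/-- The tangential trace `γ_t u = n × (u × n)` on `Γ_ω` of a piecewise polynomial field on `ω`:
on each face on the boundary of `Ω` of an element `T` of `ω` it is the tangential component of
the polynomial field on `T` (faces overlap only in null sets for the surface measure). -/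
def traceFun (ω : Finset M.Elem) (u : ω → VPoly) : E3 → E3 := fun x =>
  ∑ T : ω, ∑ a ∈ T.1.1, if face T.1.1 a ⊆ frontier Ω then
    (face T.1.1 a).indicator (fun y => tangential (outwardNormal T.1.1 a) (evalV (u T) y)) x
    else 0

lemma tangential_add (n v w : E3) : tangential n (v + w) = tangential n v + tangential n w := by
  simp [tangential]

lemma tangential_smul (n : E3) (c : ℝ) (v : E3) : tangential n (c • v) = c • tangential n v := by
  simp [tangential]

lemma traceFun_add (ω : Finset M.Elem) (u w : ω → VPoly) :
    M.traceFun ω (u + w) = M.traceFun ω u + M.traceFun ω w := by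
  ext1 x
  simp only [traceFun, Pi.add_apply, ← Finset.sum_add_distrib]
  refine Finset.sum_congr rfl fun T _ => Finset.sum_congr rfl fun a _ => ?_
  split_ifs
  · by_cases hx : x ∈ face T.1.1 a <;> simp [hx, tangential_add]
  · simp

lemma traceFun_smul (ω : Finset M.Elem) (c : ℝ) (u : ω → VPoly) :
    M.traceFun ω (c • u) = c • M.traceFun ω u := by
  ext1 x
  simp only [traceFun, Pi.smul_apply, Finset.smul_sum]
  refine Finset.sum_congr rfl fun T _ => Finset.sum_congr rfl fun a _ => ?_
  split_ifs
  · by_cases hx : x ∈ face T.1.1 a <;> simp [hx, tangential_smul]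
  · simp

lemma continuous_tangential_evalV (n : E3) (u : VPoly) :
    Continuous fun y => tangential n (evalV u y) := by
  have h : ∀ i, Continuous fun y : E3 => MvPolynomial.eval y.ofLp (u i) := fun i =>
    (MvPolynomial.continuous_eval (u i)).comp (PiLp.continuous_ofLp 2 _)
  have h0 := h 0
  have h1 := h 1
  have h2 := h 2
  unfold tangential
  refine (PiLp.continuous_toLp 2 _).comp (continuous_pi fun i => ?_)
  fin_cases i <;> simp [cross_apply, evalV] <;> fun_prop

lemma isCompact_face (T : Finset E3) (a : E3) : IsCompact (face T a) :=
  Set.Finite.isCompact_convexHull (𝕜 := ℝ) (T.finite_toSet.subset Set.sdiff_subset)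

lemma face_measure_lt_top {T : Finset E3} {a : E3} (hT : T.card = 4) (ha : a ∈ T) :
    μHE[2] (face T a) < ⊤ := by
  classical
  have hc : (T.erase a).card = 3 := by rw [Finset.card_erase_of_mem ha, hT]
  obtain ⟨p, q, r, -, -, -, hpqr⟩ := Finset.card_eq_three.1 hc
  have hset : ((T : Set E3) \ {a}) = {p, q, r} := by
    rw [← Finset.coe_erase, hpqr]; simp
  let L : (Fin 2 → ℝ) →L[ℝ] E3 :=
    (ContinuousLinearMap.proj 0).smulRight (q - p) + (ContinuousLinearMap.proj 1).smulRight (r - p)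
  let f : (Fin 2 → ℝ) → E3 := fun s => p + L s
  have hf : LipschitzWith ‖L‖₊ f := by
    have h := (LipschitzWith.const p).add L.lipschitz
    simpa using h
  have hconv : Convex ℝ (f '' Set.Icc 0 1) := by
    have : f '' Set.Icc 0 1 = (fun z => p + z) '' (L '' Set.Icc 0 1) := by
      rw [Set.image_image]
    rw [this]
    exact ((convex_Icc 0 1).is_linear_image L.toLinearMap.isLinear).translate p
  have hsub : face T a ⊆ f '' Set.Icc 0 1 := by
    unfold face
    rw [hset]
    refine convexHull_min ?_ hconv
    rintro x (rfl | rfl | rfl)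
    · exact ⟨0, by simp, by simp [f]⟩
    · refine ⟨![1, 0], ⟨fun i => ?_, fun i => ?_⟩, by simp [f, L]⟩ <;> fin_cases i <;> simp
    · refine ⟨![0, 1], ⟨fun i => ?_, fun i => ?_⟩, by simp [f, L]⟩ <;> fin_cases i <;> simp
  have hfin : μH[2] (f '' Set.Icc 0 1) < ⊤ := by
    refine (hf.hausdorffMeasure_image_le (by norm_num) _).trans_lt ?_
    have h2 : (μH[2] : Measure (Fin 2 → ℝ)) = volume := by
      simpa using hausdorffMeasure_pi_real (ι := Fin 2)
    rw [h2]
    exact ENNReal.mul_lt_top (by simp) isCompact_Icc.measure_lt_top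
  refine (measure_mono hsub).trans_lt ?_
  rw [Measure.euclideanHausdorffMeasure_def, Measure.smul_apply, ENNReal.smul_def, smul_eq_mul]
  exact ENNReal.mul_lt_top (by simp) (by simpa using hfin)

lemma memLp_traceFun (ω : Finset M.Elem) (u : ω → VPoly) :
    MemLp (M.traceFun ω u) 2 (M.surfMeasure ω) := by
  refine MemLp.restrict _ ?_
  refine memLp_finsetSum _ fun T _ => memLp_finsetSum _ fun a ha => ?_
  split_ifs
  · have hK := isCompact_face T.1.1 a
    rw [memLp_indicator_iff_restrict hK.measurableSet]
    have hfin : IsFiniteMeasure ((μHE[2] : Measure E3).restrict (face T.1.1 a)) :=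
      ⟨by simpa using face_measure_lt_top (M.card_eq _ T.1.2) ha⟩
    have hcont := continuous_tangential_evalV (outwardNormal T.1.1 a) (u T)
    obtain ⟨C, hC⟩ := hK.exists_bound_of_continuousOn hcont.continuousOn
    refine MemLp.of_bound hcont.aestronglyMeasurable C ?_
    exact (ae_restrict_iff' hK.measurableSet).2 (ae_of_all _ hC)
  · exact MemLp.zero

/-- The space `L²(Γ_ω)` of vector fields. -/
abbrev SurfL2 (ω : Finset M.Elem) : Type := Lp E3 2 (M.surfMeasure ω)

/-- The tangential trace as an operator into `L²(Γ_ω)`. -/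
def trace (ω : Finset M.Elem) : (ω → VPoly) →ₗ[ℝ] M.SurfL2 ω where
  toFun u := (M.memLp_traceFun ω u).toLp
  map_add' u w := by
    rw [← MemLp.toLp_add]
    exact MemLp.toLp_congr _ _ (by rw [traceFun_add])
  map_smul' c u := by
    rw [RingHom.id_apply, ← MemLp.toLp_const_smul]
    exact MemLp.toLp_congr _ _ (by rw [traceFun_smul])

/-- The surface gradient on `Γ_ω` of the trace of a piecewise polynomial function on `ω`, that
is, the tangential component of its gradient. -/
def surfGrad (ω : Finset M.Elem) : (ω → Poly) →ₗ[ℝ] M.SurfL2 ω :=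
  (M.trace ω).comp (LinearMap.pi fun T => grad.comp (LinearMap.proj T))

/-- The space `M_ω = grad_Γ P_h(Γ_ω)` of the surface gradients of the traces of the functions in
`P_h(ω)`. -/
def gradTraceSpace (k : ℕ) (ω : Finset M.Elem) : Submodule ℝ (M.SurfL2 ω) :=
  (M.lagrangeSpace k ω).map (M.surfGrad ω)

instance (k : ℕ) (ω : Finset M.Elem) : FiniteDimensional ℝ (M.gradTraceSpace k ω) := by
  unfold gradTraceSpace
  infer_instance

/-- The restriction to `Γ_ω` of the projection `Π_h^Γ`: the `L²(Γ_ω)`-orthogonal projection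
onto `M_ω`. -/
def surfProj (k : ℕ) (ω : Finset M.Elem) : M.SurfL2 ω →L[ℝ] M.SurfL2 ω :=
  (M.gradTraceSpace k ω).starProjection

/-- The norm `‖curl u‖` in `L²(ω)` of a piecewise polynomial field in `H(curl)`, whose curl is
on each element the curl of the polynomial field. -/
def curlNorm (ω : Finset M.Elem) (u : ω → VPoly) : ℝ :=
  Real.sqrt (∫ x in M.region ω, ‖M.glue ω (fun T => evalV (curl (u T))) x‖ ^ 2)

end TetMesh
end EdgeElement
end

noncomputable section
namespace EdgeElement

open MvPolynomial

lemma evalS_apply (p : Poly) (x : E3) : evalS p x = MvPolynomial.eval x.ofLp p := rfl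

lemma evalV_apply (u : VPoly) (x : E3) (i : Fin 3) : evalV u x i = evalS (u i) x := rfl

lemma hasFDerivAt_evalS (p : Poly) (x : E3) :
    HasFDerivAt (evalS p)
      (∑ i, evalS (pderiv i p) x • (EuclideanSpace.proj i : E3 →L[ℝ] ℝ)) x := by
  induction p using MvPolynomial.induction_on with
  | C a =>
    have : evalS (C a) = fun _ => a := by ext y; simp [evalS_apply]
    rw [this]
    refine (hasFDerivAt_const a x).congr_fderiv ?_
    ext v; simp [evalS_apply]
  | add p q hp hq =>
    rw [map_add]
    refine (hp.add hq).congr_fderiv ?_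
    ext v
    simp [evalS_apply, add_mul, Finset.sum_add_distrib]
  | mul_X p j hp =>
    have : evalS (p * X j) = fun y => evalS p y * (EuclideanSpace.proj j : E3 →L[ℝ] ℝ) y := by
      ext y; simp [evalS_apply]
    rw [this]
    refine (hp.mul (EuclideanSpace.proj j : E3 →L[ℝ] ℝ).hasFDerivAt).congr_fderiv ?_
    ext v
    simp only [evalS_apply, Derivation.leibniz, pderiv_X, smul_eq_mul, map_add, map_mul, eval_X,
      add_apply, smul_apply, sum_apply, add_mul, Finset.sum_add_distrib, PiLp.proj_apply,
      Finset.mul_sum]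
    congr 1
    · rw [Finset.sum_eq_single j] <;> simp +contextual
    · exact Finset.sum_congr rfl fun i _ => by ring

lemma contDiff_evalS (p : Poly) {n : WithTop ℕ∞} : ContDiff ℝ n (evalS p) := by
  induction p using MvPolynomial.induction_on with
  | C a =>
    have : evalS (C a) = fun _ => a := by ext y; simp [evalS_apply]
    rw [this]; exact contDiff_const
  | add p q hp hq => rw [map_add]; exact hp.add hq
  | mul_X p j hp =>
    have : evalS (p * X j) = fun y => evalS p y * (EuclideanSpace.proj j : E3 →L[ℝ] ℝ) y := by
      ext y; simp [evalS_apply]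
    rw [this]
    exact hp.mul (EuclideanSpace.proj j : E3 →L[ℝ] ℝ).contDiff

@[fun_prop]
lemma continuous_evalS (p : Poly) : Continuous (evalS p) := (contDiff_evalS p (n := 0)).continuous

@[fun_prop]
lemma continuous_evalV (u : VPoly) : Continuous (evalV u) :=
  (PiLp.continuous_toLp 2 _).comp (continuous_pi fun i => continuous_evalS (u i))

lemma fderiv_evalS (p : Poly) (x v : E3) :
    fderiv ℝ (evalS p) x v = ∑ i, evalS (pderiv i p) x * v i := by
  simp [(hasFDerivAt_evalS p x).fderiv]

lemma fderiv_evalS_eq_inner (p : Poly) (x v : E3) :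
    fderiv ℝ (evalS p) x v = inner ℝ (evalV (grad p) x) v := by
  rw [fderiv_evalS, PiLp.inner_apply]
  exact Finset.sum_congr rfl fun i _ => by simp [evalV_apply, grad, mul_comm]

/-- A polynomial is determined by its values on a nonempty open set. -/
lemma eq_zero_of_evalS_eq_zero {U : Set E3} (hU : IsOpen U) (hne : U.Nonempty) {p : Poly}
    (h : ∀ x ∈ U, evalS p x = 0) : p = 0 := by
  obtain ⟨x, hx⟩ := hne
  have hU' : IsOpen ((WithLp.toLp 2 : (Fin 3 → ℝ) → E3) ⁻¹' U) :=
    hU.preimage (PiLp.continuous_toLp 2 _)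
  obtain ⟨ε, hε, hball⟩ := Metric.isOpen_iff.1 hU' x.ofLp hx
  refine MvPolynomial.funext_set (fun i => Metric.ball (x.ofLp i) ε)
    (fun i => ?_) fun y hy => ?_
  · rw [Real.ball_eq_Ioo]
    exact Set.Ioo_infinite (by linarith)
  · have := h (WithLp.toLp 2 y) (hball ?_)
    · simpa [evalS_apply] using this
    · rw [ball_pi _ hε]
      exact hy

/-! ### Polynomial potentials -/

/-- `x · u`. -/
def radial : VPoly →ₗ[ℝ] Poly where
  toFun u := ∑ i, X i * u i
  map_add' u v := by simp [mul_add, Finset.sum_add_distrib]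
  map_smul' c u := by simp [Finset.smul_sum]

lemma radial_apply (u : VPoly) : radial u = ∑ i, X i * u i := rfl

lemma coeff_sum_X_mul_pderiv (p : Poly) (m : Fin 3 →₀ ℕ) :
    coeff m (∑ j, X j * pderiv j p) = (m.degree : ℝ) * coeff m p := by
  induction p using MvPolynomial.induction_on' with
  | monomial s a =>
    simp only [X_mul_pderiv_monomial, coeff_sum, coeff_smul, coeff_monomial]
    by_cases h : s = m
    · subst h
      simp [Finsupp.degree_eq_sum, Finset.sum_mul]
    · simp [h]
  | add p q hp hq => simp only [map_add, mul_add, Finset.sum_add_distrib, coeff_add, hp, hq]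

/-- A polynomial vector field with vanishing curl is the gradient of a polynomial, whose degree is
at most that of `x · u`. -/
lemma exists_grad_eq (u : VPoly) (hu : ∀ i j, pderiv i (u j) = pderiv j (u i)) :
    ∃ φ : Poly, grad φ = u ∧ φ.totalDegree ≤ (radial u).totalDegree := by
  classical
  let φ : Poly := ∑ s ∈ (radial u).support, monomial s (coeff s (radial u) / (s.degree : ℝ))
  have hcoeff : ∀ s, coeff s φ = coeff s (radial u) / (s.degree : ℝ) := by
    intro s
    simp only [φ, coeff_sum, coeff_monomial, Finset.sum_ite_eq', mem_support_iff]
    split_ifs with h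
    · rfl
    · rw [not_not] at h; simp [h]
  refine ⟨φ, ?_, ?_⟩
  · ext i m
    have h1 : pderiv i (radial u) = u i + ∑ j, X j * pderiv j (u i) := by
      simp only [radial_apply, map_sum, Derivation.leibniz, smul_eq_mul, Finset.sum_add_distrib,
        pderiv_X]
      rw [add_comm]
      congr 1
      · rw [Finset.sum_eq_single i] <;> simp +contextual
      · exact Finset.sum_congr rfl fun j _ => by rw [hu i j]
    have h2 := congrArg (coeff m) h1
    rw [coeff_add, coeff_sum_X_mul_pderiv, coeff_pderiv] at h2
    change coeff m (pderiv i φ) = _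
    rw [coeff_pderiv, hcoeff, div_mul_eq_mul_div, h2]
    have : ((m + Finsupp.single i 1).degree : ℝ) = m.degree + 1 := by
      simp [Finsupp.degree_single]
    rw [this]
    have : (0 : ℝ) < m.degree + 1 := by positivity
    field_simp
    ring
  · refine (totalDegree_le_of_support_subset fun s hs => ?_)
    rw [mem_support_iff, hcoeff] at hs
    rw [mem_support_iff]
    rintro h
    simp [h] at hs

lemma curl_eq_zero_iff (u : VPoly) :
    curl u = 0 ↔ ∀ i j, pderiv i (u j) = pderiv j (u i) := by
  constructor
  · intro h
    have h0 := sub_eq_zero.1 (congrFun h 0)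
    have h1 := sub_eq_zero.1 (congrFun h 1)
    have h2 := sub_eq_zero.1 (congrFun h 2)
    intro i j
    fin_cases i <;> fin_cases j
    exacts [rfl, h2, h1.symm, h2.symm, rfl, h0, h1, h0.symm, rfl]
  · intro h
    ext1 i
    fin_cases i
    · exact sub_eq_zero.2 (h 1 2)
    · exact sub_eq_zero.2 (h 2 0)
    · exact sub_eq_zero.2 (h 0 1)

/-! ### An affinely invariant space containing the Nédélec shape functions -/

/-- The polynomial fields `u` such that `u` and `x · u` have degree at most `k + 1`. -/
def shapeSpace (k : ℕ) : Submodule ℝ VPoly where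
  carrier := {u | (∀ i, (u i).totalDegree ≤ k + 1) ∧ (radial u).totalDegree ≤ k + 1}
  zero_mem' := by simp
  add_mem' := by
    rintro u v ⟨hu, hu'⟩ ⟨hv, hv'⟩
    refine ⟨fun i => (totalDegree_add _ _).trans (max_le (hu i) (hv i)), ?_⟩
    rw [map_add]
    exact (totalDegree_add _ _).trans (max_le hu' hv')
  smul_mem' := by
    rintro c u ⟨hu, hu'⟩
    refine ⟨fun i => (totalDegree_smul_le _ _).trans (hu i), ?_⟩
    rw [map_smul]
    exact (totalDegree_smul_le _ _).trans hu'

instance (k : ℕ) : FiniteDimensional ℝ (shapeSpace k) := by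
  let f : (Fin 3 → restrictTotalDegree (Fin 3) ℝ (k + 1)) →ₗ[ℝ] VPoly :=
    LinearMap.pi fun i => (Submodule.subtype _).comp (LinearMap.proj i)
  have : shapeSpace k ≤ LinearMap.range f := fun v hv =>
    ⟨fun i => ⟨v i, (mem_restrictTotalDegree _ _ _).2 (hv.1 i)⟩, by ext1 i; simp [f]⟩
  exact Submodule.finiteDimensional_of_le this

lemma totalDegree_mul_le {p q : Poly} {a b : ℕ} (hp : p.totalDegree ≤ a)
    (hq : q.totalDegree ≤ b) : (p * q).totalDegree ≤ a + b :=
  (totalDegree_mul _ _).trans (add_le_add hp hq)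

lemma totalDegree_sub_le {p q : Poly} {a : ℕ} (hp : p.totalDegree ≤ a)
    (hq : q.totalDegree ≤ a) : (p - q).totalDegree ≤ a :=
  (totalDegree_sub _ _).trans (max_le hp hq)

lemma totalDegree_sum_le {ι : Type*} {s : Finset ι} {f : ι → Poly} {a : ℕ}
    (h : ∀ i ∈ s, (f i).totalDegree ≤ a) : (∑ i ∈ s, f i).totalDegree ≤ a :=
  totalDegree_finsetSum_le h

lemma nedelec_subset_shapeSpace (k : ℕ) : nedelec k ⊆ shapeSpace k := by
  rintro u ⟨p, q, hp, hq, rfl⟩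
  have hX : ∀ i, (X i : Poly).totalDegree ≤ 1 := fun i => (totalDegree_X i).le
  have hXq : ∀ i j, (X i * q j : Poly).totalDegree ≤ k + 1 := fun i j => by
    rw [add_comm]; exact totalDegree_mul_le (hX i) (hq j)
  have hXp : ∀ i j, (X i * p j : Poly).totalDegree ≤ k + 1 := fun i j => by
    rw [add_comm]; exact totalDegree_mul_le (hX i) (hp j)
  refine ⟨fun i => (totalDegree_add _ _).trans (max_le ((hp i).trans k.le_succ) ?_), ?_⟩
  · fin_cases i <;> simp only [cross_apply] <;> exact totalDegree_sub_le (hXq _ _) (hXq _ _)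
  · have : radial (p + (fun i => (X i : Poly)) ⨯₃ q) = radial p := by
      simp only [radial_apply, Fin.sum_univ_three, cross_apply, Pi.add_apply,
        Matrix.cons_val_zero, Matrix.cons_val_one, Matrix.cons_val]
      ring
    rw [this]
    exact totalDegree_sum_le fun i _ => hXp i i

/-! ### Pull-back under affine maps -/

/-- The linear map with `L e_i = w_{i+1} - w_0`. -/
def simplexLin (w : Fin 4 → E3) : E3 →L[ℝ] E3 :=
  ∑ i : Fin 3, (EuclideanSpace.proj i : E3 →L[ℝ] ℝ).smulRight (w i.succ - w 0)

lemma simplexLin_apply (w : Fin 4 → E3) (x : E3) :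
    simplexLin w x = ∑ i : Fin 3, x i • (w i.succ - w 0) := by
  simp [simplexLin]

/-- The affine map sending the reference simplex to the simplex with vertices `w`. -/
def simplexMap (w : Fin 4 → E3) (x : E3) : E3 := w 0 + simplexLin w x

/-- The coordinate polynomials of an affine map. -/
def affineSubst (b : E3) (A : Fin 3 → E3) : Fin 3 → Poly :=
  fun j => C (b j) + ∑ i, C (A i j) * X i

lemma eval_affineSubst (b : E3) (A : Fin 3 → E3) (x : E3) (j : Fin 3) :
    eval x.ofLp (affineSubst b A j) = (b + ∑ i, x i • A i) j := by
  simp [affineSubst, mul_comm]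

lemma totalDegree_affineSubst (b : E3) (A : Fin 3 → E3) (j : Fin 3) :
    (affineSubst b A j).totalDegree ≤ 1 := by
  refine (totalDegree_add _ _).trans (max_le (by simp) (totalDegree_sum_le fun i _ => ?_))
  exact totalDegree_mul_le (a := 0) (b := 1) (by simp) (totalDegree_X i).le

lemma totalDegree_bind₁_le {f : Fin 3 → Poly} (hf : ∀ j, (f j).totalDegree ≤ 1) (p : Poly) :
    (bind₁ f p).totalDegree ≤ p.totalDegree := by
  rw [bind₁, aeval_def, eval₂_eq]
  refine totalDegree_sum_le fun s hs => ?_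
  rw [algebraMap_eq]
  refine (totalDegree_mul_le (a := 0) (b := s.degree) (by simp) ?_).trans ?_
  · refine (totalDegree_finsetProd _ _).trans ?_
    rw [Finsupp.degree_apply]
    refine Finset.sum_le_sum fun j _ => (totalDegree_pow _ _).trans ?_
    exact (Nat.mul_le_mul_left _ (hf j)).trans (by simp)
  · rw [zero_add]
    exact le_totalDegree hs

/-- Pull-back of polynomials under `simplexMap w`. -/
def pullS (w : Fin 4 → E3) : Poly →ₐ[ℝ] Poly :=
  bind₁ (affineSubst (w 0) fun i => w i.succ - w 0)

lemma evalS_bind₁ (b : E3) (A : Fin 3 → E3) (p : Poly) (x : E3) :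
    evalS (bind₁ (affineSubst b A) p) x = evalS p (b + ∑ i, x i • A i) := by
  rw [evalS_apply, evalS_apply, ← MvPolynomial.coe_aeval_eq_eval, RingHom.coe_coe, aeval_bind₁,
    ← MvPolynomial.coe_aeval_eq_eval, RingHom.coe_coe]
  congr 2
  ext j
  rw [← eval_affineSubst, ← MvPolynomial.coe_aeval_eq_eval, RingHom.coe_coe]

lemma evalS_pullS (w : Fin 4 → E3) (p : Poly) (x : E3) :
    evalS (pullS w p) x = evalS p (simplexMap w x) := by
  rw [pullS, evalS_bind₁, simplexMap, simplexLin_apply]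

lemma totalDegree_pullS_le (w : Fin 4 → E3) (p : Poly) :
    (pullS w p).totalDegree ≤ p.totalDegree :=
  totalDegree_bind₁_le (totalDegree_affineSubst _ _) p

/-- Covariant pull-back of polynomial vector fields under `simplexMap w`. -/
def pullV (w : Fin 4 → E3) : VPoly →ₗ[ℝ] VPoly where
  toFun u i := ∑ j, C ((w i.succ - w 0) j) * pullS w (u j)
  map_add' u v := by ext1 i; simp [mul_add, Finset.sum_add_distrib]
  map_smul' c u := by ext1 i; simp [Finset.smul_sum]

lemma pullV_apply (w : Fin 4 → E3) (u : VPoly) (i : Fin 3) :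
    pullV w u i = ∑ j, C ((w i.succ - w 0) j) * pullS w (u j) := rfl

lemma evalV_pullV_apply (w : Fin 4 → E3) (u : VPoly) (x : E3) (i : Fin 3) :
    evalV (pullV w u) x i = inner ℝ (evalV u (simplexMap w x)) (w i.succ - w 0) := by
  rw [evalV_apply, pullV_apply, map_sum, Finset.sum_apply, PiLp.inner_apply]
  refine Finset.sum_congr rfl fun j _ => ?_
  rw [evalV_apply, ← evalS_pullS]
  simp [evalS_apply]

lemma inner_evalV_pullV (w : Fin 4 → E3) (u : VPoly) (x v : E3) :
    inner ℝ (evalV (pullV w u) x) v = inner ℝ (evalV u (simplexMap w x)) (simplexLin w v) := by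
  rw [simplexLin_apply, inner_sum, PiLp.inner_apply]
  refine Finset.sum_congr rfl fun i _ => ?_
  rw [evalV_pullV_apply, inner_smul_right]
  simp

lemma pderiv_pullS (w : Fin 4 → E3) (p : Poly) (i : Fin 3) :
    pderiv i (pullS w p) = ∑ j, C ((w i.succ - w 0) j) * pullS w (pderiv j p) := by
  induction p using MvPolynomial.induction_on with
  | C a => simp [pullS]
  | add p q hp hq => simp only [map_add, hp, hq, mul_add, Finset.sum_add_distrib]
  | mul_X p l hp =>
    have hX : pderiv i (pullS w (X l)) = C ((w i.succ - w 0) l) := by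
      simp only [pullS, bind₁_X_right, affineSubst, map_add, pderiv_C, map_sum, zero_add,
        pderiv_C_mul, pderiv_X]
      rw [Finset.sum_eq_single i] <;> simp +contextual
    have hj : ∀ j, pullS w (pderiv j (p * X l)) =
        pullS w p * (if l = j then 1 else 0) + pullS w (X l) * pullS w (pderiv j p) := by
      intro j
      rw [Derivation.leibniz, pderiv_X, smul_eq_mul, smul_eq_mul, map_add, map_mul, map_mul,
        Pi.single_apply]
      split_ifs <;> simp
    rw [map_mul, Derivation.leibniz, hX, hp, smul_eq_mul, smul_eq_mul, Finset.mul_sum]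
    simp_rw [hj, mul_add]
    rw [Finset.sum_add_distrib]
    refine congrArg₂ (· + ·) ?_ ?_
    · simp_rw [mul_ite, mul_one, mul_zero]
      rw [Finset.sum_ite_eq, if_pos (Finset.mem_univ _), mul_comm]
    · exact Finset.sum_congr rfl fun j _ => mul_left_comm _ _ _

lemma grad_pullS (w : Fin 4 → E3) (p : Poly) : grad (pullS w p) = pullV w (grad p) := by
  ext1 i
  exact pderiv_pullS w p i

/-- The exterior derivative transforms covariantly. -/
lemma pderiv_pullV_sub (w : Fin 4 → E3) (u : VPoly) (i j : Fin 3) :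
    pderiv i (pullV w u j) - pderiv j (pullV w u i) =
      ∑ a, ∑ b, C ((w i.succ - w 0) a * (w j.succ - w 0) b) *
        pullS w (pderiv a (u b) - pderiv b (u a)) := by
  have h : ∀ i j : Fin 3, pderiv i (pullV w u j) =
      ∑ a, ∑ b, C ((w i.succ - w 0) a * (w j.succ - w 0) b) * pullS w (pderiv a (u b)) := by
    intro i j
    simp only [pullV_apply, map_sum, pderiv_C_mul, pderiv_pullS, Finset.mul_sum]
    rw [Finset.sum_comm]
    refine Finset.sum_congr rfl fun a _ => Finset.sum_congr rfl fun b _ => ?_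
    rw [C_mul]; ring
  rw [h i j, h j i, Finset.sum_comm (s := Finset.univ) (t := Finset.univ)
    (f := fun a b => C ((w j.succ - w 0) a * (w i.succ - w 0) b) * pullS w (pderiv a (u b))),
    ← Finset.sum_sub_distrib]
  refine Finset.sum_congr rfl fun a _ => ?_
  rw [← Finset.sum_sub_distrib]
  refine Finset.sum_congr rfl fun b _ => ?_
  rw [map_sub, mul_sub, mul_comm ((w j.succ - w 0) b)]

lemma pullV_mem_shapeSpace (w : Fin 4 → E3) {k : ℕ} {u : VPoly} (hu : u ∈ shapeSpace k) :
    pullV w u ∈ shapeSpace k := by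
  have hC : ∀ (c : ℝ) (p : Poly), p.totalDegree ≤ k + 1 → (C c * p).totalDegree ≤ k + 1 :=
    fun c p hp => (totalDegree_mul_le (a := 0) (by simp) hp).trans (by simp)
  have hS : ∀ p : Poly, p.totalDegree ≤ k + 1 → (pullS w p).totalDegree ≤ k + 1 :=
    fun p hp => (totalDegree_pullS_le w p).trans hp
  refine ⟨fun i => totalDegree_sum_le fun j _ => hC _ _ (hS _ (hu.1 j)), ?_⟩
  have h1 : radial (pullV w u) = pullS w (radial u) - ∑ j, C (w 0 j) * pullS w (u j) := by
    have : pullS w (radial u) = ∑ j, affineSubst (w 0) (fun i => w i.succ - w 0) j *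
        pullS w (u j) := by
      simp [radial_apply, pullS]
    rw [this, ← Finset.sum_sub_distrib]
    simp only [radial_apply, pullV_apply, affineSubst, add_mul, add_sub_cancel_left,
      Finset.mul_sum, Finset.sum_mul]
    rw [Finset.sum_comm]
    exact Finset.sum_congr rfl fun a _ => Finset.sum_congr rfl fun b _ => by ring
  rw [h1]
  exact totalDegree_sub_le (hS _ hu.2) (totalDegree_sum_le fun j _ => hC _ _ (hS _ (hu.1 j)))

/-- Polynomials on the reference simplex are pull-backs. -/
lemma exists_pullS_eq (w : Fin 4 → E3) (hw : Function.Bijective (simplexLin w)) (q : Poly) :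
    ∃ p : Poly, pullS w p = q ∧ p.totalDegree ≤ q.totalDegree := by
  let e : E3 ≃ₗ[ℝ] E3 := LinearEquiv.ofBijective (simplexLin w).toLinearMap hw
  refine ⟨bind₁ (affineSubst (-(e.symm (w 0))) fun i => e.symm (EuclideanSpace.single i 1)) q, ?_,
    totalDegree_bind₁_le (totalDegree_affineSubst _ _) q⟩
  rw [← sub_eq_zero]
  refine eq_zero_of_evalS_eq_zero isOpen_univ Set.univ_nonempty fun x _ => ?_
  have hsum : ∀ y : E3, ∑ i, y i • e.symm (EuclideanSpace.single i 1) = e.symm y := by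
    intro y
    simp_rw [← map_smul, ← map_sum]
    congr 1
    ext j
    simp [Finset.sum_apply, Pi.single_apply]
  have hx : e.symm (simplexLin w x) = x := e.symm_apply_apply x
  rw [map_sub, Pi.sub_apply, evalS_pullS, evalS_bind₁, hsum, simplexMap, map_add, hx]
  simp

end EdgeElement

namespace EdgeElement

open MvPolynomial Topology

lemma tsupport_subset_of_forall {V W : Type*} [Zero V] [Zero W] {f : E3 → V} {g : E3 → W}
    (h : ∀ y, g y = 0 → f y = 0) : tsupport f ⊆ tsupport g :=
  closure_mono fun y hy h' => hy (h y h')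

/-! ### Integrals of derivatives over half-spaces -/

lemma continuous_fderiv_apply_const {g : E3 → ℝ} (hg : ContDiff ℝ (⊤ : ℕ∞) g) (v : E3) :
    Continuous fun y => fderiv ℝ g y v :=
  (hg.continuous_fderiv (by simp)).clm_apply continuous_const

lemma integrable_fderiv_apply {g : E3 → ℝ} (hg : ContDiff ℝ (⊤ : ℕ∞) g)
    (hc : HasCompactSupport g) (v : E3) : Integrable fun y => fderiv ℝ g y v :=
  (continuous_fderiv_apply_const hg v).integrable_of_hasCompactSupport (hc.fderiv_apply (𝕜 := ℝ) v)

lemma hasDerivAt_setIntegral_translate {g : E3 → ℝ} (hg : ContDiff ℝ (⊤ : ℕ∞) g)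
    (hc : HasCompactSupport g) (S : Set E3) (v : E3) (t₀ : ℝ) :
    HasDerivAt (fun t : ℝ => ∫ y in S, g (y + t • v))
      (∫ y in S, fderiv ℝ g (y + t₀ • v) v) t₀ := by
  have hcont := continuous_fderiv_apply_const hg v
  obtain ⟨M, hM⟩ := (hc.fderiv_apply (𝕜 := ℝ) v).exists_bound_of_continuous hcont
  have hMnn : 0 ≤ M := (norm_nonneg _).trans (hM 0)
  let K : Set E3 := (fun z : E3 × ℝ => z.1 - z.2 • v) '' (tsupport g ×ˢ Icc (t₀ - 1) (t₀ + 1))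
  have hK : IsCompact K := (IsCompact.prod hc isCompact_Icc).image (by fun_prop)
  have hint : ∀ t : ℝ, Integrable (fun y => g (y + t • v)) := fun t =>
    (hg.continuous.integrable_of_hasCompactSupport hc).comp_add_right _
  refine (hasDerivAt_integral_of_dominated_loc_of_deriv_le (μ := volume.restrict S)
    (F := fun t y => g (y + t • v)) (F' := fun t y => fderiv ℝ g (y + t • v) v)
    (bound := K.indicator fun _ => M) (s := Metric.ball t₀ 1)
    (Metric.ball_mem_nhds _ one_pos) ?_ ?_ ?_ ?_ ?_ ?_).2
  · exact Filter.Eventually.of_forall fun t => (hint t).aestronglyMeasurable.restrict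
  · exact (hint t₀).restrict
  · exact (hcont.comp (by fun_prop : Continuous fun y => y + t₀ • v)).aestronglyMeasurable
  · refine Filter.Eventually.of_forall fun y t ht => ?_
    by_cases hy : y + t • v ∈ tsupport g
    · have hyK : y ∈ K := by
        refine ⟨(y + t • v, t), ⟨hy, ?_⟩, by simp⟩
        rw [Metric.mem_ball, Real.dist_eq, abs_lt] at ht
        constructor <;> linarith [ht.1, ht.2]
      rw [indicator_of_mem hyK]
      exact hM _
    · have : fderiv ℝ g (y + t • v) = 0 := by
        by_contra h
        exact hy (support_fderiv_subset ℝ h)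
      simp only [this, zero_apply, norm_zero]
      exact indicator_nonneg (fun _ _ => hMnn) _
  · refine ((integrable_indicator_iff hK.measurableSet).2 ?_).restrict
    exact integrableOn_const hK.measure_lt_top.ne
  · refine Filter.Eventually.of_forall fun y t _ => ?_
    have h1 : HasDerivAt (fun t : ℝ => y + t • v) v t := by
      simpa using ((hasDerivAt_id t).smul_const v).const_add y
    exact ((hg.differentiable (by simp)) (y + t • v)).hasFDerivAt.comp_hasDerivAt t h1

/-- The integral of a directional derivative vanishes over sets which are invariant under
translation in this direction. -/
lemma setIntegral_fderiv_eq_zero {g : E3 → ℝ} (hg : ContDiff ℝ (⊤ : ℕ∞) g)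
    (hc : HasCompactSupport g) {S : Set E3} (hS : MeasurableSet S) {v : E3}
    (hv : ∀ (t : ℝ) (y : E3), y + t • v ∈ S ↔ y ∈ S) : ∫ y in S, fderiv ℝ g y v = 0 := by
  have h := hasDerivAt_setIntegral_translate hg hc S v 0
  have hconst : (fun t : ℝ => ∫ y in S, g (y + t • v)) = fun _ => ∫ y in S, g y := by
    ext t
    rw [← integral_indicator hS, ← integral_indicator hS,
      ← integral_add_right_eq_self (S.indicator g) (t • v)]
    congr 1
    ext y
    by_cases hy : y ∈ S
    · rw [indicator_of_mem hy, indicator_of_mem ((hv t y).2 hy)]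
    · rw [indicator_of_notMem hy, indicator_of_notMem fun h' => hy ((hv t y).1 h')]
  rw [hconst] at h
  simpa using h.unique (hasDerivAt_const _ _)

lemma integral_fderiv_eq_zero {g : E3 → ℝ} (hg : ContDiff ℝ (⊤ : ℕ∞) g)
    (hc : HasCompactSupport g) (v : E3) : ∫ y, fderiv ℝ g y v = 0 := by
  simpa using setIntegral_fderiv_eq_zero hg hc MeasurableSet.univ (v := v) (by simp)

/-- The open half-space `⟨n, y⟩ > c`. -/
def halfSpace (n : E3) (c : ℝ) : Set E3 := {y | c < inner ℝ n y}

lemma isOpen_halfSpace (n : E3) (c : ℝ) : IsOpen (halfSpace n c) :=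
  isOpen_lt continuous_const (by fun_prop)

/-- Near a point of its boundary, a half-space has test functions whose normal derivative has
nonzero integral. -/
lemma exists_halfSpace_integral_ne_zero {n : E3} (hn : n ≠ 0) {c : ℝ} {U : Set E3}
    (hU : IsOpen U) {x : E3} (hx : x ∈ U) (hxc : inner ℝ n x = c) :
    ∃ g : E3 → ℝ, ContDiff ℝ (⊤ : ℕ∞) g ∧ HasCompactSupport g ∧ tsupport g ⊆ U ∧
      ∫ y in halfSpace n c, fderiv ℝ g y n ≠ 0 := by
  by_contra! hall
  have hn0 : 0 < ‖n‖ := norm_pos_iff.2 hn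
  obtain ⟨ε, hε, hball⟩ := Metric.isOpen_iff.1 hU x hx
  let f : ContDiffBump x := ⟨ε / 4, ε / 2, by linarith, by linarith⟩
  have hf : ContDiff ℝ (⊤ : ℕ∞) f := f.contDiff
  set δ : ℝ := ε / (4 * ‖n‖) with hδ
  have hδ0 : 0 < δ := by positivity
  have hzero : ∀ t ∈ Icc (0 : ℝ) δ, ∫ y in halfSpace n c, fderiv ℝ f (y + t • n) n = 0 := by
    intro t ht
    have hts : tsupport (fun y => f (y + t • n)) ⊆ U := by
      refine (closure_mono (t := Metric.closedBall (x - t • n) (ε / 2)) ?_).trans ?_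
      · intro y hy
        have hy' : y + t • n ∈ Function.support f := hy
        rw [f.support_eq, Metric.mem_ball] at hy'
        rw [Metric.mem_closedBall, dist_eq_norm]
        rw [dist_eq_norm] at hy'
        have : y - (x - t • n) = y + t • n - x := by abel
        rw [this]
        exact hy'.le
      · rw [Metric.isClosed_closedBall.closure_eq]
        refine Subset.trans ?_ hball
        refine Metric.closedBall_subset_ball' ?_
        have h1 : dist (x - t • n) x = t * ‖n‖ := by
          rw [dist_eq_norm]
          simp [norm_smul, abs_of_nonneg ht.1]
        have h2 : t * ‖n‖ ≤ ε / 4 := by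
          calc t * ‖n‖ ≤ δ * ‖n‖ := by gcongr; exact ht.2
            _ = ε / 4 := by rw [hδ]; field_simp
        rw [h1]
        linarith
    have hgt : ContDiff ℝ (⊤ : ℕ∞) (fun y => f (y + t • n)) :=
      hf.comp (contDiff_id.add contDiff_const)
    have hct : HasCompactSupport (fun y => f (y + t • n)) :=
      f.hasCompactSupport.comp_homeomorph (Homeomorph.addRight (t • n))
    have := hall _ hgt hct hts
    simpa only [fderiv_comp_add_right] using this
  have hconst := constant_of_has_deriv_right_zero
    (f := fun t : ℝ => ∫ y in halfSpace n c, f (y + t • n)) (a := 0) (b := δ)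
    (fun t _ => (hasDerivAt_setIntegral_translate hf f.hasCompactSupport _ n t).continuousAt
      |>.continuousWithinAt)
    (fun t ht => by
      have := hasDerivAt_setIntegral_translate hf f.hasCompactSupport (halfSpace n c) n t
      rw [hzero t ⟨ht.1, ht.2.le⟩] at this
      exact this.hasDerivWithinAt) δ ⟨hδ0.le, le_rfl⟩
  simp only [zero_smul, add_zero] at hconst
  -- the translate of the half-space is smaller by a slab
  have hint : Integrable f := hf.continuous.integrable_of_hasCompactSupport f.hasCompactSupport
  have hshift : ∫ y in halfSpace n c, f (y + δ • n) =
      ∫ y in halfSpace n (c + δ * ‖n‖ ^ 2), f y := by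
    rw [← integral_indicator (isOpen_halfSpace _ _).measurableSet,
      ← integral_indicator (isOpen_halfSpace _ _).measurableSet,
      ← integral_add_right_eq_self ((halfSpace n (c + δ * ‖n‖ ^ 2)).indicator f) (δ • n)]
    congr 1
    ext y
    have : y + δ • n ∈ halfSpace n (c + δ * ‖n‖ ^ 2) ↔ y ∈ halfSpace n c := by
      simp only [halfSpace, mem_ofPred_eq, inner_add_right, inner_smul_right,
        real_inner_self_eq_norm_sq]
      constructor <;> intro h <;> linarith
    by_cases hy : y ∈ halfSpace n c
    · rw [indicator_of_mem hy, indicator_of_mem (this.2 hy)]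
    · rw [indicator_of_notMem hy, indicator_of_notMem fun h' => hy (this.1 h')]
  have hsub : halfSpace n (c + δ * ‖n‖ ^ 2) ⊆ halfSpace n c := fun y hy => by
    have : c + δ * ‖n‖ ^ 2 < inner ℝ n y := hy
    have : 0 < δ * ‖n‖ ^ 2 := by positivity
    change c < inner ℝ n y
    linarith
  have hdiff := setIntegral_sdiff (isOpen_halfSpace n (c + δ * ‖n‖ ^ 2)).measurableSet
    hint.integrableOn hsub (μ := volume)
  rw [← hshift, hconst, sub_self] at hdiff
  have hae := (setIntegral_eq_zero_iff_of_nonneg_ae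
    (Filter.Eventually.of_forall fun y => f.nonneg) hint.integrableOn).1 hdiff
  have hpos : 0 < volume ({y : E3 | c < inner ℝ n y ∧ inner ℝ n y < c + δ * ‖n‖ ^ 2} ∩
      Metric.ball x (ε / 2)) := by
    refine IsOpen.measure_pos _ ?_ ?_
    · exact ((isOpen_halfSpace n c).inter (isOpen_lt
        (f := fun y : E3 => inner ℝ n y) (by fun_prop) continuous_const)).inter Metric.isOpen_ball
    · refine ⟨x + (δ / 2) • n, ⟨?_, ?_⟩, ?_⟩
      · rw [inner_add_right, inner_smul_right, hxc, real_inner_self_eq_norm_sq]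
        have : 0 < δ / 2 * ‖n‖ ^ 2 := by positivity
        linarith
      · rw [inner_add_right, inner_smul_right, hxc, real_inner_self_eq_norm_sq]
        have : 0 < δ / 2 * ‖n‖ ^ 2 := by positivity
        linarith
      · rw [Metric.mem_ball, dist_eq_norm, add_sub_cancel_left, norm_smul, Real.norm_eq_abs,
          abs_of_pos (by positivity), hδ]
        have : ε / (4 * ‖n‖) / 2 * ‖n‖ = ε / 8 := by field_simp; norm_num
        rw [this]; linarith
  refine hpos.ne' ?_
  rw [Filter.EventuallyEq, ae_restrict_iff'
    ((isOpen_halfSpace _ _).measurableSet.diff (isOpen_halfSpace _ _).measurableSet)] at hae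
  refine measure_mono_null ?_ hae
  rintro y ⟨⟨hy1, hy2⟩, hy3⟩ hy4
  have h0 := hy4 ⟨hy1, fun h => lt_asymm hy2 h⟩
  have : y ∈ Function.support f := by rw [f.support_eq]; exact hy3
  exact this h0

/-! ### Tangential continuity of fields with a square integrable curl -/

/-- The divergence of a polynomial vector field. -/
def divP (p : VPoly) : Poly := ∑ i, pderiv i (p i)

/-- The cross product of a constant vector and a polynomial vector field. -/
def crossP (τ : E3) (p : VPoly) : VPoly := (fun i => C (τ i)) ⨯₃ p

lemma evalV_crossP (τ : E3) (p : VPoly) (x : E3) :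
    evalV (crossP τ p) x = WithLp.toLp 2 (τ.ofLp ⨯₃ (evalV p x).ofLp) := by
  ext i
  fin_cases i <;> simp [evalV_apply, evalS_apply, crossP, cross_apply]

lemma sum_smul_single (v : E3) : ∑ i, v i • (EuclideanSpace.single i 1 : E3) = v := by
  ext j
  simp [Finset.sum_apply, Pi.single_apply]

lemma fderiv_apply_eq_sum (g : E3 → ℝ) (x v : E3) :
    fderiv ℝ g x v = ∑ i, v i * fderiv ℝ g x (EuclideanSpace.single i 1) := by
  conv_lhs => rw [← sum_smul_single v]
  simp

lemma inner_classicalCurl_smul {χ : E3 → ℝ} (hχ : Differentiable ℝ χ) (τ v x : E3) :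
    inner ℝ v (classicalCurl (fun y => χ y • τ) x) =
      fderiv ℝ χ x (WithLp.toLp 2 (τ.ofLp ⨯₃ v.ofLp)) := by
  have h : ∀ i j : Fin 3, fderiv ℝ (fun y => χ y • τ) x (EuclideanSpace.single j 1) i =
      fderiv ℝ χ x (EuclideanSpace.single j 1) * τ i := by
    intro i j
    rw [fderiv_smul_const (hχ x)]
    simp
  rw [fderiv_apply_eq_sum]
  simp only [classicalCurl, h, PiLp.inner_apply, Fin.sum_univ_three, cross_apply]
  simp
  ring

lemma classicalCurl_of_notMem_tsupport {ψ : E3 → E3} {x : E3} (hx : x ∉ tsupport ψ) :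
    classicalCurl ψ x = 0 := by
  have : fderiv ℝ ψ x = 0 := by
    by_contra h
    exact hx (support_fderiv_subset ℝ h)
  ext i
  fin_cases i <;> simp [classicalCurl, this]

lemma IsWeakCurl.mono {U Ω : Set E3} (hU : U ⊆ Ω) (hΩ : MeasurableSet Ω) {u w : E3 → E3}
    (h : IsWeakCurl Ω u w) : IsWeakCurl U u w := by
  intro ψ h1 h2 h3
  have h4 := h ψ h1 h2 (h3.trans hU)
  rw [setIntegral_eq_of_subset_of_forall_sdiff_eq_zero hΩ hU,
    setIntegral_eq_of_subset_of_forall_sdiff_eq_zero hΩ hU] at h4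
  · exact h4
  · intro x hx
    rw [image_eq_zero_of_notMem_tsupport fun h => hx.2 (h3 h), inner_zero_right]
  · intro x hx
    rw [classicalCurl_of_notMem_tsupport fun h => hx.2 (h3 h), inner_zero_right]

variable {n : E3} {c : ℝ}

lemma halfSpace_add_iff {v : E3} (hv : inner ℝ n v = 0) (t : ℝ) (y : E3) :
    y + t • v ∈ halfSpace n c ↔ y ∈ halfSpace n c := by
  simp [halfSpace, inner_add_right, inner_smul_right, hv]

lemma volume_hyperplane (hn : n ≠ 0) (c : ℝ) : volume {y : E3 | inner ℝ n y = c} = 0 := by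
  let s : AffineSubspace ℝ E3 := AffineSubspace.mk' ((c / ‖n‖ ^ 2) • n) (ℝ ∙ n)ᗮ
  have hn0 : ‖n‖ ^ 2 ≠ 0 := by simpa using hn
  have hmem : ∀ y, y ∈ s ↔ inner ℝ n y = c := by
    intro y
    rw [AffineSubspace.mem_mk', vsub_eq_sub, Submodule.mem_orthogonal_singleton_iff_inner_right,
      inner_sub_right, inner_smul_right, real_inner_self_eq_norm_sq, div_mul_cancel₀ _ hn0,
      sub_eq_zero]
  have hs : s ≠ ⊤ := by
    intro h
    have h1 : (0 : E3) ∈ s := h ▸ AffineSubspace.mem_top _ _ _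
    have h2 : n ∈ s := h ▸ AffineSubspace.mem_top _ _ _
    rw [hmem] at h1 h2
    rw [inner_zero_right] at h1
    rw [real_inner_self_eq_norm_sq, ← h1] at h2
    exact hn0 h2
  have := Measure.addHaar_affineSubspace volume s hs
  convert this using 2
  ext y
  exact (hmem y).symm

lemma contDiff_mul_evalS {χ : E3 → ℝ} (hχ : ContDiff ℝ (⊤ : ℕ∞) χ) (p : Poly) :
    ContDiff ℝ (⊤ : ℕ∞) (fun y => χ y * evalS p y) := hχ.mul (contDiff_evalS p)

lemma div_mul_eq_sum {χ : E3 → ℝ} (hχ : ContDiff ℝ (⊤ : ℕ∞) χ) (p : VPoly) (y : E3) :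
    fderiv ℝ χ y (evalV p y) + χ y * evalS (divP p) y =
      ∑ i, fderiv ℝ (fun y => χ y * evalS (p i) y) y (EuclideanSpace.single i 1) := by
  have h : ∀ i, fderiv ℝ (fun y => χ y * evalS (p i) y) y (EuclideanSpace.single i 1) =
      χ y * evalS (pderiv i (p i)) y +
        evalS (p i) y * fderiv ℝ χ y (EuclideanSpace.single i 1) := by
    intro i
    rw [fderiv_fun_mul (hχ.differentiable (by simp) y)
      ((contDiff_evalS (p i) (n := 1)).differentiable (by simp) y)]
    simp [fderiv_evalS]
  simp only [h, Finset.sum_add_distrib]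
  rw [fderiv_apply_eq_sum, add_comm, divP, map_sum, Finset.sum_apply, Finset.mul_sum]
  rfl

/-- Only the normal component contributes to the integral of a divergence over a half-space. -/
lemma setIntegral_halfSpace_div (hn : n ≠ 0) {χ : E3 → ℝ} (hχ : ContDiff ℝ (⊤ : ℕ∞) χ)
    (hc : HasCompactSupport χ) (p : VPoly) :
    ∫ y in halfSpace n c, (fderiv ℝ χ y (evalV p y) + χ y * evalS (divP p) y) =
      (‖n‖ ^ 2)⁻¹ * ∫ y in halfSpace n c,
        fderiv ℝ (fun y => χ y * inner ℝ n (evalV p y)) y n := by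
  have hn0 : ‖n‖ ^ 2 ≠ 0 := by simpa using hn
  have hG := fun i => contDiff_mul_evalS hχ (p i)
  have hGc : ∀ i, HasCompactSupport (fun y => χ y * evalS (p i) y) := fun i => hc.mul_right
  simp only [div_mul_eq_sum hχ]
  rw [integral_finsetSum _ fun i _ => (integrable_fderiv_apply (hG i) (hGc i) _).restrict]
  have h1 : ∀ i, ∫ y in halfSpace n c,
      fderiv ℝ (fun y => χ y * evalS (p i) y) y (EuclideanSpace.single i 1) =
      (‖n‖ ^ 2)⁻¹ * (n i * ∫ y in halfSpace n c,
        fderiv ℝ (fun y => χ y * evalS (p i) y) y n) := by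
    intro i
    set t : E3 := EuclideanSpace.single i 1 - ((‖n‖ ^ 2)⁻¹ * n i) • n with ht
    have htn : inner ℝ n t = 0 := by
      rw [ht, inner_sub_right, inner_smul_right, real_inner_self_eq_norm_sq,
        EuclideanSpace.inner_single_right]
      field_simp
      simp
    have h2 := setIntegral_fderiv_eq_zero (hG i) (hGc i)
      (isOpen_halfSpace n c).measurableSet (halfSpace_add_iff htn)
    simp only [ht, map_sub, map_smul, smul_eq_mul] at h2
    rw [integral_sub (integrable_fderiv_apply (hG i) (hGc i) _).restrict
      ((integrable_fderiv_apply (hG i) (hGc i) _).restrict.const_mul _),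
      integral_const_mul, sub_eq_zero] at h2
    rw [h2, mul_assoc]
  simp only [h1]
  rw [← Finset.mul_sum]
  congr 1
  simp only [← integral_const_mul]
  rw [← integral_finsetSum _ fun i _ =>
    ((integrable_fderiv_apply (hG i) (hGc i) n).restrict.const_mul _)]
  refine integral_congr_ae (Filter.Eventually.of_forall fun y => ?_)
  have h3 : (fun y => χ y * inner ℝ n (evalV p y)) =
      fun y => ∑ i, n i * (χ y * evalS (p i) y) := by
    ext y
    rw [PiLp.inner_apply, Finset.mul_sum]
    refine Finset.sum_congr rfl fun i _ => ?_
    simp only [evalV_apply, RCLike.inner_apply, conj_trivial]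
    ring
  simp only [h3]
  rw [fderiv_fun_sum fun i _ => ((hG i).differentiable (by simp) y).const_mul _]
  simp only [sum_apply]
  refine Finset.sum_congr rfl fun i _ => ?_
  rw [fderiv_const_mul ((hG i).differentiable (by simp) y)]
  rfl

lemma integral_div_eq_zero {χ : E3 → ℝ} (hχ : ContDiff ℝ (⊤ : ℕ∞) χ)
    (hc : HasCompactSupport χ) (p : VPoly) :
    ∫ y, (fderiv ℝ χ y (evalV p y) + χ y * evalS (divP p) y) = 0 := by
  have hG := fun i => contDiff_mul_evalS hχ (p i)
  have hGc : ∀ i, HasCompactSupport (fun y => χ y * evalS (p i) y) := fun i => hc.mul_right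
  simp only [div_mul_eq_sum hχ]
  rw [integral_finsetSum _ fun i _ => (integrable_fderiv_apply (hG i) (hGc i) _)]
  exact Finset.sum_eq_zero fun i _ => integral_fderiv_eq_zero (hG i) (hGc i) _

lemma inner_eq_zero_of_forall_cross {j t : E3} (hn : n ≠ 0) (ht : inner ℝ n t = 0)
    (h : ∀ τ : E3, inner ℝ n (WithLp.toLp 2 (τ.ofLp ⨯₃ j.ofLp)) = 0) : inner ℝ j t = 0 := by
  have h0 := h (EuclideanSpace.single 0 1)
  have h1 := h (EuclideanSpace.single 1 1)
  have h2 := h (EuclideanSpace.single 2 1)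
  simp [PiLp.inner_apply, Fin.sum_univ_three, cross_apply] at h0 h1 h2
  have hn2 : n 0 ^ 2 + n 1 ^ 2 + n 2 ^ 2 ≠ 0 := by
    have := norm_pos_iff.2 hn
    have h4 := EuclideanSpace.real_norm_sq_eq n
    rw [Fin.sum_univ_three] at h4
    rw [← h4]; positivity
  simp only [PiLp.inner_apply, Fin.sum_univ_three, RCLike.inner_apply, conj_trivial] at ht ⊢
  refine (mul_eq_zero.1 ?_).resolve_left hn2
  linear_combination (n 0 * j 0 + n 1 * j 1 + n 2 * j 2) * ht +
    (n 2 * t 1 - n 1 * t 2) * h0 + (n 0 * t 2 - n 2 * t 0) * h1 + (n 1 * t 0 - n 0 * t 1) * h2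

lemma integrable_fderiv_evalV {χ : E3 → ℝ} (hχ : ContDiff ℝ (⊤ : ℕ∞) χ)
    (hc : HasCompactSupport χ) (p : VPoly) : Integrable fun y => fderiv ℝ χ y (evalV p y) := by
  refine Continuous.integrable_of_hasCompactSupport
    ((hχ.continuous_fderiv (by simp)).clm_apply (continuous_evalV p)) ?_
  exact (hc.fderiv (𝕜 := ℝ)).mono fun y hy h => hy (by simp [h])

lemma integrable_mul_evalS {χ : E3 → ℝ} (hχ : ContDiff ℝ (⊤ : ℕ∞) χ)
    (hc : HasCompactSupport χ) (p : Poly) : Integrable fun y => χ y * evalS p y :=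
  (contDiff_mul_evalS hχ p).continuous.integrable_of_hasCompactSupport hc.mul_right

/-- The weak curl of a field, which is polynomial on both sides of a plane, tested with `χ τ`. -/
lemma exists_density_of_isWeakCurl (hn : n ≠ 0) {U : Set E3} (hU : IsOpen U) {u w : E3 → E3}
    (hw : MemLp w 2 (volume.restrict U)) (hcurl : IsWeakCurl U u w) {p₁ p₂ : VPoly}
    (h₁ : ∀ y ∈ U, c < inner ℝ n y → u y = evalV p₁ y)
    (h₂ : ∀ y ∈ U, inner ℝ n y < c → u y = evalV p₂ y) (τ : E3) :
    ∃ r : E3 → ℝ, LocallyIntegrable r ∧ ∀ χ : E3 → ℝ, ContDiff ℝ (⊤ : ℕ∞) χ →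
      HasCompactSupport χ → tsupport χ ⊆ U →
      ∫ y in halfSpace n c, fderiv ℝ
        (fun y => χ y * inner ℝ n (evalV (crossP τ (p₁ - p₂)) y)) y n = ∫ y, χ y * r y := by
  set H := halfSpace n c with hH
  have hHm : MeasurableSet H := (isOpen_halfSpace n c).measurableSet
  set J := crossP τ (p₁ - p₂) with hJ
  set P := crossP τ p₂ with hP
  have hn0 : ‖n‖ ^ 2 ≠ 0 := by simpa using hn
  let f₁ : E3 → ℝ := U.indicator fun y => inner ℝ (w y) τ
  have hf₁ : LocallyIntegrable f₁ := by
    have hm : MemLp (fun y => inner ℝ (w y) τ) 2 (volume.restrict U) := hw.inner_const τ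
    exact ((memLp_indicator_iff_restrict hU.measurableSet).2 hm).locallyIntegrable (by norm_num)
  have hf₂ : LocallyIntegrable (evalS (divP P)) := (continuous_evalS _).locallyIntegrable
  have hf₃ : LocallyIntegrable (H.indicator (evalS (divP J))) :=
    (continuous_evalS _).locallyIntegrable.indicator hHm
  refine ⟨fun y => ‖n‖ ^ 2 * (f₁ y + evalS (divP P) y + H.indicator (evalS (divP J)) y),
    (((hf₁.add hf₂).add hf₃).smul (‖n‖ ^ 2)), fun χ hχ hc hts => ?_⟩
  have i₁ : Integrable fun y => χ y * f₁ y :=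
    hf₁.integrable_smul_left_of_hasCompactSupport hχ.continuous hc
  have i₂ := integrable_mul_evalS hχ hc (divP P)
  have i₃ := integrable_mul_evalS hχ hc (divP J)
  have i₄ := integrable_fderiv_evalV hχ hc P
  have i₅ := integrable_fderiv_evalV hχ hc J
  have e₁ : ∫ y, χ y * f₁ y = (∫ y, fderiv ℝ χ y (evalV P y)) +
      ∫ y in H, fderiv ℝ χ y (evalV J y) := by
    have hψ : ContDiff ℝ (⊤ : ℕ∞) fun y => χ y • τ := hχ.smul contDiff_const
    have hψc : HasCompactSupport fun y => χ y • τ := hc.smul_right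
    have hψs : tsupport (fun y => χ y • τ) ⊆ U :=
      (tsupport_subset_of_forall fun y h => by simp [h]).trans hts
    have h := hcurl _ hψ hψc hψs
    simp only [inner_classicalCurl_smul (hχ.differentiable (by simp)), inner_smul_right] at h
    have e : ∫ y, χ y * f₁ y = ∫ y in U, χ y * inner ℝ (w y) τ := by
      rw [← integral_indicator hU.measurableSet]
      congr 1
      ext y
      by_cases hy : y ∈ U <;> simp [f₁, hy]
    rw [e, ← h, ← integral_indicator hHm, ← integral_add i₄ (i₅.indicator hHm),
      ← integral_indicator hU.measurableSet]
    refine integral_congr_ae ?_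
    have hnull : ∀ᵐ y : E3, inner ℝ n y ≠ c := by
      rw [ae_iff]
      simpa using volume_hyperplane hn c
    filter_upwards [hnull] with y hy
    by_cases hyU : y ∈ U
    · rw [indicator_of_mem hyU]
      rcases lt_or_gt_of_ne hy with h' | h'
      · rw [h₂ y hyU h', indicator_of_notMem (show y ∉ H from fun h'' => lt_asymm h' h''),
          add_zero, evalV_crossP]
      · rw [h₁ y hyU h', indicator_of_mem (show y ∈ H from h'), ← map_add, ← Pi.add_apply,
          ← map_add]
        have : P + J = crossP τ p₁ := by
          rw [hP, hJ, crossP, crossP, crossP, ← map_add, add_sub_cancel]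
        rw [this, evalV_crossP]
    · have h0 : fderiv ℝ χ y = 0 := by
        by_contra h0
        exact hyU (hts (support_fderiv_subset ℝ h0))
      rw [indicator_of_notMem hyU]
      by_cases hyH : y ∈ H <;> simp [h0, hyH]
  have e₂ := integral_div_eq_zero hχ hc P
  have e₃ := setIntegral_halfSpace_div (c := c) hn hχ hc J
  rw [integral_add i₄ i₂] at e₂
  rw [integral_add i₅.restrict i₃.restrict] at e₃
  have e₄ : ∫ y, χ y * (‖n‖ ^ 2 * (f₁ y + evalS (divP P) y + H.indicator (evalS (divP J)) y)) =
      ‖n‖ ^ 2 * ((∫ y, χ y * f₁ y) + (∫ y, χ y * evalS (divP P) y) +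
        ∫ y in H, χ y * evalS (divP J) y) := by
    rw [← integral_indicator hHm, ← integral_add i₁ i₂,
      ← integral_add (i₁.fun_add i₂) (i₃.indicator hHm), ← integral_const_mul]
    congr 1
    ext y
    by_cases hy : y ∈ H <;> simp [hy] <;> ring
  rw [e₄, e₁]
  have e₅ : (∫ y, fderiv ℝ χ y (evalV P y)) + (∫ y in H, fderiv ℝ χ y (evalV J y)) +
      (∫ y, χ y * evalS (divP P) y) + (∫ y in H, χ y * evalS (divP J) y) =
      (‖n‖ ^ 2)⁻¹ * ∫ y in H, fderiv ℝ (fun y => χ y * inner ℝ n (evalV J y)) y n := by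
    rw [← e₃]
    linear_combination e₂
  rw [e₅, mul_inv_cancel_left₀ hn0]

/-- The tangential component of a field with a square integrable curl, which is polynomial on
both sides of a plane, is continuous across the plane. -/
lemma tangential_jump_eq_zero (hn : n ≠ 0) {U : Set E3} (hU : IsOpen U) {u w : E3 → E3}
    (hw : MemLp w 2 (volume.restrict U)) (hcurl : IsWeakCurl U u w) {p₁ p₂ : VPoly}
    (h₁ : ∀ y ∈ U, c < inner ℝ n y → u y = evalV p₁ y)
    (h₂ : ∀ y ∈ U, inner ℝ n y < c → u y = evalV p₂ y) {x t : E3} (hx : x ∈ U)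
    (hxc : inner ℝ n x = c) (ht : inner ℝ n t = 0) :
    inner ℝ (evalV p₁ x - evalV p₂ x) t = 0 := by
  refine inner_eq_zero_of_forall_cross hn ht fun τ => ?_
  obtain ⟨r, hr, key⟩ := exists_density_of_isWeakCurl hn hU hw hcurl h₁ h₂ τ
  set q : E3 → ℝ := fun y => inner ℝ n (evalV (crossP τ (p₁ - p₂)) y) with hq
  have hqx : inner ℝ n (WithLp.toLp 2 (τ.ofLp ⨯₃ (evalV p₁ x - evalV p₂ x).ofLp)) = q x := by
    rw [hq]
    simp only [evalV_crossP, map_sub, Pi.sub_apply]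
  have hqs : ContDiff ℝ (⊤ : ℕ∞) q := by
    have : q = fun y => ∑ i, n i * evalS (crossP τ (p₁ - p₂) i) y := by
      ext y
      rw [hq]
      simp only [PiLp.inner_apply, evalV_apply, RCLike.inner_apply, conj_trivial]
      exact Finset.sum_congr rfl fun i _ => mul_comm _ _
    rw [this]
    exact ContDiff.sum fun i _ => contDiff_const.mul (contDiff_evalS _)
  rw [hqx]
  by_contra hne
  have hHo := isOpen_halfSpace n c
  have hr₁ : ∀ᵐ y, y ∈ U ∩ halfSpace n c → r y = 0 := by
    refine (hU.inter hHo).ae_eq_zero_of_integral_contDiff_smul_eq_zero (hr.locallyIntegrableOn _) ?_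
    intro χ hχ hc hts
    have hG : ContDiff ℝ (⊤ : ℕ∞) fun y => χ y * q y := hχ.mul hqs
    have hGc : HasCompactSupport fun y => χ y * q y := hc.mul_right
    have := key χ hχ hc (hts.trans inter_subset_left)
    simp only [smul_eq_mul]
    rw [← this, setIntegral_eq_integral_of_forall_compl_eq_zero, integral_fderiv_eq_zero hG hGc]
    intro y hy
    have : fderiv ℝ (fun y => χ y * q y) y = 0 := by
      by_contra h0
      have h1 := support_fderiv_subset ℝ h0
      exact hy (hts ((tsupport_subset_of_forall fun y h => by simp [h]) h1)).2
    rw [this]; rfl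
  have hLo : IsOpen {y : E3 | inner ℝ n y < c} :=
    isOpen_lt (f := fun y : E3 => inner ℝ n y) (by fun_prop) continuous_const
  have hr₂ : ∀ᵐ y, y ∈ U ∩ {y : E3 | inner ℝ n y < c} → r y = 0 := by
    refine (hU.inter hLo).ae_eq_zero_of_integral_contDiff_smul_eq_zero (hr.locallyIntegrableOn _) ?_
    intro χ hχ hc hts
    have := key χ hχ hc (hts.trans inter_subset_left)
    simp only [smul_eq_mul]
    rw [← this]
    refine setIntegral_eq_zero_of_forall_eq_zero fun y hy => ?_
    have : fderiv ℝ (fun y => χ y * q y) y = 0 := by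
      by_contra h0
      have h1 := support_fderiv_subset ℝ h0
      have h2 : inner ℝ n y < c := (hts ((tsupport_subset_of_forall fun y h => by simp [h]) h1)).2
      exact lt_asymm (show c < inner ℝ n y from hy) h2
    rw [this]; rfl
  have hnull : ∀ᵐ y : E3, inner ℝ n y ≠ c := by
    rw [ae_iff]
    simpa using volume_hyperplane hn c
  have hr₀ : ∀ᵐ y, y ∈ U → r y = 0 := by
    filter_upwards [hr₁, hr₂, hnull] with y h1 h2 h3 hyU
    rcases lt_or_gt_of_ne h3 with h | h
    · exact h2 ⟨hyU, h⟩
    · exact h1 ⟨hyU, h⟩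
  obtain ⟨g, hg, hgc, hgs, hgne⟩ := exists_halfSpace_integral_ne_zero hn
    (hU.inter (isOpen_ne_fun hqs.continuous continuous_const)) (x := x) ⟨hx, hne⟩ hxc
  have hχ : ContDiff ℝ (⊤ : ℕ∞) fun y => g y / q y := by
    rw [contDiff_iff_contDiffAt]
    intro y
    by_cases hy : y ∈ tsupport g
    · exact hg.contDiffAt.div hqs.contDiffAt (hgs hy).2
    · have : (fun y => g y / q y) =ᶠ[𝓝 y] fun _ => 0 := by
        filter_upwards [(notMem_tsupport_iff_eventuallyEq.1 hy)] with z hz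
        simp [hz]
      exact contDiffAt_const.congr_of_eventuallyEq this
  have hsub : tsupport (fun y => g y / q y) ⊆ tsupport g :=
    tsupport_subset_of_forall fun y h => by simp [h]
  have := key _ hχ (hgc.mono fun y hy h => hy (by simp [h]))
    (hsub.trans (hgs.trans inter_subset_left))
  have hgq : (fun y => g y / q y * q y) = g := by
    ext y
    by_cases hy : q y = 0
    · have : g y = 0 := image_eq_zero_of_notMem_tsupport fun h => (hgs h).2 hy
      simp [this]
    · field_simp
  change ∫ y in halfSpace n c, fderiv ℝ (fun y => g y / q y * q y) y n = _ at this
  rw [hgq] at this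
  refine hgne (this.trans ?_)
  refine integral_eq_zero_of_ae ?_
  filter_upwards [hr₀] with y hy
  by_cases hyU : y ∈ U
  · simp [hy hyU]
  · have : g y = 0 := image_eq_zero_of_notMem_tsupport fun h => hyU (hgs h).1
    simp [this]

end EdgeElement

namespace EdgeElement

open Topology

/-! ### Lipschitz domains -/

section Lipschitz

variable {Ω : Set E3}

lemma sub_inner_smul_add_smul {d : E3} (hd : ‖d‖ = 1) (y : E3) (s : ℝ) :
    (y + s • d) - inner ℝ d (y + s • d) • d = y - inner ℝ d y • d := by
  rw [inner_add_right, inner_smul_right, real_inner_self_eq_norm_sq, hd, add_smul]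
  simp

lemma IsLipschitzDomain.interior_closure (hΩ : IsLipschitzDomain Ω) :
    interior (closure Ω) = Ω := by
  refine Subset.antisymm (fun x hx => ?_)
    (interior_maximal subset_closure hΩ.isOpen)
  by_contra hxΩ
  have hxf : x ∈ frontier Ω := by
    rw [hΩ.isOpen.frontier_eq]
    exact ⟨interior_subset hx, hxΩ⟩
  obtain ⟨d, φ, K, hd, hφ, U, hU, hxU, hUΩ⟩ := hΩ.lipschitz x hxf
  have hxφ : inner ℝ d x ≤ φ (x - inner ℝ d x • d) := not_lt.1 fun h => hxΩ ((hUΩ x hxU).2 h)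
  have hc : Continuous fun t : ℝ => x + t • d := by fun_prop
  have hev : ∀ᶠ t : ℝ in 𝓝 0, x + t • d ∈ interior (closure Ω) ∩ U := by
    refine hc.continuousAt.eventually ?_
    simpa using (isOpen_interior.inter hU).mem_nhds ⟨hx, hxU⟩
  obtain ⟨t, ⟨ht1, ht2⟩, ht0⟩ := (Filter.Eventually.and (hev.filter_mono nhdsWithin_le_nhds)
    (self_mem_nhdsWithin (s := Iio (0 : ℝ)))).exists
  have ht0 : t < 0 := ht0
  have hφc := hφ.continuous
  have hG : IsOpen (U ∩ {y : E3 | inner ℝ d y < φ (y - inner ℝ d y • d)}) :=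
    hU.inter (isOpen_lt (f := fun y : E3 => inner ℝ d y)
      (g := fun y => φ (y - inner ℝ d y • d)) (by fun_prop) (hφc.comp (by fun_prop)))
  have hmem : x + t • d ∈ U ∩ {y : E3 | inner ℝ d y < φ (y - inner ℝ d y • d)} := by
    refine ⟨ht2, ?_⟩
    change inner ℝ d (x + t • d) < φ (x + t • d - inner ℝ d (x + t • d) • d)
    rw [sub_inner_smul_add_smul hd, inner_add_right, inner_smul_right,
      real_inner_self_eq_norm_sq, hd]
    linarith
  obtain ⟨y, ⟨hyU, hy⟩, hyΩ⟩ := mem_closure_iff.1 (interior_subset ht1) _ hG hmem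
  exact lt_asymm ((hUΩ y hyU).1 hyΩ) hy

/-- A Lipschitz domain is locally connected at its boundary. -/
lemma IsLipschitzDomain.exists_isPreconnected (hΩ : IsLipschitzDomain Ω) {x : E3}
    (hx : x ∈ frontier Ω) {ε : ℝ} (hε : 0 < ε) :
    ∃ δ > 0, ∀ y₁ ∈ Ω ∩ Metric.ball x δ, ∀ y₂ ∈ Ω ∩ Metric.ball x δ,
      ∃ Z ⊆ Ω ∩ Metric.ball x ε, IsPreconnected Z ∧ y₁ ∈ Z ∧ y₂ ∈ Z := by
  obtain ⟨d, φ, K, hd, hφ, U, hU, hxU, hUΩ⟩ := hΩ.lipschitz x hx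
  obtain ⟨ε', hε', hball⟩ := Metric.isOpen_iff.1 hU x hxU
  wlog hle : ε ≤ ε' generalizing ε
  · obtain ⟨δ, hδ, h⟩ := this hε' le_rfl
    refine ⟨δ, hδ, fun y₁ h₁ y₂ h₂ => ?_⟩
    obtain ⟨Z, hZ, h'⟩ := h y₁ h₁ y₂ h₂
    exact ⟨Z, hZ.trans (inter_subset_inter_right _ (Metric.ball_subset_ball (not_le.1 hle).le)), h'⟩
  have hK : (0 : ℝ) ≤ K := K.2
  set δ : ℝ := ε / (8 * (K + 1)) with hδ
  have hδ0 : 0 < δ := by positivity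
  have hδε : 4 * (K + 1) * δ = ε / 2 := by rw [hδ]; field_simp; norm_num
  have hδ4 : 4 * δ ≤ ε / 2 := by
    rw [← hδε]
    nlinarith [mul_nonneg hK hδ0.le]
  have hin : ∀ z ∈ Metric.ball x δ, ∀ t ∈ Icc (0 : ℝ) (ε / 2), z + t • d ∈ Metric.ball x ε := by
    intro z hz t ht
    rw [mem_ball_iff_norm] at hz ⊢
    calc ‖z + t • d - x‖ = ‖(z - x) + t • d‖ := by congr 1; abel
      _ ≤ ‖z - x‖ + ‖t • d‖ := norm_add_le _ _
      _ = ‖z - x‖ + t := by rw [norm_smul, hd, mul_one, Real.norm_eq_abs, abs_of_nonneg ht.1]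
      _ < ε := by linarith [ht.2]
  have hup : ∀ y ∈ Ω ∩ Metric.ball x δ, segment ℝ y (y + (ε / 2) • d) ⊆ Ω ∩ Metric.ball x ε := by
    rintro y ⟨hyΩ, hy⟩ z hz
    rw [segment_eq_image'] at hz
    obtain ⟨θ, hθ, rfl⟩ := hz
    have hθ' : θ * (ε / 2) ∈ Icc 0 (ε / 2) :=
      ⟨mul_nonneg hθ.1 (by linarith), mul_le_of_le_one_left (by linarith) hθ.2⟩
    have hz := hin y hy _ hθ'
    beta_reduce
    rw [add_sub_cancel_left, smul_smul]
    have hyU : y ∈ U := by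
      have h0 := hin y hy 0 ⟨le_rfl, by linarith⟩
      rw [zero_smul, add_zero] at h0
      exact hball (Metric.ball_subset_ball hle h0)
    refine ⟨(hUΩ _ (hball (Metric.ball_subset_ball hle hz))).2 ?_, hz⟩
    rw [sub_inner_smul_add_smul hd, inner_add_right, inner_smul_right,
      real_inner_self_eq_norm_sq, hd]
    have := (hUΩ y hyU).1 hyΩ
    linarith [hθ'.1]
  refine ⟨δ, hδ0, fun y₁ h₁ y₂ h₂ => ?_⟩
  refine ⟨segment ℝ y₁ (y₁ + (ε / 2) • d) ∪
    (segment ℝ (y₁ + (ε / 2) • d) (y₂ + (ε / 2) • d) ∪ segment ℝ y₂ (y₂ + (ε / 2) • d)),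
    union_subset (hup y₁ h₁) (union_subset ?_ (hup y₂ h₂)), ?_, ?_, ?_⟩
  · intro z hz
    rw [segment_eq_image'] at hz
    obtain ⟨θ, hθ, rfl⟩ := hz
    set y : E3 := y₁ + θ • (y₂ - y₁) with hy
    have hyb : y ∈ Metric.ball x δ := (convex_ball x δ).segment_subset h₁.2 h₂.2 (by
      rw [segment_eq_image']; exact ⟨θ, hθ, rfl⟩)
    have heq : y₁ + (ε / 2) • d + θ • (y₂ + (ε / 2) • d - (y₁ + (ε / 2) • d)) =
        y + (ε / 2) • d := by
      rw [hy, add_sub_add_right_eq_sub]; abel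
    beta_reduce
    rw [heq]
    clear_value y
    have hz := hin y hyb (ε / 2) ⟨by linarith, le_rfl⟩
    refine ⟨(hUΩ _ (hball (Metric.ball_subset_ball hle hz))).2 ?_, hz⟩
    rw [sub_inner_smul_add_smul hd, inner_add_right, inner_smul_right,
      real_inner_self_eq_norm_sq, hd]
    have hy₁U : y₁ ∈ U := by
      have h0 := hin y₁ h₁.2 0 ⟨le_rfl, by linarith⟩
      rw [zero_smul, add_zero] at h0
      exact hball (Metric.ball_subset_ball hle h0)
    have h3 := (hUΩ y₁ hy₁U).1 h₁.1
    have hdist : ‖y - y₁‖ < 2 * δ := by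
      have h4 := hyb
      have h5 := h₁.2
      rw [mem_ball_iff_norm] at h4 h5
      calc ‖y - y₁‖ = ‖(y - x) - (y₁ - x)‖ := by congr 1; abel
        _ ≤ ‖y - x‖ + ‖y₁ - x‖ := norm_sub_le _ _
        _ < 2 * δ := by linarith
    have hinner : |inner ℝ d (y - y₁)| ≤ ‖y - y₁‖ := by
      simpa [hd] using abs_real_inner_le_norm d (y - y₁)
    have h6 := hφ.dist_le_mul (y - inner ℝ d y • d) (y₁ - inner ℝ d y₁ • d)
    have h7 : dist (y - inner ℝ d y • d) (y₁ - inner ℝ d y₁ • d) ≤ 2 * ‖y - y₁‖ := by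
      rw [dist_eq_norm]
      calc _ = ‖(y - y₁) - inner ℝ d (y - y₁) • d‖ := by
            congr 1; rw [inner_sub_right, sub_smul]; abel
        _ ≤ ‖y - y₁‖ + ‖inner ℝ d (y - y₁) • d‖ := norm_sub_le _ _
        _ ≤ 2 * ‖y - y₁‖ := by
          rw [norm_smul, hd, mul_one, Real.norm_eq_abs]; linarith
    have h8 : φ (y - inner ℝ d y • d) ≤ φ (y₁ - inner ℝ d y₁ • d) + K * (2 * ‖y - y₁‖) := by
      have := (le_abs_self _).trans ((Real.dist_eq _ _).symm.le.trans h6)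
      have := this.trans (mul_le_mul_of_nonneg_left h7 hK)
      linarith
    rw [inner_sub_right] at hinner
    have h9 := (abs_le.1 hinner).1
    have h10 : K * (2 * ‖y - y₁‖) ≤ K * (4 * δ) := mul_le_mul_of_nonneg_left (by linarith) hK
    nlinarith
  · have hp : ∀ a b : E3, IsPreconnected (segment ℝ a b) := fun a b =>
      (convex_segment a b).isPreconnected
    refine (hp _ _).union (y₁ + (ε / 2) • d) (right_mem_segment _ _ _)
      (Or.inl (left_mem_segment _ _ _)) ((hp _ _).union (y₂ + (ε / 2) • d)
      (right_mem_segment _ _ _) (right_mem_segment _ _ _) (hp _ _))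
  · exact Or.inl (left_mem_segment _ _ _)
  · exact Or.inr (Or.inr (left_mem_segment _ _ _))

end Lipschitz

end EdgeElement

namespace EdgeElement

open Topology

/-! ### Barycentric coordinates of the elements -/

lemma affineMap_sum {ι : Type*} (s : Finset ι) (f : E3 →ᵃ[ℝ] ℝ) (g : ι → ℝ) (p : ι → E3)
    (hg : ∑ i ∈ s, g i = 1) : f (∑ i ∈ s, g i • p i) = ∑ i ∈ s, g i * f (p i) := by
  have h : ∀ y, f y = f.linear y + f 0 := fun y => congrFun f.decomp y
  rw [h, map_sum]
  simp only [h (p _), mul_add, Finset.sum_add_distrib, ← Finset.sum_mul, hg, one_mul, map_smul,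
    smul_eq_mul]

namespace TetMesh

variable {Ω : Set E3} (M : TetMesh Ω)

/-- The vertices of an element as an affine basis of the space. -/
def basis (T : M.Elem) : AffineBasis T.1 ℝ E3 where
  toFun := (↑)
  ind' := M.affineIndependent T.1 T.2
  tot' := by
    refine ((M.affineIndependent T.1 T.2).affineSpan_eq_top_iff_card_eq_finrank_add_one).2 ?_
    simp [M.card_eq T.1 T.2]

/-- The barycentric coordinate of an element which belongs to a given vertex. -/
def bary (T : M.Elem) (a : T.1) : E3 →ᵃ[ℝ] ℝ := (M.basis T).coord a

lemma continuous_bary (T : M.Elem) (a : T.1) : Continuous (M.bary T a) :=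
  (M.bary T a).continuous_of_finiteDimensional

lemma bary_self (T : M.Elem) (a : T.1) : M.bary T a a = 1 := (M.basis T).coord_apply_eq a

lemma bary_ne (T : M.Elem) {a b : T.1} (h : a ≠ b) : M.bary T a b = 0 :=
  (M.basis T).coord_apply_ne h

lemma sum_bary (T : M.Elem) (x : E3) : ∑ a, M.bary T a x = 1 :=
  (M.basis T).sum_coord_apply_eq_one x

lemma sum_bary_smul (T : M.Elem) (x : E3) : ∑ a : T.1, M.bary T a x • (a : E3) = x :=
  (M.basis T).linear_combination_coord_eq_self x

lemma range_basis (T : M.Elem) : range (M.basis T) = (T.1 : Set E3) := Subtype.range_coe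

lemma mem_dom_iff (T : M.Elem) (x : E3) : x ∈ M.dom T ↔ ∀ a, 0 ≤ M.bary T a x := by
  have := (M.basis T).convexHull_eq_nonneg_coord
  rw [range_basis] at this
  rw [dom, this]
  rfl

lemma mem_interior_dom_iff (T : M.Elem) (x : E3) :
    x ∈ interior (M.dom T) ↔ ∀ a, 0 < M.bary T a x := by
  have := (M.basis T).interior_convexHull
  rw [range_basis] at this
  rw [dom, this]
  rfl

lemma convex_dom (T : M.Elem) : Convex ℝ (M.dom T) := convex_convexHull ℝ _

lemma isCompact_dom (T : M.Elem) : IsCompact (M.dom T) :=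
  T.1.finite_toSet.isCompact_convexHull (𝕜 := ℝ)

lemma isClosed_dom (T : M.Elem) : IsClosed (M.dom T) := (M.isCompact_dom T).isClosed

lemma mem_dom_of_mem (T : M.Elem) {a : E3} (ha : a ∈ T.1) : a ∈ M.dom T :=
  subset_convexHull ℝ _ ha

lemma interior_dom_nonempty (T : M.Elem) : (interior (M.dom T)).Nonempty := by
  have := (M.basis T).centroid_mem_interior_convexHull
  rw [range_basis] at this
  exact ⟨_, this⟩

lemma dom_subset_closure (T : M.Elem) : M.dom T ⊆ closure Ω := by
  rw [← M.cover]
  exact subset_biUnion_of_mem (u := fun T : Finset E3 => convexHull ℝ (T : Set E3)) T.2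

lemma dom_inter_dom (T T' : M.Elem) :
    M.dom T ∩ M.dom T' = convexHull ℝ ((T.1 : Set E3) ∩ (T'.1 : Set E3)) :=
  M.inter_eq T.1 T.2 T'.1 T'.2

lemma bary_eq_zero_of_mem_convexHull (T : M.Elem) {C : Set E3} {a : T.1}
    (haC : (a : E3) ∉ C) (hC : C ⊆ T.1) {x : E3} (hx : x ∈ convexHull ℝ C) :
    M.bary T a x = 0 := by
  have hconv : Convex ℝ ((M.bary T a) ⁻¹' {0}) := (convex_singleton 0).affine_preimage _
  refine convexHull_min (fun y hy => ?_) hconv hx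
  exact M.bary_ne T (b := ⟨y, hC hy⟩) fun h => haC (by rw [h]; exact hy)

/-- If a point of two elements has a positive coordinate in the first one, then the corresponding
vertex is shared. -/
lemma mem_of_bary_pos {T T' : M.Elem} {x : E3} (hx : x ∈ M.dom T) (hx' : x ∈ M.dom T')
    {a : T.1} (ha : 0 < M.bary T a x) : (a : E3) ∈ T'.1 := by
  by_contra h
  have h1 : x ∈ M.dom T ∩ M.dom T' := ⟨hx, hx'⟩
  rw [dom_inter_dom] at h1
  exact ha.ne' (M.bary_eq_zero_of_mem_convexHull T (fun h2 => h h2.2) inter_subset_left h1)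

lemma eq_of_subset {T T' : M.Elem} (h : T.1 ⊆ T'.1) : T = T' :=
  Subtype.ext (Finset.eq_of_subset_of_card_le h
    (by rw [M.card_eq _ T.2, M.card_eq _ T'.2]))

lemma eq_of_mem_interior {T T' : M.Elem} {x : E3} (hx : x ∈ interior (M.dom T))
    (hx' : x ∈ M.dom T') : T = T' :=
  M.eq_of_subset fun a ha =>
    M.mem_of_bary_pos (interior_subset hx) hx' (a := ⟨a, ha⟩) ((M.mem_interior_dom_iff T x).1 hx _)

lemma glue_of_mem_interior {V : Type*} [AddCommMonoid V] {ω : Finset M.Elem} (f : ω → E3 → V)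
    (T : ω) {x : E3} (hx : x ∈ interior (M.dom T.1)) : M.glue ω f x = f T x := by
  rw [glue, Finset.sum_eq_single T]
  · exact indicator_of_mem hx _
  · intro T' _ hT'
    refine indicator_of_notMem (fun h => hT' ?_) _
    exact Subtype.ext (M.eq_of_mem_interior h (interior_subset hx))
  · simp

/-! ### Tangential continuity across faces -/

section

variable {M}

/-- Two elements with a common face lie, near its inner points, on the two sides of its plane. -/
lemma face_neighbourhood {T T' : M.Elem} (hne : T ≠ T') (a : T.1)
    (ha : ∀ b ∈ T.1, b ≠ a → b ∈ T'.1) {x : E3} (hx0 : M.bary T a x = 0)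
    (hx : ∀ b, b ≠ a → 0 < M.bary T b x) :
    ∀ᶠ y in 𝓝 x, (0 < M.bary T a y → y ∈ interior (M.dom T)) ∧
      (M.bary T a y < 0 → y ∈ interior (M.dom T')) ∧ (y ∈ M.dom T ∨ y ∈ M.dom T') := by
  classical
  have haT' : (a : E3) ∉ T'.1 := fun h => hne (M.eq_of_subset fun b hb => by
    by_cases hba : b = a
    · rw [hba]; exact h
    · exact ha b hb hba)
  have hcard : (T.1.erase a).card = 3 := by
    rw [Finset.card_erase_of_mem a.2, M.card_eq _ T.2]
  have hsub : T.1.erase a ⊆ T'.1 := fun b hb =>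
    ha b (Finset.mem_of_mem_erase hb) (Finset.ne_of_mem_erase hb)
  obtain ⟨a', ha'⟩ : ∃ a', T'.1 \ T.1.erase a = {a'} := by
    rw [← Finset.card_eq_one, Finset.card_sdiff_of_subset hsub, hcard, M.card_eq _ T'.2]
  have ha'T : a' ∈ T'.1 := (Finset.mem_sdiff.1 (ha' ▸ Finset.mem_singleton_self a')).1
  have ha'n : a' ∉ T.1.erase a := (Finset.mem_sdiff.1 (ha' ▸ Finset.mem_singleton_self a')).2
  have hT' : ∀ b ∈ T'.1, b ≠ a' → b ∈ T.1.erase a := by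
    intro b hb hba
    by_contra h
    have : b ∈ T'.1 \ T.1.erase a := Finset.mem_sdiff.2 ⟨hb, h⟩
    rw [ha'] at this
    exact hba (Finset.mem_singleton.1 this)
  -- expansion of the coordinates of the second element in the first one
  have hexp : ∀ (c : T'.1) (y : E3), M.bary T' c y =
      ∑ b : T.1, M.bary T b y * M.bary T' c b := by
    intro c y
    conv_lhs => rw [← M.sum_bary_smul T y]
    exact affineMap_sum _ _ _ _ (M.sum_bary T y)
  have hopp : ∀ y, M.bary T' ⟨a', ha'T⟩ y = M.bary T a y * M.bary T' ⟨a', ha'T⟩ a := by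
    intro y
    rw [hexp]
    refine Finset.sum_eq_single a (fun b _ hb => ?_) (by simp)
    have hb' : (b : E3) ∈ T.1.erase a :=
      Finset.mem_erase.2 ⟨fun h => hb (Subtype.ext h), b.2⟩
    rw [M.bary_ne T' (a := ⟨a', ha'T⟩) (b := ⟨b, hsub hb'⟩), mul_zero]
    intro h
    exact ha'n (by rw [Subtype.mk.injEq] at h; rw [h]; exact hb')
  have hsame : ∀ (b : T'.1) (hb : (b : E3) ∈ T.1.erase a),
      M.bary T' b x = M.bary T ⟨b, Finset.mem_of_mem_erase hb⟩ x := by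
    intro b hb
    rw [hexp, Finset.sum_eq_single (⟨b, Finset.mem_of_mem_erase hb⟩ : T.1)]
    · rw [M.bary_self T' b, mul_one]
    · intro c _ hc
      by_cases hca : c = a
      · rw [hca, hx0, zero_mul]
      · have hc' : (c : E3) ∈ T.1.erase a :=
          Finset.mem_erase.2 ⟨fun h => hca (Subtype.ext h), c.2⟩
        rw [M.bary_ne T' (a := b) (b := ⟨c, hsub hc'⟩), mul_zero]
        intro h
        exact hc (Subtype.ext (congrArg Subtype.val h).symm)
    · simp
  have hpos : ∀ᶠ y in 𝓝 x, ∀ b, b ≠ a → 0 < M.bary T b y := by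
    rw [Filter.eventually_all]
    intro b
    by_cases hb : b = a
    · simp [hb]
    · filter_upwards [((M.continuous_bary T b).tendsto x).eventually_const_lt (hx b hb)] with y hy _
      exact hy
  have hpos' : ∀ᶠ y in 𝓝 x, ∀ b : T'.1, (b : E3) ≠ a' → 0 < M.bary T' b y := by
    rw [Filter.eventually_all]
    intro b
    by_cases hb : (b : E3) = a'
    · simp [hb]
    · have hb' := hT' b b.2 hb
      have : 0 < M.bary T' b x := by
        rw [hsame b hb']
        exact hx _ fun h => Finset.ne_of_mem_erase hb' (by rw [← h])
      filter_upwards [((M.continuous_bary T' b).tendsto x).eventually_const_lt this] with y hy _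
      exact hy
  have hκ : M.bary T' ⟨a', ha'T⟩ a < 0 := by
    by_contra hκ
    rw [not_lt] at hκ
    let γ : ℝ → E3 := fun t => x + t • ((a : E3) - x)
    have hγ : Continuous γ := by fun_prop
    have hγ0 : Filter.Tendsto γ (𝓝[>] 0) (𝓝 x) := by
      have := hγ.tendsto 0
      simp only [γ, zero_smul, add_zero] at this
      exact this.mono_left nhdsWithin_le_nhds
    obtain ⟨t, ⟨h1, h2⟩, ht⟩ := ((hγ0.eventually (hpos.and hpos')).and
      self_mem_nhdsWithin).exists
    have ht : 0 < t := ht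
    have hat : 0 < M.bary T a (γ t) := by
      have : γ t = AffineMap.lineMap x (a : E3) t := by
        simp [γ, AffineMap.lineMap_apply, add_comm]
      rw [this, AffineMap.apply_lineMap, hx0, M.bary_self, AffineMap.lineMap_apply]
      simpa using ht
    have hm : γ t ∈ M.dom T := (M.mem_dom_iff T _).2 fun b => by
      by_cases hb : b = a
      · rw [hb]; exact hat.le
      · exact (h1 b hb).le
    have hm' : γ t ∈ M.dom T' := (M.mem_dom_iff T' _).2 fun b => by
      by_cases hb : (b : E3) = a'
      · have : b = ⟨a', ha'T⟩ := Subtype.ext hb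
        rw [this, hopp]
        exact mul_nonneg hat.le hκ
      · exact (h2 b hb).le
    exact haT' (M.mem_of_bary_pos hm hm' hat)
  filter_upwards [hpos, hpos'] with y h1 h2
  refine ⟨fun h => (M.mem_interior_dom_iff T y).2 fun b => ?_,
    fun h => (M.mem_interior_dom_iff T' y).2 fun b => ?_, ?_⟩
  · by_cases hb : b = a
    · rw [hb]; exact h
    · exact h1 b hb
  · by_cases hb : (b : E3) = a'
    · have : b = ⟨a', ha'T⟩ := Subtype.ext hb
      rw [this, hopp]
      exact mul_pos_of_neg_of_neg h hκ
    · exact h2 b hb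
  · rcases le_or_gt 0 (M.bary T a y) with h | h
    · refine Or.inl ((M.mem_dom_iff T _).2 fun b => ?_)
      by_cases hb : b = a
      · rw [hb]; exact h
      · exact (h1 b hb).le
    · refine Or.inr ((M.mem_dom_iff T' _).2 fun b => ?_)
      by_cases hb : (b : E3) = a'
      · have : b = ⟨a', ha'T⟩ := Subtype.ext hb
        rw [this, hopp]
        exact (mul_pos_of_neg_of_neg h hκ).le
      · exact (h2 b hb).le

end

end TetMesh
end EdgeElement

namespace EdgeElement
open Topology
namespace TetMesh

variable {Ω : Set E3} {M : TetMesh Ω}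

lemma inner_jump_face_interior (hΩ : IsLipschitzDomain Ω) {k : ℕ} {u : M.Elem → VPoly}
    (hu : u ∈ M.edgeSpace k) {T T' : M.Elem} (hne : T ≠ T') (a : T.1)
    (ha : ∀ b ∈ T.1, b ≠ a → b ∈ T'.1) {x : E3} (hx0 : M.bary T a x = 0)
    (hx : ∀ b, b ≠ a → 0 < M.bary T b x) {t : E3} (ht : (M.bary T a).linear t = 0) :
    inner ℝ (evalV (u T) x - evalV (u T') x) t = 0 := by
  obtain ⟨-, -, w, hw, hcurl⟩ := hu
  obtain ⟨V, hV, hVo, hxV⟩ := eventually_nhds_iff.1 (face_neighbourhood hne a ha hx0 hx)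
  have hVΩ : V ⊆ Ω := by
    rw [← hΩ.interior_closure]
    refine interior_maximal (fun y hy => ?_) hVo
    exact (hV y hy).2.2.elim (fun h => M.dom_subset_closure T h) fun h => M.dom_subset_closure T' h
  let ℓ : E3 →L[ℝ] ℝ := LinearMap.toContinuousLinearMap (M.bary T a).linear
  set n : E3 := (InnerProductSpace.toDual ℝ E3).symm ℓ with hn
  have hin : ∀ y, inner ℝ n y = (M.bary T a).linear y := fun y => by
    rw [hn, InnerProductSpace.toDual_symm_apply]; rfl
  have hdec : ∀ y, M.bary T a y = inner ℝ n y + M.bary T a 0 := fun y => by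
    rw [hin]; exact congrFun (M.bary T a).decomp y
  have hn0 : n ≠ 0 := by
    intro h
    have h1 := hdec x
    have h2 := hdec a
    rw [h, inner_zero_left] at h1 h2
    rw [bary_self, ← h1, hx0] at h2
    exact one_ne_zero h2
  refine tangential_jump_eq_zero (c := -M.bary T a 0) hn0 hVo
    (u := M.glue Finset.univ fun T => evalV (u T.1)) (hw.mono_measure
    (Measure.restrict_mono hVΩ le_rfl)) (hcurl.mono hVΩ hΩ.isOpen.measurableSet) ?_ ?_ hxV ?_ ?_
  · intro y hy h
    exact M.glue_of_mem_interior (fun T => evalV (u T.1)) ⟨T, Finset.mem_univ _⟩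
      ((hV y hy).1 (by rw [hdec]; linarith))
  · intro y hy h
    exact M.glue_of_mem_interior (fun T => evalV (u T.1)) ⟨T', Finset.mem_univ _⟩
      ((hV y hy).2.1 (by rw [hdec]; linarith))
  · have := hdec x
    rw [hx0] at this
    linarith
  · rw [hin, ht]

/-- Tangential continuity on a common face. -/
lemma inner_jump_face (hΩ : IsLipschitzDomain Ω) {k : ℕ} {u : M.Elem → VPoly}
    (hu : u ∈ M.edgeSpace k) {T T' : M.Elem} (hne : T ≠ T') (a : T.1)
    (ha : ∀ b ∈ T.1, b ≠ a → b ∈ T'.1) {p y z : E3} (hp : p ∈ M.dom T ∩ M.dom T')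
    (hy : y ∈ M.dom T ∩ M.dom T') (hz : z ∈ M.dom T ∩ M.dom T') :
    inner ℝ (evalV (u T) p - evalV (u T') p) (y - z) = 0 := by
  classical
  have haT' : (a : E3) ∉ T'.1 := fun h => hne (M.eq_of_subset fun b hb => by
    by_cases hba : b = a
    · rw [hba]; exact h
    · exact ha b hb hba)
  have hzero : ∀ q ∈ M.dom T ∩ M.dom T', M.bary T a q = 0 := by
    intro q hq
    rw [dom_inter_dom] at hq
    exact M.bary_eq_zero_of_mem_convexHull T (fun h => haT' h.2) inter_subset_left hq
  have hlin : (M.bary T a).linear (y - z) = 0 := by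
    have := (M.bary T a).linearMap_vsub y z
    rw [vsub_eq_sub] at this
    rw [this, hzero y hy, hzero z hz, vsub_self]
  -- the centroid of the face
  obtain ⟨q, hq0, hq⟩ : ∃ q, M.bary T a q = 0 ∧ ∀ b, b ≠ a → 0 < M.bary T b q := by
    let g : T.1 → ℝ := fun b => if b = a then 0 else 1 / 3
    have hg : ∑ b, g b = 1 := by
      have hcard : Fintype.card T.1 = 4 := by simp [M.card_eq T.1 T.2]
      have h0 : ∑ b, g b = ∑ b ∈ Finset.univ.erase a, (1 / 3 : ℝ) := by
        rw [← Finset.sum_erase_add _ _ (Finset.mem_univ a)]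
        simp only [g, if_true, add_zero]
        exact Finset.sum_congr rfl fun b hb => if_neg (Finset.ne_of_mem_erase hb)
      rw [h0, Finset.sum_const, Finset.card_erase_of_mem (Finset.mem_univ a), Finset.card_univ,
        hcard]
      norm_num
    have hval : ∀ b : T.1, M.bary T b (∑ c : T.1, g c • (c : E3)) = g b := by
      intro b
      rw [affineMap_sum _ _ _ _ hg, Finset.sum_eq_single b]
      · rw [bary_self, mul_one]
      · intro c _ hc
        rw [M.bary_ne T hc.symm, mul_zero]
      · simp
    refine ⟨∑ c : T.1, g c • (c : E3), ?_, fun b hb => ?_⟩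
    · rw [hval]; simp [g]
    · rw [hval]; simp [g, hb]
  let γ : ℝ → E3 := fun t => AffineMap.lineMap p q t
  have hγ : Continuous γ := AffineMap.lineMap_continuous
  let f : ℝ → ℝ := fun t => inner ℝ (evalV (u T) (γ t) - evalV (u T') (γ t)) (y - z)
  have hf : Continuous f := by fun_prop
  have hf0 : ∀ t ∈ Ioo (0 : ℝ) 1, f t = 0 := by
    intro t ht
    refine inner_jump_face_interior hΩ hu hne a ha ?_ (fun b hb => ?_) hlin
    · rw [AffineMap.apply_lineMap, hzero p hp, hq0]; simp
    · rw [AffineMap.apply_lineMap, AffineMap.lineMap_apply]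
      have h1 := (M.mem_dom_iff T p).1 hp.1 b
      have h2 := hq b hb
      simp only [vsub_eq_sub, vadd_eq_add, smul_eq_mul]
      nlinarith [ht.1, ht.2, mul_pos ht.1 h2, mul_nonneg (sub_nonneg.2 ht.2.le) h1]
  have hcl : (0 : ℝ) ∈ closure (Ioo (0 : ℝ) 1) := by
    rw [closure_Ioo zero_ne_one]; exact ⟨le_rfl, zero_le_one⟩
  have : f 0 = 0 :=
    closure_minimal (s := Ioo (0 : ℝ) 1) (t := f ⁻¹' {0}) hf0
      (isClosed_singleton.preimage hf) hcl
  simpa [f, γ] using this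

/-- An element which contains an inner point of an edge contains the vertices of the edge. -/
lemma mem_of_mem_openSegment {T T' : M.Elem} {a b x : E3} (ha : a ∈ T.1) (hb : b ∈ T.1)
    (hx : x ∈ openSegment ℝ a b) (hx' : x ∈ M.dom T') : a ∈ T'.1 ∧ b ∈ T'.1 := by
  have hxT : x ∈ M.dom T := (M.convex_dom T).segment_subset (M.mem_dom_of_mem T ha)
    (M.mem_dom_of_mem T hb) (openSegment_subset_segment _ _ _ hx)
  obtain ⟨s, t, hs, ht, hst, rfl⟩ := hx
  have hval : ∀ c : T.1, M.bary T c (s • a + t • b) = s * M.bary T c a + t * M.bary T c b := by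
    intro c
    rw [Convex.combo_affine_apply hst]
    rfl
  have hnn := fun (c : T.1) (v : E3) (hv : v ∈ T.1) =>
    (M.mem_dom_iff T v).1 (M.mem_dom_of_mem T hv) c
  constructor
  · refine M.mem_of_bary_pos hxT hx' (a := ⟨a, ha⟩) ?_
    rw [hval, M.bary_self T ⟨a, ha⟩]
    have := hnn ⟨a, ha⟩ b hb
    nlinarith [mul_nonneg ht.le this]
  · refine M.mem_of_bary_pos hxT hx' (a := ⟨b, hb⟩) ?_
    rw [hval, M.bary_self T ⟨b, hb⟩]
    have := hnn ⟨b, hb⟩ a ha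
    nlinarith [mul_nonneg hs.le this]

lemma interior_dom_inter_ball_nonempty (T : M.Elem) {x : E3} (hx : x ∈ M.dom T) {δ : ℝ}
    (hδ : 0 < δ) : (interior (M.dom T) ∩ Metric.ball x δ).Nonempty := by
  have h := (M.convex_dom T).closure_interior_eq_closure_of_nonempty_interior
    (M.interior_dom_nonempty T)
  rw [(M.isClosed_dom T).closure_eq] at h
  rw [← h] at hx
  obtain ⟨y, hy, hy'⟩ := mem_closure_iff.1 hx _ Metric.isOpen_ball (Metric.mem_ball_self hδ)
  exact ⟨y, hy', hy⟩

/-- Near an inner point of an edge, the closure of a Lipschitz domain without the edge is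
connected in the sense that two elements around the edge meet a common connected set. -/
lemma exists_isPreconnected_avoiding_edge (hΩ : IsLipschitzDomain Ω) {T T' : M.Elem} {a b : E3}
    (hab : a ≠ b) (ha : a ∈ T.1) (hb : b ∈ T.1) (ha' : a ∈ T'.1) (hb' : b ∈ T'.1) :
    ∃ x ∈ openSegment ℝ a b, ∀ ε > 0, ∃ Z ⊆ closure Ω ∩ Metric.ball x ε, IsPreconnected Z ∧
      (Z ∩ segment ℝ a b = ∅) ∧ (Z ∩ M.dom T).Nonempty ∧ (Z ∩ M.dom T').Nonempty := by
  classical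
  have hseg : segment ℝ a b ⊆ M.dom T := (M.convex_dom T).segment_subset
    (M.mem_dom_of_mem T ha) (M.mem_dom_of_mem T hb)
  have hseg' : segment ℝ a b ⊆ M.dom T' := (M.convex_dom T').segment_subset
    (M.mem_dom_of_mem T' ha') (M.mem_dom_of_mem T' hb')
  by_cases hcase : ∃ x ∈ openSegment ℝ a b, x ∈ Ω
  · obtain ⟨x, hx, hxΩ⟩ := hcase
    refine ⟨x, hx, fun ε hε => ?_⟩
    obtain ⟨ε', hε', hball⟩ := Metric.isOpen_iff.1 hΩ.isOpen x hxΩ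
    set δ := min ε ε' with hδ
    have hδ0 : 0 < δ := lt_min hε hε'
    have hxs := openSegment_subset_segment _ _ _ hx
    obtain ⟨y₁, hy₁, hy₁b⟩ := interior_dom_inter_ball_nonempty T (hseg hxs) hδ0
    have hW : IsOpen (interior (M.dom T') ∩ Metric.ball x δ) :=
      isOpen_interior.inter Metric.isOpen_ball
    have hspan : affineSpan ℝ {a, b, y₁} ≠ ⊤ := by
      intro h
      have h1 := coplanar_triple ℝ a b y₁
      rw [Coplanar, ← direction_affineSpan, h, AffineSubspace.direction_top, rank_top] at h1
      have h2 : Module.rank ℝ E3 = 3 := by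
        rw [← Module.finrank_eq_rank, finrank_euclideanSpace_fin]; norm_num
      rw [h2] at h1
      norm_num at h1
    have hnull := Measure.addHaar_affineSubspace volume _ hspan
    obtain ⟨y₂, ⟨hy₂, hy₂b⟩, hy₂s⟩ : ∃ y₂ ∈ interior (M.dom T') ∩ Metric.ball x δ,
        y₂ ∉ affineSpan ℝ {a, b, y₁} := by
      by_contra! hall
      exact (hW.measure_pos volume (interior_dom_inter_ball_nonempty T' (hseg' hxs) hδ0)).ne'
        (measure_mono_null hall hnull)
    have hy₁s : y₁ ∉ segment ℝ a b := by
      intro h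
      obtain ⟨c, hc, hca, hcb⟩ : ∃ c ∈ T.1, c ≠ a ∧ c ≠ b := by
        have : 2 < T.1.card := by rw [M.card_eq _ T.2]; norm_num
        obtain ⟨c, hc, hc'⟩ := Finset.exists_mem_notMem_of_card_lt_card
          (s := {a, b}) (t := T.1) ((Finset.card_le_two).trans_lt this)
        simp only [Finset.mem_insert, Finset.mem_singleton, not_or] at hc'
        exact ⟨c, hc, hc'⟩
      have h0 := (M.mem_interior_dom_iff T y₁).1 hy₁ ⟨c, hc⟩
      rw [← convexHull_pair] at h
      refine h0.ne' (M.bary_eq_zero_of_mem_convexHull T (C := {a, b}) ?_ ?_ h)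
      · simp [hca, hcb]
      · rintro y (rfl | rfl)
        · exact ha
        · exact hb
    refine ⟨segment ℝ y₁ y₂, fun z hz => ?_, (convex_segment _ _).isPreconnected, ?_,
      ⟨y₁, left_mem_segment _ _ _, interior_subset hy₁⟩,
      ⟨y₂, right_mem_segment _ _ _, interior_subset hy₂⟩⟩
    · have hz' := (convex_ball x δ).segment_subset hy₁b hy₂b hz
      exact ⟨subset_closure (hball (Metric.ball_subset_ball (min_le_right _ _) hz')),
        Metric.ball_subset_ball (min_le_left _ _) hz'⟩
    · rw [eq_empty_iff_forall_notMem]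
      rintro z ⟨hz, hz'⟩
      rw [segment_eq_image_lineMap] at hz
      obtain ⟨s, -, rfl⟩ := hz
      have hs : s ≠ 0 := by
        rintro rfl
        rw [AffineMap.lineMap_apply_zero] at hz'
        exact hy₁s hz'
      refine hy₂s ?_
      have hzm : AffineMap.lineMap y₁ y₂ s ∈ affineSpan ℝ {a, b, y₁} := by
        rw [← convexHull_pair] at hz'
        exact affineSpan_mono ℝ (by simp [insert_subset_iff])
          (convexHull_subset_affineSpan _ hz')
      have hy₁m : y₁ ∈ affineSpan ℝ {a, b, y₁} := subset_affineSpan ℝ _ (by simp)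
      have : y₂ = AffineMap.lineMap y₁ (AffineMap.lineMap y₁ y₂ s : E3) s⁻¹ := by
        simp [AffineMap.lineMap_apply, hs]
      rw [this]
      exact AffineMap.lineMap_mem _ hy₁m hzm
  · push Not at hcase
    set x : E3 := midpoint ℝ a b with hx
    have hxo : x ∈ openSegment ℝ a b := midpoint_mem_openSegment a b
    refine ⟨x, hxo, fun ε hε => ?_⟩
    have hxs := openSegment_subset_segment _ _ _ hxo
    have hxf : x ∈ frontier Ω := by
      rw [hΩ.isOpen.frontier_eq]
      exact ⟨M.dom_subset_closure T (hseg hxs), hcase x hxo⟩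
    set ε' := min ε (dist a b / 2) with hε'
    have hε'0 : 0 < ε' := lt_min hε (half_pos (dist_pos.2 hab))
    obtain ⟨δ, hδ, h⟩ := hΩ.exists_isPreconnected hxf hε'0
    have hint : ∀ T : M.Elem, interior (M.dom T) ⊆ Ω := fun T =>
      (interior_mono (M.dom_subset_closure T)).trans hΩ.interior_closure.subset
    obtain ⟨y₁, hy₁, hy₁b⟩ := interior_dom_inter_ball_nonempty T (hseg hxs) hδ
    obtain ⟨y₂, hy₂, hy₂b⟩ := interior_dom_inter_ball_nonempty T' (hseg' hxs) hδ
    obtain ⟨Z, hZ, hZc, h1, h2⟩ := h y₁ ⟨hint T hy₁, hy₁b⟩ y₂ ⟨hint T' hy₂, hy₂b⟩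
    refine ⟨Z, hZ.trans (inter_subset_inter subset_closure
      (Metric.ball_subset_ball (min_le_left _ _))), hZc, ?_,
      ⟨y₁, h1, interior_subset hy₁⟩, ⟨y₂, h2, interior_subset hy₂⟩⟩
    rw [eq_empty_iff_forall_notMem]
    rintro z ⟨hz, hz'⟩
    obtain ⟨hzΩ, hzb⟩ := hZ hz
    have hzb : dist z x < dist a b / 2 := lt_of_lt_of_le hzb (min_le_right _ _)
    have hza : z ≠ a := by
      rintro rfl
      rw [hx, dist_left_midpoint] at hzb
      simp at hzb
      linarith
    have hzb' : z ≠ b := by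
      rintro rfl
      rw [hx, dist_right_midpoint] at hzb
      simp at hzb
      linarith
    exact hcase z (mem_openSegment_of_ne_left_right hza.symm hzb'.symm hz') hzΩ

/-- The tangential components of the fields in the edge element space are continuous. -/
lemma inner_jump_eq_zero (hΩ : IsLipschitzDomain Ω) {k : ℕ} {u : M.Elem → VPoly}
    (hu : u ∈ M.edgeSpace k) {T T' : M.Elem} {p y z : E3} (hp : p ∈ M.dom T ∩ M.dom T')
    (hy : y ∈ M.dom T ∩ M.dom T') (hz : z ∈ M.dom T ∩ M.dom T') :
    inner ℝ (evalV (u T) p - evalV (u T') p) (y - z) = 0 := by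
  classical
  -- two elements with three common vertices
  have hface : ∀ {T T' : M.Elem}, 2 < (T.1 ∩ T'.1).card → ∀ {p y z : E3},
      p ∈ M.dom T ∩ M.dom T' → y ∈ M.dom T ∩ M.dom T' → z ∈ M.dom T ∩ M.dom T' →
      inner ℝ (evalV (u T) p - evalV (u T') p) (y - z) = 0 := by
    intro T T' hcard p y z hp hy hz
    by_cases hne : T = T'
    · rw [hne, sub_self, inner_zero_left]
    obtain ⟨a, haT, haT'⟩ : ∃ a ∈ T.1, a ∉ T'.1 := by
      by_contra! h
      exact hne (M.eq_of_subset h)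
    refine inner_jump_face hΩ hu hne ⟨a, haT⟩ (fun b hb hba => ?_) hp hy hz
    by_contra hb'
    have h1 : T.1 ∩ T'.1 ⊆ (T.1.erase a).erase b := fun c hc => by
      rw [Finset.mem_inter] at hc
      refine Finset.mem_erase.2 ⟨fun h => hb' (h ▸ hc.2), Finset.mem_erase.2
        ⟨fun h => haT' (h ▸ hc.2), hc.1⟩⟩
    have h2 := Finset.card_le_card h1
    rw [Finset.card_erase_of_mem (Finset.mem_erase.2 ⟨hba, hb⟩), Finset.card_erase_of_mem haT,
      M.card_eq _ T.2] at h2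
    omega
  have hconv : ∀ T T' : M.Elem, M.dom T ∩ M.dom T' =
      convexHull ℝ ((T.1 ∩ T'.1 : Finset E3) : Set E3) := fun T T' => by
    rw [dom_inter_dom, Finset.coe_inter]
  rcases lt_or_ge 2 (T.1 ∩ T'.1).card with hcard | hcard
  · exact hface hcard hp hy hz
  rcases lt_or_ge 1 (T.1 ∩ T'.1).card with hcard1 | hcard1
  swap
  · have hsub : (convexHull ℝ ((T.1 ∩ T'.1 : Finset E3) : Set E3)).Subsingleton := by
      rcases (Finset.card_le_one_iff_subset_singleton (s := T.1 ∩ T'.1)).1 hcard1 with ⟨c, hc⟩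
      refine Set.Subsingleton.anti (t := {c}) subsingleton_singleton ?_
      exact convexHull_min (by exact_mod_cast hc) (convex_singleton c)
    rw [hconv] at hy hz
    rw [hsub hy hz, sub_self, inner_zero_right]
  -- a common edge
  obtain ⟨a, b, hab, hcab⟩ := Finset.card_eq_two.1 (le_antisymm hcard hcard1)
  have hmem : ∀ c, (c = a ∨ c = b) → c ∈ T.1 ∧ c ∈ T'.1 := fun c hc => by
    rw [← Finset.mem_inter, hcab]; simpa using hc
  obtain ⟨haT, haT'⟩ := hmem a (Or.inl rfl)
  obtain ⟨hbT, hbT'⟩ := hmem b (Or.inr rfl)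
  have hsegTT : ∀ q ∈ M.dom T ∩ M.dom T', q ∈ segment ℝ a b := fun q hq => by
    rw [hconv, hcab] at hq
    simpa [convexHull_pair] using hq
  have hsegsub : ∀ T : M.Elem, a ∈ T.1 → b ∈ T.1 → segment ℝ a b ⊆ M.dom T := fun T h1 h2 =>
    (M.convex_dom T).segment_subset (M.mem_dom_of_mem T h1) (M.mem_dom_of_mem T h2)
  have key : ∀ q ∈ segment ℝ a b, inner ℝ (evalV (u T) q - evalV (u T') q) (b - a) = 0 := by
    by_contra hcon
    let S : Set M.Elem := {T'' | (a ∈ T''.1 ∧ b ∈ T''.1) ∧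
      ∀ q ∈ segment ℝ a b, inner ℝ (evalV (u T) q - evalV (u T'') q) (b - a) = 0}
    let S' : Set M.Elem := {T'' | (a ∈ T''.1 ∧ b ∈ T''.1) ∧ T'' ∉ S}
    have hTS : T ∈ S := ⟨⟨haT, hbT⟩, fun q _ => by rw [sub_self, inner_zero_left]⟩
    have hTS' : T' ∈ S' := ⟨⟨haT', hbT'⟩, fun h => hcon h.2⟩
    have hsep : ∀ T₁ ∈ S, ∀ T₂ ∈ S', M.dom T₁ ∩ M.dom T₂ ⊆ segment ℝ a b := by
      intro T₁ h₁ T₂ h₂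
      have hsub : ({a, b} : Finset E3) ⊆ T₁.1 ∩ T₂.1 := by
        intro c hc
        rw [Finset.mem_insert, Finset.mem_singleton] at hc
        rcases hc with rfl | rfl
        · exact Finset.mem_inter.2 ⟨h₁.1.1, h₂.1.1⟩
        · exact Finset.mem_inter.2 ⟨h₁.1.2, h₂.1.2⟩
      rcases lt_or_ge 2 (T₁.1 ∩ T₂.1).card with hc | hc
      · refine absurd ⟨h₂.1, fun q hq => ?_⟩ h₂.2
        have hm := fun r (hr : r ∈ segment ℝ a b) =>
          (⟨hsegsub T₁ h₁.1.1 h₁.1.2 hr, hsegsub T₂ h₂.1.1 h₂.1.2 hr⟩ :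
            r ∈ M.dom T₁ ∩ M.dom T₂)
        have e1 := hface hc (hm q hq) (hm b (right_mem_segment _ _ _))
          (hm a (left_mem_segment _ _ _))
        have e2 := h₁.2 q hq
        rw [← sub_add_sub_cancel _ (evalV (u T₁) q), inner_add_left, e1, e2, add_zero]
      · have := Finset.eq_of_subset_of_card_le hsub (by rw [Finset.card_pair hab]; exact hc)
        rw [hconv, ← this]
        simp [convexHull_pair]
    obtain ⟨x, hx, hZ⟩ := exists_isPreconnected_avoiding_edge hΩ hab haT hbT haT' hbT'
    -- near `x` there are only elements which contain the edge
    obtain ⟨ε, hε, hball⟩ : ∃ ε > 0, ∀ T'' : M.Elem, ∀ q ∈ Metric.ball x ε, q ∈ M.dom T'' →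
        a ∈ T''.1 ∧ b ∈ T''.1 := by
      have : ∀ᶠ q in 𝓝 x, ∀ T'' : M.Elem, q ∈ M.dom T'' → a ∈ T''.1 ∧ b ∈ T''.1 := by
        rw [Filter.eventually_all]
        intro T''
        by_cases hxT : x ∈ M.dom T''
        · have := mem_of_mem_openSegment haT hbT hx hxT
          exact Filter.Eventually.of_forall fun _ _ => this
        · filter_upwards [(M.isClosed_dom T'').isOpen_compl.mem_nhds hxT] with q hq hq'
          exact absurd hq' hq
      obtain ⟨ε, hε, h⟩ := Metric.eventually_nhds_iff_ball.1 this
      exact ⟨ε, hε, fun T'' q hq => h q hq T''⟩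
    obtain ⟨Z, hZs, hZc, hZe, hZT, hZT'⟩ := hZ ε hε
    have hclosed : ∀ R : Set M.Elem, IsClosed (⋃ T'' ∈ R, M.dom T'') := fun R =>
      (toFinite R).isClosed_biUnion fun T'' _ => M.isClosed_dom T''
    have hcover : Z ⊆ (⋃ T'' ∈ S, M.dom T'') ∪ ⋃ T'' ∈ S', M.dom T'' := by
      intro q hq
      obtain ⟨hq1, hq2⟩ := hZs hq
      rw [← M.cover, mem_iUnion₂] at hq1
      obtain ⟨T'', hT'', hqT⟩ := hq1
      have hab'' := hball ⟨T'', hT''⟩ q hq2 hqT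
      by_cases hS : (⟨T'', hT''⟩ : M.Elem) ∈ S
      · exact Or.inl (mem_biUnion hS hqT)
      · exact Or.inr (mem_biUnion (show (⟨T'', hT''⟩ : M.Elem) ∈ S' from ⟨hab'', hS⟩) hqT)
    obtain ⟨q, hqZ, hq1, hq2⟩ := isPreconnected_closed_iff.1 hZc _ _ (hclosed S) (hclosed S')
      hcover (hZT.mono (inter_subset_inter_right _ (subset_biUnion_of_mem hTS)))
      (hZT'.mono (inter_subset_inter_right _ (subset_biUnion_of_mem hTS')))
    rw [mem_iUnion₂] at hq1 hq2
    obtain ⟨T₁, h₁, hq1⟩ := hq1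
    obtain ⟨T₂, h₂, hq2⟩ := hq2
    have : q ∈ Z ∩ segment ℝ a b := ⟨hqZ, hsep T₁ h₁ T₂ h₂ ⟨hq1, hq2⟩⟩
    rw [hZe] at this
    exact this
  have hq := key p (hsegTT p hp)
  have hy' := hsegTT y hy
  have hz' := hsegTT z hz
  rw [segment_eq_image'] at hy' hz'
  obtain ⟨s, -, rfl⟩ := hy'
  obtain ⟨t, -, rfl⟩ := hz'
  have : a + s • (b - a) - (a + t • (b - a)) = (s - t) • (b - a) := by rw [sub_smul]; abel
  beta_reduce
  rw [this, inner_smul_right, hq, mul_zero]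

end TetMesh
end EdgeElement

namespace EdgeElement
open Topology

/-! ### Additive cocycles on simply connected spaces -/

/-- The real numbers with the discrete topology. -/
def DiscreteReal : Type := ℝ

instance : TopologicalSpace DiscreteReal := ⊥

instance : DiscreteTopology DiscreteReal := ⟨rfl⟩

section Cocycle

variable {X ι : Type*} [TopologicalSpace X]

/-- The covering space of a constant additive cocycle. -/
def cocycleCore (U : ι → Set X) (hU : ∀ i, IsOpen (U i)) (hcov : ∀ x, ∃ i, x ∈ U i)
    (c : ι → ι → ℝ)
    (hc : ∀ i j k x, x ∈ U i → x ∈ U j → x ∈ U k → c i j + c j k = c i k) :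
    FiberBundleCore ι X DiscreteReal where
  baseSet := U
  isOpen_baseSet := hU
  indexAt x := (hcov x).choose
  mem_baseSet_at x := (hcov x).choose_spec
  coordChange i j _ t := HAdd.hAdd (α := ℝ) (β := ℝ) (γ := ℝ) t (c i j)
  coordChange_self i x hx v := by
    have := hc i i i x hx hx hx
    change (show ℝ from v) + c i i = v
    have h0 : c i i = 0 := by linarith
    rw [h0, add_zero]
  continuousOn_coordChange i j := by
    refine Continuous.continuousOn ?_
    exact (continuous_of_discreteTopology (α := DiscreteReal) (β := DiscreteReal)
      (f := fun t => HAdd.hAdd (α := ℝ) (β := ℝ) (γ := ℝ) t (c i j))).comp continuous_snd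
  coordChange_comp i j k x hx v := by
    have := hc i j k x hx.1.1 hx.1.2 hx.2
    change (show ℝ from v) + c i j + c j k = (show ℝ from v) + c i k
    rw [add_assoc, this]

/-- A constant additive cocycle on a simply connected space is a coboundary. -/
lemma exists_potential_of_cocycle [SimplyConnectedSpace X] [LocallyPathConnectedSpace X]
    (U : ι → Set X) (hU : ∀ i, IsOpen (U i)) (hcov : ∀ x, ∃ i, x ∈ U i) (c : ι → ι → ℝ)
    (hc : ∀ i j k x, x ∈ U i → x ∈ U j → x ∈ U k → c i j + c j k = c i k) :
    ∃ g : ι → X → ℝ, (∀ i, ContinuousOn (Y := DiscreteReal) (g i) (U i)) ∧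
      ∀ i j x, x ∈ U i → x ∈ U j → g j x = g i x + c i j := by
  let Z := cocycleCore U hU hcov c hc
  have hZ : IsCoveringMap Z.proj :=
    IsFiberBundle.isCoveringMap fun x => ⟨Z.localTriv (Z.indexAt x), Z.mem_baseSet_at x⟩
  have x₀ : X := Classical.arbitrary X
  obtain ⟨F, ⟨-, hF⟩, -⟩ := hZ.existsUnique_continuousMap_lifts (ContinuousMap.id X) x₀
    (⟨x₀, (0 : ℝ)⟩ : Z.TotalSpace) rfl
  have hF' : ∀ x, (F x).1 = x := fun x => congrFun hF x
  refine ⟨fun i x => (Z.localTriv i (F x)).2, fun i => ?_, fun i j x hi hj => ?_⟩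
  · refine continuous_snd.comp_continuousOn ?_
    refine (Z.localTriv i).continuousOn.comp F.continuous.continuousOn fun x hx => ?_
    rw [Z.mem_localTriv_source]
    rw [hF' x]
    exact hx
  · simp only [FiberBundleCore.localTriv_apply]
    have h := Z.coordChange_comp (Z.indexAt (F x).1) i j (F x).1 ⟨⟨Z.mem_baseSet_at _,
      by rw [hF']; exact hi⟩, by rw [hF']; exact hj⟩ (F x).2
    exact h.symm

end Cocycle

namespace TetMesh

variable {Ω : Set E3} (M : TetMesh Ω)

lemma mem_region_iff (ω : Finset M.Elem) (x : E3) : x ∈ M.region ω ↔ ∃ T ∈ ω, x ∈ M.dom T := by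
  simp [region]

lemma locallyPathConnectedSpace_region (ω : Finset M.Elem) :
    LocallyPathConnectedSpace (M.region ω) := by
  have hex : ∀ x : M.region ω, ∃ ε > 0, ∀ T ∈ ω, ∀ y ∈ Metric.ball (x : E3) ε,
      y ∈ M.dom T → (x : E3) ∈ M.dom T := by
    intro x
    have : ∀ᶠ y in 𝓝 (x : E3), ∀ T ∈ ω, y ∈ M.dom T → (x : E3) ∈ M.dom T := by
      rw [Filter.eventually_all_finset]
      intro T _
      by_cases hx : (x : E3) ∈ M.dom T
      · exact Filter.Eventually.of_forall fun _ _ => hx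
      · filter_upwards [(M.isClosed_dom T).isOpen_compl.mem_nhds hx] with y hy hy'
        exact absurd hy' hy
    obtain ⟨ε, hε, h⟩ := Metric.eventually_nhds_iff_ball.1 this
    exact ⟨ε, hε, fun T hT y hy => h y hy T hT⟩
  choose r hr hrT using hex
  refine LocallyPathConnectedSpace.of_bases (p := fun x ε => 0 < ε ∧ ε ≤ r x)
    (s := fun x ε => Metric.ball x ε) (fun x => ?_) fun x ε hε => ?_
  · refine Metric.nhds_basis_ball.to_hasBasis (fun ε hε => ?_) fun ε hε => ⟨ε, hε.1, le_rfl⟩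
    exact ⟨min ε (r x), ⟨lt_min hε (hr x), min_le_right _ _⟩,
      Metric.ball_subset_ball (min_le_left _ _)⟩
  · have hstar : StarConvex ℝ (x : E3) (Metric.ball (x : E3) ε ∩ M.region ω) := by
      rw [starConvex_iff_segment_subset]
      rintro y ⟨hy, hyω⟩
      obtain ⟨T, hT, hyT⟩ := (M.mem_region_iff ω y).1 hyω
      have hxT := hrT x T hT y (Metric.ball_subset_ball hε.2 hy) hyT
      refine subset_inter ((convex_ball _ _).segment_subset (Metric.mem_ball_self hε.1) hy) ?_
      exact ((M.convex_dom T).segment_subset hxT hyT).trans fun z hz =>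
        (M.mem_region_iff ω z).2 ⟨T, hT, hz⟩
    have := (hstar.isPathConnected ⟨Metric.mem_ball_self hε.1, x.2⟩).preimage_coe
      inter_subset_right
    convert this using 1
    ext y
    simp [Subtype.dist_eq]

lemma exists_bary_pos (T : M.Elem) {x : E3} (hx : x ∈ M.dom T) : ∃ a, 0 < M.bary T a x := by
  by_contra! h
  have h1 := M.sum_bary T x
  rw [Finset.sum_eq_zero fun a _ => le_antisymm (h a) ((M.mem_dom_iff T x).1 hx a)] at h1
  exact zero_ne_one h1

/-- On a simply connected patch, functions on the elements whose differences are constant on the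
intersections of the elements can be made to agree there by adding constants. -/
lemma exists_const_of_isSimplyConnected {ω : Finset M.Elem}
    (hω : IsSimplyConnected (M.region ω)) (f : M.Elem → E3 → ℝ)
    (hf : ∀ T ∈ ω, ∀ T' ∈ ω, ∀ p ∈ M.dom T ∩ M.dom T', ∀ q ∈ M.dom T ∩ M.dom T',
      f T p - f T q = f T' p - f T' q) :
    ∃ κ : M.Elem → ℝ, ∀ T ∈ ω, ∀ T' ∈ ω, ∀ p ∈ M.dom T ∩ M.dom T',
      f T p + κ T = f T' p + κ T' := by
  classical
  have := hω.simplyConnectedSpace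
  have := M.locallyPathConnectedSpace_region ω
  let U : E3 → Set (M.region ω) := fun v => {x | ∀ T ∈ ω, (x : E3) ∈ M.dom T → v ∈ T.1}
  have hUo : ∀ v, IsOpen (U v) := by
    intro v
    have : U v = (⋃ T ∈ {T : M.Elem | T ∈ ω ∧ v ∉ T.1},
        ((↑) : M.region ω → E3) ⁻¹' M.dom T)ᶜ := by
      ext x
      simp only [U, mem_ofPred_eq, mem_compl_iff, mem_iUnion₂, mem_preimage, not_exists]
      constructor
      · rintro h T ⟨hT, hv⟩ hx
        exact hv (h T hT hx)
      · intro h T hT hx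
        by_contra hv
        exact h T ⟨hT, hv⟩ hx
    rw [this]
    exact ((toFinite _).isClosed_biUnion fun T _ =>
      (M.isClosed_dom T).preimage continuous_subtype_val).isOpen_compl
  have hcov : ∀ x, ∃ v, x ∈ U v := by
    intro x
    obtain ⟨T, hT, hx⟩ := (M.mem_region_iff ω x).1 x.2
    obtain ⟨a, ha⟩ := M.exists_bary_pos T hx
    exact ⟨a, fun T' _ hx' => M.mem_of_bary_pos hx hx' ha⟩
  let c : E3 → E3 → ℝ := fun v w =>
    if h : ∃ T ∈ ω, v ∈ T.1 ∧ w ∈ T.1 then f h.choose w - f h.choose v else 0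
  have hcT : ∀ T ∈ ω, ∀ v ∈ T.1, ∀ w ∈ T.1, c v w = f T w - f T v := by
    intro T hT v hv w hw
    have h : ∃ T ∈ ω, v ∈ T.1 ∧ w ∈ T.1 := ⟨T, hT, hv, hw⟩
    simp only [c, dif_pos h]
    obtain ⟨h1, h2, h3⟩ := h.choose_spec
    exact hf _ h1 T hT w ⟨M.mem_dom_of_mem _ h3, M.mem_dom_of_mem _ hw⟩ v
      ⟨M.mem_dom_of_mem _ h2, M.mem_dom_of_mem _ hv⟩
  obtain ⟨g, hg, hgc⟩ := exists_potential_of_cocycle U hUo hcov c (by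
    intro u v w x hu hv hw
    obtain ⟨T, hT, hx⟩ := (M.mem_region_iff ω x).1 x.2
    rw [hcT T hT u (hu T hT hx) v (hv T hT hx), hcT T hT v (hv T hT hx) w (hw T hT hx),
      hcT T hT u (hu T hT hx) w (hw T hT hx)]
    ring)
  have hreg : ∀ T ∈ ω, ∀ x ∈ M.dom T, x ∈ M.region ω := fun T hT x hx =>
    (M.mem_region_iff ω x).2 ⟨T, hT, hx⟩
  -- the potential is constant on the first half of an edge
  have hhalf : ∀ (T : M.Elem) (hT : T ∈ ω) (v w : E3) (hv : v ∈ T.1) (hw : w ∈ T.1)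
      (hm : midpoint ℝ v w ∈ M.dom T),
      (⟨midpoint ℝ v w, hreg T hT _ hm⟩ : M.region ω) ∈ U v ∧
      g v ⟨midpoint ℝ v w, hreg T hT _ hm⟩ = g v ⟨v, hreg T hT v (M.mem_dom_of_mem T hv)⟩ := by
    intro T hT v w hv hw hm
    have hdom : ∀ t : unitInterval, AffineMap.lineMap v (midpoint ℝ v w) (t : ℝ) ∈ M.dom T :=
      fun t => (M.convex_dom T).segment_subset (M.mem_dom_of_mem T hv) hm (by
        rw [segment_eq_image_lineMap]; exact ⟨t, t.2, rfl⟩)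
    have hpos : ∀ t : unitInterval,
        0 < M.bary T ⟨v, hv⟩ (AffineMap.lineMap v (midpoint ℝ v w) (t : ℝ)) := by
      intro t
      have hnn := (M.mem_dom_iff T w).1 (M.mem_dom_of_mem T hw) ⟨v, hv⟩
      have h1 : M.bary T ⟨v, hv⟩ (midpoint ℝ v w) = (1 + M.bary T ⟨v, hv⟩ w) / 2 := by
        rw [midpoint, AffineMap.apply_lineMap, M.bary_self T ⟨v, hv⟩, AffineMap.lineMap_apply]
        simp
        ring
      rw [AffineMap.apply_lineMap, h1, M.bary_self T ⟨v, hv⟩, AffineMap.lineMap_apply]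
      simp only [vsub_eq_sub, vadd_eq_add, smul_eq_mul]
      nlinarith [t.2.1, t.2.2, mul_nonneg t.2.1 hnn]
    let γ : unitInterval → M.region ω := fun t => ⟨_, hreg T hT _ (hdom t)⟩
    have hγ : Continuous γ := Continuous.subtype_mk
      (AffineMap.lineMap_continuous.comp continuous_subtype_val) _
    have hγU : ∀ t, γ t ∈ U v := fun t T' _ hx' =>
      M.mem_of_bary_pos (hdom t) hx' (hpos t)
    have hconst := PreconnectedSpace.constant (α := unitInterval) (Y := DiscreteReal) inferInstance
      ((hg v).comp_continuous hγ hγU) (x := 1) (y := 0)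
    have h0 : γ 0 = ⟨v, hreg T hT v (M.mem_dom_of_mem T hv)⟩ := Subtype.ext (by simp [γ])
    have h1 : γ 1 = ⟨midpoint ℝ v w, hreg T hT _ hm⟩ := Subtype.ext (by simp [γ])
    rw [← h0, ← h1]
    exact ⟨hγU 1, hconst⟩
  let d : E3 → ℝ := fun v => if h : v ∈ M.region ω then g v ⟨v, h⟩ else (0 : ℝ)
  have hd : ∀ T ∈ ω, ∀ v ∈ T.1, ∀ w ∈ T.1, f T w - f T v = d w - d v := by
    intro T hT v hv w hw
    have hm : midpoint ℝ v w ∈ M.dom T := (M.convex_dom T).midpoint_mem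
      (M.mem_dom_of_mem T hv) (M.mem_dom_of_mem T hw)
    have hm' : midpoint ℝ w v ∈ M.dom T := by rwa [midpoint_comm]
    obtain ⟨h1, h2⟩ := hhalf T hT v w hv hw hm
    obtain ⟨h3, h4⟩ := hhalf T hT w v hw hv hm'
    simp only [midpoint_comm w v] at h3 h4
    have h5 := hgc v w _ h1 h3
    have hdv : d v = g v ⟨v, hreg T hT v (M.mem_dom_of_mem T hv)⟩ := dif_pos _
    have hdw : d w = g w ⟨w, hreg T hT w (M.mem_dom_of_mem T hw)⟩ := dif_pos _
    rw [← hcT T hT v hv w hw, hdv, hdw, ← h2, ← h4, h5]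
    exact (add_sub_cancel_left _ _).symm
  have hne : ∀ T : M.Elem, ∃ v, v ∈ T.1 := fun T =>
    Finset.card_pos.1 (by rw [M.card_eq _ T.2]; norm_num)
  choose v₀ hv₀ using hne
  have hκ : ∀ T ∈ ω, ∀ v ∈ T.1, f T v + (d (v₀ T) - f T (v₀ T)) = d v := by
    intro T hT v hv
    have := hd T hT (v₀ T) (hv₀ T) v hv
    linarith
  refine ⟨fun T => d (v₀ T) - f T (v₀ T), fun T hT T' hT' p hp => ?_⟩
  obtain ⟨a, ha⟩ := M.exists_bary_pos T hp.1
  have ha' := M.mem_of_bary_pos hp.1 hp.2 ha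
  have h1 := hκ T hT a a.2
  have h2 := hκ T' hT' a ha'
  have h3 := hf T hT T' hT' p hp a ⟨M.mem_dom_of_mem T a.2, M.mem_dom_of_mem T' ha'⟩
  linarith

end TetMesh

end EdgeElement

namespace EdgeElement
open Topology

/-! ### Piecewise Lipschitz functions -/

lemma dist_le_of_closed_cover {ι : Type*} (h : ℝ → ℝ) (A : ι → Set ℝ) (hA : ∀ i, IsClosed (A i))
    {K : ℝ} (hh : ∀ i, ∀ x ∈ A i, ∀ y ∈ A i, dist (h x) (h y) ≤ K * dist x y) (s : Finset ι) :
    ∀ a b : ℝ, a ≤ b → Icc a b ⊆ ⋃ i ∈ s, A i → dist (h a) (h b) ≤ K * (b - a) := by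
  classical
  induction s using Finset.strongInduction with
  | H s ih =>
    intro a b hab hcov
    obtain ⟨i, hi, hai⟩ := mem_iUnion₂.1 (hcov (left_mem_Icc.2 hab))
    have hcomp : IsCompact (A i ∩ Icc a b) := isCompact_Icc.inter_left (hA i)
    obtain ⟨t, ⟨hti, hta, htb⟩, htmax⟩ := hcomp.exists_isGreatest ⟨a, hai, left_mem_Icc.2 hab⟩
    have h1 : dist (h a) (h t) ≤ K * (t - a) := by
      have := hh i a hai t hti
      rwa [dist_comm a t, Real.dist_eq t a, abs_of_nonneg (sub_nonneg.2 hta)] at this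
    rcases htb.eq_or_lt with rfl | htb
    · exact h1
    have hcov' : Icc t b ⊆ ⋃ j ∈ s.erase i, A j := by
      have hcl : IsClosed (⋃ j ∈ s.erase i, A j) :=
        isClosed_biUnion_finset fun j _ => hA j
      rw [← closure_Ioc htb.ne]
      refine closure_minimal (fun r hr => ?_) hcl
      obtain ⟨j, hj, hrj⟩ := mem_iUnion₂.1 (hcov ⟨hta.trans hr.1.le, hr.2⟩)
      refine mem_iUnion₂.2 ⟨j, Finset.mem_erase.2 ⟨?_, hj⟩, hrj⟩
      rintro rfl
      exact absurd (htmax ⟨hrj, hta.trans hr.1.le, hr.2⟩) (not_le.2 hr.1)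
    have h2 := ih _ (Finset.erase_ssubset hi) t b htb.le hcov'
    calc dist (h a) (h b) ≤ dist (h a) (h t) + dist (h t) (h b) := dist_triangle _ _ _
      _ ≤ K * (t - a) + K * (b - t) := add_le_add h1 h2
      _ = K * (b - a) := by ring

lemma lipschitzWith_of_closed_cover {ι : Type*} [Fintype ι] {G : E3 → ℝ} (A : ι → Set E3)
    (hA : ∀ i, IsClosed (A i)) (hcov : ∀ x, ∃ i, x ∈ A i) {K : NNReal}
    (hG : ∀ i, LipschitzOnWith K G (A i)) : LipschitzWith K G := by
  refine LipschitzWith.of_dist_le_mul fun x y => ?_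
  let γ : ℝ → E3 := fun t => AffineMap.lineMap x y t
  have hγ : Continuous γ := AffineMap.lineMap_continuous
  have h := dist_le_of_closed_cover (G ∘ γ) (fun i => γ ⁻¹' A i) (fun i => (hA i).preimage hγ)
    (K := K * dist x y) (fun i s hs t ht => by
      have := (hG i).dist_le_mul _ hs _ ht
      rw [dist_lineMap_lineMap] at this
      exact this.trans (by rw [mul_assoc, mul_comm (dist s t)])) Finset.univ 0 1 zero_le_one
    (fun t _ => by
      obtain ⟨i, hi⟩ := hcov (γ t)
      exact mem_iUnion₂.2 ⟨i, Finset.mem_univ _, hi⟩)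
  simpa [γ] using h

namespace TetMesh

variable {Ω : Set E3} (M : TetMesh Ω)

lemma memLp_glue {V : Type*} [NormedAddCommGroup V] (ω : Finset M.Elem) (f : ω → E3 → V)
    (hf : ∀ T, Continuous (f T)) : MemLp (M.glue ω f) 2 := by
  have : M.glue ω f = ∑ T : ω, (interior (M.dom T.1)).indicator (f T) := by
    ext x; simp [glue]
  rw [this]
  refine memLp_finsetSum' _ fun T _ => ?_
  rw [memLp_indicator_iff_restrict isOpen_interior.measurableSet]
  obtain ⟨C, hC⟩ := (M.isCompact_dom T.1).exists_bound_of_continuousOn (hf T).continuousOn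
  have hfin : volume (interior (M.dom T.1)) < ⊤ :=
    (measure_mono interior_subset).trans_lt (M.isCompact_dom T.1).measure_lt_top
  have : IsFiniteMeasure (volume.restrict (interior (M.dom T.1))) := ⟨by simpa using hfin⟩
  refine MemLp.of_bound (hf T).aestronglyMeasurable C ?_
  exact (ae_restrict_iff' isOpen_interior.measurableSet).2
    (ae_of_all _ fun x hx => hC x (interior_subset hx))

lemma ae_notMem_frontier_dom (T : M.Elem) : ∀ᵐ x, x ∉ frontier (M.dom T) := by
  rw [ae_iff]
  simpa using (M.convex_dom T).addHaar_frontier volume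

lemma glue_of_notMem_region {V : Type*} [AddCommMonoid V] {ω : Finset M.Elem} (f : ω → E3 → V)
    {x : E3} (hx : x ∉ M.region ω) : M.glue ω f x = 0 :=
  Finset.sum_eq_zero fun T _ => indicator_of_notMem
    (fun h => hx ((M.mem_region_iff ω x).2 ⟨T.1, T.2, interior_subset h⟩)) _

/-- A continuous piecewise polynomial function belongs to the Lagrange space. -/
lemma mem_lagrangeSpace {k : ℕ} {ω : Finset M.Elem} {φ : ω → Poly}
    (hdeg : ∀ T, (φ T).totalDegree ≤ k + 1)
    (hφ : ∀ T T' : ω, ∀ p ∈ M.dom T.1 ∩ M.dom T'.1, evalS (φ T) p = evalS (φ T') p) :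
    φ ∈ M.lagrangeSpace k ω := by
  classical
  refine ⟨hdeg, (M.memLp_glue ω _ fun T => continuous_evalS _).restrict _, fun i => ?_⟩
  refine ⟨M.glue ω fun T => evalS (MvPolynomial.pderiv i (φ T)),
    (M.memLp_glue ω _ fun T => continuous_evalS _).restrict _, fun χ hχ hc hts => ?_⟩
  let F : E3 → ℝ := fun x => if h : ∃ T : ω, x ∈ M.dom T.1 then evalS (φ h.choose) x else 0
  have hF : ∀ (T : ω) (x : E3), x ∈ M.dom T.1 → F x = evalS (φ T) x := by
    intro T x hx
    have h : ∃ T : ω, x ∈ M.dom T.1 := ⟨T, hx⟩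
    simp only [F, dif_pos h]
    exact hφ _ _ x ⟨h.choose_spec, hx⟩
  let G : E3 → ℝ := fun x => F x * χ x
  have hprod : ∀ T, ContDiff ℝ (⊤ : ℕ∞) fun x => evalS (φ T) x * χ x := fun T =>
    (contDiff_evalS _).mul hχ
  have hLip : ∀ T : ω, ∃ K, LipschitzOnWith K G (M.dom T.1) := by
    intro T
    obtain ⟨K, hK⟩ := ((hprod T).of_le (m := 1)
      (by exact_mod_cast le_top)).contDiffOn.exists_lipschitzOnWith one_ne_zero (M.convex_dom T.1) (M.isCompact_dom T.1)
    refine ⟨K, fun x hx y hy => ?_⟩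
    simpa only [G, hF T x hx, hF T y hy] using hK hx hy
  choose K hK using hLip
  have hGL : LipschitzWith (∑ T, K T) G := by
    refine lipschitzWith_of_closed_cover (ι := Option ω)
      (fun o => o.elim {x | χ x = 0} fun T => M.dom T.1) ?_ ?_ ?_
    · rintro (_ | T)
      · exact isClosed_eq hχ.continuous continuous_const
      · exact M.isClosed_dom T.1
    · intro x
      by_cases hx : χ x = 0
      · exact ⟨none, hx⟩
      · obtain ⟨T, hT, hxT⟩ := (M.mem_region_iff ω x).1
          (interior_subset (hts (subset_tsupport χ hx)))
        exact ⟨some ⟨T, hT⟩, hxT⟩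
    · rintro (_ | T)
      · intro x hx y hy
        have hx' : χ x = 0 := hx
        have hy' : χ y = 0 := hy
        simp [G, hx', hy']
      · exact (hK T).weaken (Finset.single_le_sum (f := K) (fun _ _ => zero_le) (Finset.mem_univ T))
  set e : E3 := EuclideanSpace.single i 1 with he
  have hint : ∫ x, lineDeriv ℝ G x e = 0 := by
    have := LipschitzWith.integral_lineDeriv_mul_eq (μ := volume) (LipschitzWith.const (1 : ℝ))
      hGL (hc.mul_left (f := F)) (-e)
    simpa [lineDeriv] using this.symm
  set a := M.glue ω fun T => evalS (φ T)
  set b := M.glue ω fun T => evalS (MvPolynomial.pderiv i (φ T))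
  have hdχ : MemLp (fun x => fderiv ℝ χ x e) 2 :=
    (continuous_fderiv_apply_const hχ e).memLp_of_hasCompactSupport (hc.fderiv_apply (𝕜 := ℝ) e)
  have hχL : MemLp χ 2 := hχ.continuous.memLp_of_hasCompactSupport hc
  have i₁ : Integrable fun x => a x * fderiv ℝ χ x e :=
    (M.memLp_glue ω _ fun T => continuous_evalS _).integrable_mul hdχ
  have i₂ : Integrable fun x => b x * χ x :=
    (M.memLp_glue ω _ fun T => continuous_evalS _).integrable_mul hχL
  have hae : ∀ᵐ x, lineDeriv ℝ G x e = a x * fderiv ℝ χ x e + b x * χ x := by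
    have hfr : ∀ᵐ x, ∀ T : M.Elem, x ∉ frontier (M.dom T) :=
      ae_all_iff.2 fun T => M.ae_notMem_frontier_dom T
    filter_upwards [hfr] with x hx
    by_cases hxω : x ∈ M.region ω
    · obtain ⟨T, hT, hxT⟩ := (M.mem_region_iff ω x).1 hxω
      have hxi : x ∈ interior (M.dom T) := by
        by_contra h
        exact hx T ⟨subset_closure hxT, h⟩
      have hev : G =ᶠ[𝓝 x] fun x => evalS (φ ⟨T, hT⟩) x * χ x := by
        filter_upwards [isOpen_interior.mem_nhds hxi] with y hy
        simp only [G, hF ⟨T, hT⟩ y (interior_subset hy)]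
      have h1 : a x = evalS (φ ⟨T, hT⟩) x :=
        M.glue_of_mem_interior (fun T => evalS (φ T)) ⟨T, hT⟩ hxi
      have h2 : b x = evalS (MvPolynomial.pderiv i (φ ⟨T, hT⟩)) x :=
        M.glue_of_mem_interior (fun T => evalS (MvPolynomial.pderiv i (φ T))) ⟨T, hT⟩ hxi
      rw [hev.lineDeriv_eq, ((hprod _).differentiable (by simp) x).lineDeriv_eq_fderiv, h1, h2,
        fderiv_fun_mul ((contDiff_evalS _ (n := 1)).differentiable (by simp) x)
          (hχ.differentiable (by simp) x)]
      simp [fderiv_evalS, he, mul_comm]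
    · have hxs : x ∉ tsupport χ := fun h => hxω (interior_subset (hts h))
      have hev : G =ᶠ[𝓝 x] fun _ => 0 := by
        filter_upwards [notMem_tsupport_iff_eventuallyEq.1 hxs] with y hy
        simp [G, hy]
      rw [hev.lineDeriv_eq, (differentiableAt_const _).lineDeriv_eq_fderiv, show a x = 0 from M.glue_of_notMem_region _ hxω,
        show b x = 0 from M.glue_of_notMem_region _ hxω]
      simp
  rw [integral_congr_ae hae, integral_add i₁ i₂] at hint
  rw [setIntegral_eq_integral_of_forall_compl_eq_zero,
    setIntegral_eq_integral_of_forall_compl_eq_zero]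
  · linarith
  · intro x hx
    rw [image_eq_zero_of_notMem_tsupport fun h => hx (hts h), mul_zero]
  · intro x hx
    have : fderiv ℝ χ x = 0 := by
      by_contra h0
      exact hx (hts (support_fderiv_subset ℝ h0))
    simp [this]

end TetMesh

end EdgeElement

namespace EdgeElement
open Topology

/-! ### The reference simplex -/

/-- The reference simplex. -/
def refSimplex : Set E3 := {x | (∀ i, 0 ≤ x i) ∧ ∑ i, x i ≤ 1}

/-- The point of the reference simplex with given barycentric coordinates. -/
def refPoint (l : Fin 4 → ℝ) : E3 := WithLp.toLp 2 fun i => l i.succ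

lemma refPoint_mem {l : Fin 4 → ℝ} (h0 : ∀ i, 0 ≤ l i) (h1 : ∑ i, l i = 1) :
    refPoint l ∈ refSimplex := by
  refine ⟨fun i => h0 _, ?_⟩
  rw [Fin.sum_univ_succ] at h1
  have := h0 0
  change ∑ i : Fin 3, l i.succ ≤ 1
  linarith

lemma simplexMap_refPoint (w : Fin 4 → E3) {l : Fin 4 → ℝ} (h1 : ∑ i, l i = 1) :
    simplexMap w (refPoint l) = ∑ i, l i • w i := by
  rw [simplexMap, simplexLin_apply, Fin.sum_univ_succ (fun i => l i • w i)]
  rw [Fin.sum_univ_succ] at h1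
  have : l 0 = 1 - ∑ i : Fin 3, l i.succ := by linarith
  rw [this]
  simp only [refPoint, smul_sub, Finset.sum_sub_distrib, sub_smul, Finset.sum_smul, one_smul]
  abel

lemma convex_refSimplex : Convex ℝ refSimplex := by
  rintro x ⟨hx, hx'⟩ y ⟨hy, hy'⟩ a b ha hb hab
  refine ⟨fun i => ?_, ?_⟩
  · simp only [PiLp.add_apply, PiLp.smul_apply, smul_eq_mul]
    exact add_nonneg (mul_nonneg ha (hx i)) (mul_nonneg hb (hy i))
  · simp only [PiLp.add_apply, PiLp.smul_apply, smul_eq_mul, Finset.sum_add_distrib,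
      ← Finset.mul_sum]
    nlinarith

lemma le_one_of_mem_refSimplex {x : E3} (hx : x ∈ refSimplex) (i : Fin 3) : x i ≤ 1 :=
  (Finset.single_le_sum (f := fun i => x i) (fun i _ => hx.1 i) (Finset.mem_univ i)).trans hx.2

lemma isCompact_refSimplex : IsCompact refSimplex := by
  refine Metric.isCompact_of_isClosed_isBounded ?_ ?_
  · have h1 : IsClosed {x : E3 | ∀ i, 0 ≤ x i} := by
      have : {x : E3 | ∀ i, 0 ≤ x i} = ⋂ i, {x : E3 | 0 ≤ x i} := by ext x; simp
      rw [this]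
      exact isClosed_iInter fun i => isClosed_le continuous_const (by fun_prop)
    exact h1.inter (isClosed_le (f := fun x : E3 => ∑ i, x i) (by fun_prop) continuous_const)
  · refine isBounded_iff_forall_norm_le.2 ⟨3, fun x hx => ?_⟩
    rw [EuclideanSpace.norm_eq]
    refine Real.sqrt_le_iff.2 ⟨by norm_num, ?_⟩
    calc ∑ i, ‖x i‖ ^ 2 ≤ ∑ _i : Fin 3, (1 : ℝ) := by
          refine Finset.sum_le_sum fun i _ => ?_
          rw [Real.norm_eq_abs, abs_of_nonneg (hx.1 i)]
          exact pow_le_one₀ (hx.1 i) (le_one_of_mem_refSimplex hx i)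
      _ ≤ 3 ^ 2 := by norm_num

lemma interior_refSimplex_nonempty : (interior refSimplex).Nonempty := by
  let U : Set E3 := {x | (∀ i, 0 < x i) ∧ ∑ i, x i < 1}
  have hU : IsOpen U := by
    have h1 : IsOpen {x : E3 | ∀ i, 0 < x i} := by
      have : {x : E3 | ∀ i, 0 < x i} = ⋂ i, {x : E3 | 0 < x i} := by ext x; simp
      rw [this]
      exact isOpen_iInter_of_finite fun i => isOpen_lt continuous_const (by fun_prop)
    exact h1.inter (isOpen_lt (f := fun x : E3 => ∑ i, x i) (by fun_prop) continuous_const)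
  have hsub : U ⊆ refSimplex := fun x hx => ⟨fun i => (hx.1 i).le, hx.2.le⟩
  refine ⟨WithLp.toLp 2 fun _ => 1 / 4, interior_maximal hsub hU ⟨fun i => ?_, ?_⟩⟩
  · norm_num
  · simp; norm_num

lemma image_simplexMap (w : Fin 4 → E3) :
    simplexMap w '' refSimplex = convexHull ℝ (range w) := by
  refine Subset.antisymm ?_ (convexHull_min ?_ ?_)
  · rintro _ ⟨x, hx, rfl⟩
    let l : Fin 4 → ℝ := Fin.cons (1 - ∑ i, x i) fun i => x i
    have hl1 : ∑ i, l i = 1 := by simp [l, Fin.sum_univ_succ]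
    have hl0 : ∀ i, 0 ≤ l i := by
      intro i
      refine Fin.cases ?_ (fun j => ?_) i
      · simpa [l] using hx.2
      · simpa [l] using hx.1 j
    have : x = refPoint l := by ext i; simp [refPoint, l]
    rw [this, simplexMap_refPoint w hl1]
    exact (convex_convexHull ℝ _).sum_mem (fun i _ => hl0 i) hl1
      fun i _ => subset_convexHull ℝ _ (mem_range_self i)
  · rintro _ ⟨i, rfl⟩
    have h1 : ∑ j, (Pi.single i 1 : Fin 4 → ℝ) j = 1 := by simp
    refine ⟨refPoint (Pi.single i 1), refPoint_mem (fun j => ?_) h1, ?_⟩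
    · by_cases h : j = i
      · subst h; simp
      · simp [h]
    · rw [simplexMap_refPoint w h1, Finset.sum_eq_single i] <;> simp +contextual
  · have : simplexMap w '' refSimplex = (fun z => w 0 + z) '' (simplexLin w '' refSimplex) := by
      rw [image_image]; rfl
    rw [this]
    exact (convex_refSimplex.is_linear_image (simplexLin w).toLinearMap.isLinear).translate _

/-! ### A discrete Friedrichs inequality on the reference patches -/

/-- For linear maps on a finite-dimensional space, the distance to the kernel of the first one is
controlled by its norm. -/
lemma exists_norm_sub_le {V W E : Type*} [AddCommGroup V] [Module ℝ V] [FiniteDimensional ℝ V]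
    [NormedAddCommGroup W] [NormedSpace ℝ W] [NormedAddCommGroup E] [NormedSpace ℝ E]
    (D : V →ₗ[ℝ] W) (B : V →ₗ[ℝ] E) :
    ∃ C : ℝ, 0 ≤ C ∧ ∀ v, ∃ z, D z = 0 ∧ ‖B (v - z)‖ ≤ C * ‖D v‖ := by
  obtain ⟨g, hg⟩ := D.rangeRestrict.exists_rightInverse_of_surjective D.range_rangeRestrict
  let f : LinearMap.range D →L[ℝ] E := LinearMap.toContinuousLinearMap (B ∘ₗ g)
  refine ⟨‖f‖, norm_nonneg f, fun v => ⟨v - g (D.rangeRestrict v), ?_, ?_⟩⟩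
  · have h := congrArg Subtype.val (LinearMap.congr_fun hg (D.rangeRestrict v))
    have h' : D (g (D.rangeRestrict v)) = D v := h
    rw [map_sub, h', sub_self]
  · rw [sub_sub_cancel]
    exact f.le_opNorm (D.rangeRestrict v)

lemma memLp_evalS (p : Poly) : MemLp (evalS p) 2 (volume.restrict refSimplex) := by
  have : IsFiniteMeasure (volume.restrict refSimplex) :=
    ⟨by simpa using isCompact_refSimplex.measure_lt_top⟩
  obtain ⟨C, hC⟩ := isCompact_refSimplex.exists_bound_of_continuousOn
    (continuous_evalS p).continuousOn
  exact MemLp.of_bound (continuous_evalS p).aestronglyMeasurable C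
    ((ae_restrict_iff' isCompact_refSimplex.measurableSet).2 (ae_of_all _ hC))

/-- Polynomials as elements of `L²` of the reference simplex. -/
def polyL2 : Poly →ₗ[ℝ] Lp ℝ 2 (volume.restrict refSimplex) where
  toFun p := (memLp_evalS p).toLp
  map_add' p q := by
    rw [← MemLp.toLp_add]
    exact MemLp.toLp_congr _ _ (by rw [map_add])
  map_smul' c p := by
    rw [RingHom.id_apply, ← MemLp.toLp_const_smul]
    exact MemLp.toLp_congr _ _ (by rw [map_smul])

lemma eq_zero_of_polyL2_eq_zero {p : Poly} (h : polyL2 p = 0) : p = 0 := by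
  have h1 : evalS p =ᵐ[volume.restrict refSimplex] 0 := 
    (memLp_evalS p).coeFn_toLp.symm.trans (Lp.eq_zero_iff_ae_eq_zero.1 h)
  rw [Filter.EventuallyEq, ae_restrict_iff' isCompact_refSimplex.measurableSet] at h1
  refine eq_zero_of_evalS_eq_zero isOpen_interior interior_refSimplex_nonempty fun x hx => ?_
  by_contra hne
  have hop : IsOpen (interior refSimplex ∩ {y | evalS p y ≠ 0}) :=
    isOpen_interior.inter (isOpen_ne_fun (continuous_evalS p) continuous_const)
  refine (hop.measure_pos volume ⟨x, hx, hne⟩).ne' (measure_mono_null ?_ h1)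
  exact fun y hy h => hy.2 (h (interior_subset hy.1))

lemma norm_polyL2_sq (p : Poly) : ‖polyL2 p‖ ^ 2 = ∫ x in refSimplex, evalS p x ^ 2 := by
  rw [← real_inner_self_eq_norm_sq, L2.inner_def]
  refine integral_congr_ae ?_
  filter_upwards [(memLp_evalS p).coeFn_toLp] with x hx
  have : (polyL2 p : E3 → ℝ) x = evalS p x := hx
  rw [this]
  simp [sq]

instance : CompactSpace refSimplex := isCompact_iff_compactSpace.1 isCompact_refSimplex

/-- Polynomials as continuous functions on the reference simplex. -/
def polyC : Poly →ₗ[ℝ] C(refSimplex, ℝ) where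
  toFun p := ⟨fun x => evalS p x, (continuous_evalS p).comp continuous_subtype_val⟩
  map_add' p q := by ext x; simp
  map_smul' c p := by ext x; simp

/-- The curl as a linear map. -/
def curlL : VPoly →ₗ[ℝ] VPoly where
  toFun := curl
  map_add' u v := by
    ext1 i
    fin_cases i <;> simp [curl] <;> ring
  map_smul' c u := by
    ext1 i
    fin_cases i <;> simp [curl, smul_sub]

variable {n m : ℕ}

/-- The barycentric weights of the points shared by two elements of a labelled patch. -/
def sharedWeights (l : Fin n → Fin 4 → Fin m) (s t : Fin n) : Set (Fin m → ℝ) :=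
  {g | (∀ j, 0 ≤ g j) ∧ ∑ j, g j = 1 ∧ ∀ j, g j ≠ 0 → j ∈ range (l s) ∧ j ∈ range (l t)}

/-- The piecewise polynomial fields with continuous tangential components on a labelled patch,
pulled back to the reference simplex. -/
def refSpace (k : ℕ) (l : Fin n → Fin 4 → Fin m) : Submodule ℝ (Fin n → VPoly) where
  carrier := {u | (∀ s, u s ∈ shapeSpace k) ∧ ∀ s t, ∀ g₁ ∈ sharedWeights l s t,
    ∀ g₂ ∈ sharedWeights l s t, ∀ g₃ ∈ sharedWeights l s t,
    inner ℝ (evalV (u s) (refPoint (g₁ ∘ l s))) (refPoint (g₂ ∘ l s) - refPoint (g₃ ∘ l s)) =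
    inner ℝ (evalV (u t) (refPoint (g₁ ∘ l t))) (refPoint (g₂ ∘ l t) - refPoint (g₃ ∘ l t))}
  zero_mem' := ⟨fun s => zero_mem _, by simp⟩
  add_mem' := by
    rintro u v ⟨hu, hu'⟩ ⟨hv, hv'⟩
    refine ⟨fun s => add_mem (hu s) (hv s), fun s t g₁ h₁ g₂ h₂ g₃ h₃ => ?_⟩
    simp only [Pi.add_apply, map_add, inner_add_left]
    rw [hu' s t g₁ h₁ g₂ h₂ g₃ h₃, hv' s t g₁ h₁ g₂ h₂ g₃ h₃]
  smul_mem' := by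
    rintro c u ⟨hu, hu'⟩
    refine ⟨fun s => Submodule.smul_mem _ c (hu s), fun s t g₁ h₁ g₂ h₂ g₃ h₃ => ?_⟩
    simp only [Pi.smul_apply, map_smul, inner_smul_left]
    rw [hu' s t g₁ h₁ g₂ h₂ g₃ h₃]

lemma mem_refSpace {k : ℕ} {l : Fin n → Fin 4 → Fin m} {u : Fin n → VPoly} :
    u ∈ refSpace k l ↔ (∀ s, u s ∈ shapeSpace k) ∧ ∀ s t, ∀ g₁ ∈ sharedWeights l s t,
    ∀ g₂ ∈ sharedWeights l s t, ∀ g₃ ∈ sharedWeights l s t,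
    inner ℝ (evalV (u s) (refPoint (g₁ ∘ l s))) (refPoint (g₂ ∘ l s) - refPoint (g₃ ∘ l s)) =
    inner ℝ (evalV (u t) (refPoint (g₁ ∘ l t))) (refPoint (g₂ ∘ l t) - refPoint (g₃ ∘ l t)) :=
  Iff.rfl

instance (k : ℕ) (l : Fin n → Fin 4 → Fin m) : FiniteDimensional ℝ (refSpace k l) := by
  let f : (Fin n → shapeSpace k) →ₗ[ℝ] (Fin n → VPoly) :=
    LinearMap.pi fun s => (Submodule.subtype _).comp (LinearMap.proj s)
  have : refSpace k l ≤ LinearMap.range f := fun v hv =>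
    ⟨fun s => ⟨v s, hv.1 s⟩, by ext1 s; simp [f]⟩
  exact Submodule.finiteDimensional_of_le this

lemma exists_curl_free_approx (k : ℕ) (l : Fin n → Fin 4 → Fin m) :
    ∃ C : ℝ, 0 ≤ C ∧ ∀ u ∈ refSpace k l, ∃ z ∈ refSpace k l, (∀ s, curl (z s) = 0) ∧
      ∀ R : ℝ, 0 ≤ R → (∀ s i, ‖polyL2 (curl (u s) i)‖ ≤ R) →
      ∀ s, ∀ x ∈ refSimplex, ∀ i, |evalV (u s - z s) x i| ≤ C * R := by
  let D : refSpace k l →ₗ[ℝ] (Fin n → Fin 3 → Lp ℝ 2 (volume.restrict refSimplex)) :=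
    LinearMap.pi fun s => LinearMap.pi fun i =>
      polyL2 ∘ₗ LinearMap.proj i ∘ₗ curlL ∘ₗ LinearMap.proj s ∘ₗ (refSpace k l).subtype
  let B : refSpace k l →ₗ[ℝ] (Fin n → Fin 3 → C(refSimplex, ℝ)) :=
    LinearMap.pi fun s => LinearMap.pi fun i =>
      polyC ∘ₗ LinearMap.proj i ∘ₗ LinearMap.proj s ∘ₗ (refSpace k l).subtype
  have hD : ∀ v s i, D v s i = polyL2 (curl (v.1 s) i) := fun _ _ _ => rfl
  have hB : ∀ v s i, B v s i = polyC (v.1 s i) := fun _ _ _ => rfl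
  clear_value D B
  obtain ⟨C, hC, h⟩ := exists_norm_sub_le D B
  refine ⟨C, hC, fun u hu => ?_⟩
  obtain ⟨z, hz, hz'⟩ := h ⟨u, hu⟩
  refine ⟨z, z.2, fun s => ?_, fun R hR hDR s x hx i => ?_⟩
  · ext1 i
    refine eq_zero_of_polyL2_eq_zero ?_
    rw [← hD, hz]
    rfl
  · have h1 : ‖D ⟨u, hu⟩‖ ≤ R := by
      rw [pi_norm_le_iff_of_nonneg hR]
      intro s
      rw [pi_norm_le_iff_of_nonneg hR]
      intro i
      rw [hD]
      exact hDR s i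
    have h2 := hz'.trans (mul_le_mul_of_nonneg_left h1 hC)
    rw [pi_norm_le_iff_of_nonneg (mul_nonneg hC hR)] at h2
    have h3 := h2 s
    rw [pi_norm_le_iff_of_nonneg (mul_nonneg hC hR)] at h3
    have h4 := h3 i
    rw [hB] at h4
    exact (ContinuousMap.norm_coe_le_norm (polyC ((u s - (z : Fin n → VPoly) s) i))
      ⟨x, hx⟩).trans h4

/-- The constant can be chosen uniformly for all patches with a bounded number of elements. -/
lemma exists_uniform_curl_free_approx (k N : ℕ) :
    ∃ C : ℝ, 0 ≤ C ∧ ∀ n ≤ N, ∀ m ≤ 4 * N, ∀ l : Fin n → Fin 4 → Fin m,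
      ∀ u ∈ refSpace k l, ∃ z ∈ refSpace k l, (∀ s, curl (z s) = 0) ∧
      ∀ R : ℝ, 0 ≤ R → (∀ s i, ‖polyL2 (curl (u s) i)‖ ≤ R) →
      ∀ s, ∀ x ∈ refSimplex, ∀ i, |evalV (u s - z s) x i| ≤ C * R := by
  choose C hC h using fun (n m : ℕ) (l : Fin n → Fin 4 → Fin m) => exists_curl_free_approx k l
  have hsum : ∀ n m, 0 ≤ ∑ l, C n m l := fun n m => Finset.sum_nonneg fun l _ => hC n m l
  refine ⟨∑ n ∈ Finset.range (N + 1), ∑ m ∈ Finset.range (4 * N + 1), ∑ l, C n m l,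
    Finset.sum_nonneg fun n _ => Finset.sum_nonneg fun m _ => hsum n m,
    fun n hn m hm l u hu => ?_⟩
  obtain ⟨z, hz, hz0, hz1⟩ := h n m l u hu
  refine ⟨z, hz, hz0, fun R hR hR' s x hx i => (hz1 R hR hR' s x hx i).trans ?_⟩
  refine mul_le_mul_of_nonneg_right ?_ hR
  calc C n m l ≤ ∑ l, C n m l :=
        Finset.single_le_sum (f := C n m) (fun l _ => hC n m l) (Finset.mem_univ l)
    _ ≤ ∑ m ∈ Finset.range (4 * N + 1), ∑ l, C n m l :=
        Finset.single_le_sum (f := fun m => ∑ l, C n m l) (fun m _ => hsum n m)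
          (Finset.mem_range.2 (by omega))
    _ ≤ _ := Finset.single_le_sum
          (f := fun n => ∑ m ∈ Finset.range (4 * N + 1), ∑ l, C n m l)
          (fun n _ => Finset.sum_nonneg fun m _ => hsum n m) (Finset.mem_range.2 (by omega))

end EdgeElement

namespace EdgeElement
open Topology Metric

/-! ### Simplices containing a ball -/

section Simplex

variable {w : Fin 4 → E3} {c : E3} {r h : ℝ}

lemma simplexLin_single (w : Fin 4 → E3) (i : Fin 3) :
    simplexLin w (EuclideanSpace.single i 1) = w i.succ - w 0 := by
  rw [simplexLin_apply, Finset.sum_eq_single i] <;> simp +contextual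

lemma mul_norm_le_sum_abs_inner (hr : 0 < r) (hball : closedBall c r ⊆ convexHull ℝ (range w))
    (v : E3) : r * ‖v‖ ≤ ∑ i : Fin 3, |inner ℝ v (w i.succ - w 0)| := by
  rcases eq_or_ne v 0 with rfl | hv
  · simp
  have hv' : ‖v‖ ≠ 0 := norm_ne_zero_iff.2 hv
  rw [← image_simplexMap] at hball
  obtain ⟨p, hp, hpc⟩ := hball (mem_closedBall_self hr.le)
  obtain ⟨q, hq, hqc⟩ := hball (show c + (r / ‖v‖) • v ∈ closedBall c r by
    rw [mem_closedBall, dist_eq_norm, add_sub_cancel_left, norm_smul, norm_div, norm_norm,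
      div_mul_cancel₀ _ hv', Real.norm_of_nonneg hr.le])
  have hL : simplexLin w (q - p) = (r / ‖v‖) • v := by
    rw [map_sub, ← add_sub_add_left_eq_sub _ _ (w 0)]
    change simplexMap w q - simplexMap w p = _
    rw [hqc, hpc, add_sub_cancel_left]
  have h1 : inner ℝ v (simplexLin w (q - p)) = r * ‖v‖ := by
    rw [hL, inner_smul_right, real_inner_self_eq_norm_sq]
    field_simp
  rw [← h1, simplexLin_apply, inner_sum]
  refine Finset.sum_le_sum fun i _ => (le_abs_self _).trans ?_
  rw [inner_smul_right, abs_mul]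
  refine mul_le_of_le_one_left (abs_nonneg _) ?_
  have h2 := le_one_of_mem_refSimplex hp i
  have h3 := le_one_of_mem_refSimplex hq i
  rw [PiLp.sub_apply, abs_le]
  constructor <;> linarith [hp.1 i, hq.1 i]

lemma simplexLin_bijective (hr : 0 < r) (hball : closedBall c r ⊆ convexHull ℝ (range w)) :
    Function.Bijective (simplexLin w) := by
  have hsurj : Function.Surjective (simplexLin w).toLinearMap := by
    rw [← LinearMap.range_eq_top, ← Submodule.orthogonal_eq_bot_iff, Submodule.eq_bot_iff]
    intro v hv
    have h1 := mul_norm_le_sum_abs_inner hr hball v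
    rw [Finset.sum_eq_zero fun i _ => ?_] at h1
    · exact norm_le_zero_iff.1 (nonpos_of_mul_nonpos_right h1 hr)
    · rw [abs_eq_zero, ← simplexLin_single, real_inner_comm]
      exact hv _ (LinearMap.mem_range_self (simplexLin w).toLinearMap _)
  exact ⟨LinearMap.injective_iff_surjective.2 hsurj, hsurj⟩

lemma setIntegral_simplex (hw : Function.Bijective (simplexLin w)) (g : E3 → ℝ) :
    ∫ x in convexHull ℝ (range w), g x =
      |(simplexLin w).det| * ∫ x in refSimplex, g (simplexMap w x) := by
  rw [← image_simplexMap, integral_image_eq_integral_abs_det_fderiv_smul volume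
    isCompact_refSimplex.measurableSet (f := simplexMap w) (f' := fun _ => simplexLin w)
    (fun x _ => ((simplexLin w).hasFDerivAt.const_add (w 0)).hasFDerivWithinAt)
    (fun x _ y _ hxy => hw.1 (add_left_cancel hxy)), ← integral_const_mul]
  rfl

lemma volume_refSimplex_pos : 0 < volume.real refSimplex :=
  ENNReal.toReal_pos (Measure.measure_pos_of_nonempty_interior _ interior_refSimplex_nonempty).ne'
    isCompact_refSimplex.measure_lt_top.ne

/-- The ratio of the volumes of the unit ball and of the reference simplex. -/
def ballRatio : ℝ := volume.real (ball (0 : E3) 1) / volume.real refSimplex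

lemma ballRatio_pos : 0 < ballRatio :=
  div_pos (ENNReal.toReal_pos (measure_ball_pos _ _ one_pos).ne' measure_ball_lt_top.ne)
    volume_refSimplex_pos

lemma ballRatio_mul_le_det (hr : 0 < r) (hball : closedBall c r ⊆ convexHull ℝ (range w)) :
    ballRatio * r ^ 3 ≤ |(simplexLin w).det| := by
  have h1 := setIntegral_simplex (simplexLin_bijective hr hball) fun _ => 1
  simp only [integral_const, smul_eq_mul, mul_one, measureReal_restrict_apply_univ] at h1
  have hK : IsCompact (convexHull ℝ (range w)) := (finite_range w).isCompact_convexHull (𝕜 := ℝ)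
  have h2 : volume.real (closedBall c r) ≤ volume.real (convexHull ℝ (range w)) :=
    measureReal_mono hball hK.measure_lt_top.ne
  rw [h1, Measure.addHaar_real_closedBall _ _ hr.le, finrank_euclideanSpace_fin] at h2
  rw [ballRatio, div_mul_eq_mul_div, div_le_iff₀ volume_refSimplex_pos, mul_comm]
  exact h2

lemma abs_apply_le_norm (v : E3) (i : Fin 3) : |v i| ≤ ‖v‖ := by
  simpa using PiLp.norm_apply_le v i

lemma abs_pderiv_sub_le (u : VPoly) (a b : Fin 3) (x : E3) :
    |evalS (MvPolynomial.pderiv a (u b) - MvPolynomial.pderiv b (u a)) x| ≤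
      ‖evalV (curl u) x‖ := by
  have hs : ∀ a b, |evalS (MvPolynomial.pderiv a (u b) - MvPolynomial.pderiv b (u a)) x| ≤
      ‖evalV (curl u) x‖ → |evalS (MvPolynomial.pderiv b (u a) - MvPolynomial.pderiv a (u b)) x| ≤
      ‖evalV (curl u) x‖ := fun a b hab => by
    rwa [← neg_sub, map_neg, Pi.neg_apply, abs_neg]
  have hd : ∀ a, |evalS (MvPolynomial.pderiv a (u a) - MvPolynomial.pderiv a (u a)) x| ≤
      ‖evalV (curl u) x‖ := fun a => by
    rw [sub_self, map_zero, Pi.zero_apply, abs_zero]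
    exact norm_nonneg _
  have h0 : |evalS (MvPolynomial.pderiv 1 (u 2) - MvPolynomial.pderiv 2 (u 1)) x| ≤
      ‖evalV (curl u) x‖ := abs_apply_le_norm (evalV (curl u) x) 0
  have h1 : |evalS (MvPolynomial.pderiv 2 (u 0) - MvPolynomial.pderiv 0 (u 2)) x| ≤
      ‖evalV (curl u) x‖ := abs_apply_le_norm (evalV (curl u) x) 1
  have h2 : |evalS (MvPolynomial.pderiv 0 (u 1) - MvPolynomial.pderiv 1 (u 0)) x| ≤
      ‖evalV (curl u) x‖ := abs_apply_le_norm (evalV (curl u) x) 2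
  fin_cases a <;> fin_cases b
  · exact hd 0
  · exact h2
  · exact hs _ _ h1
  · exact hs _ _ h2
  · exact hd 1
  · exact h0
  · exact h1
  · exact hs _ _ h0
  · exact hd 2

lemma abs_curl_pullV_le (hh : ∀ i : Fin 3, ‖w i.succ - w 0‖ ≤ h) (u : VPoly) (x : E3) (i : Fin 3) :
    |evalS (curl (pullV w u) i) x| ≤ 9 * h ^ 2 * ‖evalV (curl u) (simplexMap w x)‖ := by
  have h0 : 0 ≤ h := (norm_nonneg _).trans (hh 0)
  have key : ∀ i j, |evalS (MvPolynomial.pderiv i (pullV w u j) -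
      MvPolynomial.pderiv j (pullV w u i)) x| ≤
      9 * h ^ 2 * ‖evalV (curl u) (simplexMap w x)‖ := by
    intro i j
    rw [pderiv_pullV_sub]
    simp only [map_sum, Finset.sum_apply]
    calc _ ≤ ∑ _a : Fin 3, ∑ _b : Fin 3, h ^ 2 * ‖evalV (curl u) (simplexMap w x)‖ := by
          refine (Finset.abs_sum_le_sum_abs _ _).trans (Finset.sum_le_sum fun a _ =>
            (Finset.abs_sum_le_sum_abs _ _).trans (Finset.sum_le_sum fun b _ => ?_))
          have : evalS (MvPolynomial.C ((w i.succ - w 0) a * (w j.succ - w 0) b) *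
              pullS w (MvPolynomial.pderiv a (u b) - MvPolynomial.pderiv b (u a))) x =
              ((w i.succ - w 0) a * (w j.succ - w 0) b) *
              evalS (MvPolynomial.pderiv a (u b) - MvPolynomial.pderiv b (u a))
                (simplexMap w x) := by
            rw [← evalS_pullS]
            simp only [evalS_apply, map_mul, MvPolynomial.eval_C]
          rw [this, abs_mul, abs_mul, sq]
          refine mul_le_mul (mul_le_mul ((abs_apply_le_norm _ a).trans (hh i))
            ((abs_apply_le_norm _ b).trans (hh j)) (abs_nonneg _) h0)
            (abs_pderiv_sub_le u a b _) (abs_nonneg _) (mul_nonneg h0 h0)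
      _ = _ := by simp; ring
  fin_cases i
  · exact key 1 2
  · exact key 2 0
  · exact key 0 1

lemma norm_polyL2_curl_pullV_sq_le (hr : 0 < r)
    (hball : closedBall c r ⊆ convexHull ℝ (range w)) (hh : ∀ i : Fin 3, ‖w i.succ - w 0‖ ≤ h)
    (u : VPoly) (i : Fin 3) :
    ballRatio * r ^ 3 * ‖polyL2 (curl (pullV w u) i)‖ ^ 2 ≤
      81 * h ^ 4 * ∫ x in convexHull ℝ (range w), ‖evalV (curl u) x‖ ^ 2 := by
  have hcont : Continuous (simplexMap w) := continuous_const.add (simplexLin w).continuous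
  have h1 : ‖polyL2 (curl (pullV w u) i)‖ ^ 2 ≤
      81 * h ^ 4 * ∫ x in refSimplex, ‖evalV (curl u) (simplexMap w x)‖ ^ 2 := by
    rw [norm_polyL2_sq, ← integral_const_mul]
    refine setIntegral_mono_on ?_ ?_ isCompact_refSimplex.measurableSet fun x _ => ?_
    · exact ((continuous_evalS _).pow 2).continuousOn.integrableOn_compact isCompact_refSimplex
    · exact ((((continuous_evalV _).comp hcont).norm.pow 2).const_mul
        _).continuousOn.integrableOn_compact isCompact_refSimplex
    · have := pow_le_pow_left₀ (abs_nonneg _) (abs_curl_pullV_le hh u x i) 2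
      rw [sq_abs] at this
      exact this.trans_eq (by ring)
  rw [setIntegral_simplex (simplexLin_bijective hr hball)]
  have h2 := ballRatio_mul_le_det hr hball
  have h3 : 0 ≤ ballRatio * r ^ 3 := mul_nonneg ballRatio_pos.le (pow_nonneg hr.le 3)
  calc _ ≤ |(simplexLin w).det| *
        (81 * h ^ 4 * ∫ x in refSimplex, ‖evalV (curl u) (simplexMap w x)‖ ^ 2) :=
        mul_le_mul h2 h1 (sq_nonneg _) (abs_nonneg _)
    _ = _ := by ring

end Simplex

/-! ### Scaling of the elements of a mesh -/

lemma norm_tangential_le {n : E3} (hn : ‖n‖ ≤ 1) (v : E3) : ‖tangential n v‖ ≤ 2 * ‖v‖ := by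
  have h : tangential n v = ‖n‖ ^ 2 • v - inner ℝ n v • n := by
    rw [← real_inner_self_eq_norm_sq]
    simp only [tangential, PiLp.inner_apply, Fin.sum_univ_three]
    ext i
    fin_cases i <;> simp [cross_apply] <;> ring
  have h1 : ‖n‖ ^ 2 ≤ 1 := pow_le_one₀ (norm_nonneg n) hn
  calc ‖tangential n v‖ ≤ ‖‖n‖ ^ 2 • v‖ + ‖inner ℝ n v • n‖ := h ▸ norm_sub_le _ _
    _ ≤ 1 * ‖v‖ + 1 * ‖v‖ := by
        refine add_le_add ?_ ?_
        · rw [norm_smul, norm_pow, norm_norm]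
          exact mul_le_mul_of_nonneg_right h1 (norm_nonneg v)
        · rw [norm_smul]
          calc _ ≤ (‖n‖ * ‖v‖) * ‖n‖ :=
                mul_le_mul_of_nonneg_right (norm_inner_le_norm n v) (norm_nonneg n)
            _ = ‖n‖ ^ 2 * ‖v‖ := by ring
            _ ≤ 1 * ‖v‖ := mul_le_mul_of_nonneg_right h1 (norm_nonneg v)
    _ = 2 * ‖v‖ := by ring

lemma norm_outwardNormal_le (T : Finset E3) (a : E3) : ‖outwardNormal T a‖ ≤ 1 := by
  rw [outwardNormal, norm_smul, norm_inv, norm_norm]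
  exact inv_mul_le_one

/-- The area of a face is at most of the order of the square of the diameter. -/
lemma exists_face_measure_le : ∃ c : ℝ, 0 ≤ c ∧ ∀ (T : Finset E3) (a : E3) (h : ℝ), T.card = 4 →
    a ∈ T → (∀ x ∈ T, ∀ y ∈ T, dist x y ≤ h) →
    μHE[2] (face T a) ≤ ENNReal.ofReal (c * h ^ 2) := by
  classical
  obtain ⟨s, hs⟩ : ∃ s : NNReal, (μHE[2] : Measure E3) = s • μH[2] :=
    ⟨_, by rw [Measure.euclideanHausdorffMeasure_def]; norm_cast⟩
  refine ⟨s * 4, by positivity, fun T a h hT ha hh => ?_⟩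
  have h0 : 0 ≤ h := dist_nonneg.trans (hh a ha a ha)
  have hc : (T.erase a).card = 3 := by rw [Finset.card_erase_of_mem ha, hT]
  obtain ⟨p, q, r, -, -, -, hpqr⟩ := Finset.card_eq_three.1 hc
  have hset : ((T : Set E3) \ {a}) = {p, q, r} := by
    rw [← Finset.coe_erase, hpqr]; simp
  have hmem : ∀ x ∈ ({p, q, r} : Finset E3), x ∈ T := fun x hx =>
    Finset.mem_of_mem_erase (hpqr ▸ hx)
  have hpq : ‖q - p‖ ≤ h := by
    rw [← dist_eq_norm]; exact hh _ (hmem _ (by simp)) _ (hmem _ (by simp))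
  have hpr : ‖r - p‖ ≤ h := by
    rw [← dist_eq_norm]; exact hh _ (hmem _ (by simp)) _ (hmem _ (by simp))
  let L : (Fin 2 → ℝ) →L[ℝ] E3 :=
    (ContinuousLinearMap.proj 0).smulRight (q - p) + (ContinuousLinearMap.proj 1).smulRight (r - p)
  have hL : ∀ v, L v = v 0 • (q - p) + v 1 • (r - p) := fun _ => rfl
  let f : (Fin 2 → ℝ) → E3 := fun s => p + L s
  have hf : LipschitzWith (2 * h).toNNReal f := by
    refine LipschitzWith.of_dist_le_mul fun x y => ?_
    rw [Real.coe_toNNReal _ (by positivity), dist_add_left, dist_eq_norm, dist_eq_norm, ← map_sub,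
      hL]
    calc _ ≤ ‖(x - y) 0‖ * ‖q - p‖ + ‖(x - y) 1‖ * ‖r - p‖ := by
          refine (norm_add_le _ _).trans_eq ?_
          rw [norm_smul, norm_smul]
      _ ≤ ‖x - y‖ * h + ‖x - y‖ * h := by
          gcongr
          · exact norm_le_pi_norm (x - y) 0
          · exact norm_le_pi_norm (x - y) 1
      _ = _ := by ring
  have hconv : Convex ℝ (f '' Set.Icc 0 1) := by
    have : f '' Set.Icc 0 1 = (fun z => p + z) '' (L '' Set.Icc 0 1) := by
      rw [Set.image_image]
    rw [this]
    exact ((convex_Icc 0 1).is_linear_image L.toLinearMap.isLinear).translate p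
  have hsub : face T a ⊆ f '' Set.Icc 0 1 := by
    unfold face
    rw [hset]
    refine convexHull_min ?_ hconv
    rintro x (rfl | rfl | rfl)
    · exact ⟨0, by simp, by simp [f]⟩
    · refine ⟨![1, 0], ⟨fun i => ?_, fun i => ?_⟩, by simp [f, hL]⟩ <;> fin_cases i <;> simp
    · refine ⟨![0, 1], ⟨fun i => ?_, fun i => ?_⟩, by simp [f, hL]⟩ <;> fin_cases i <;> simp
  have hfin : μH[2] (f '' Set.Icc 0 1) ≤ ENNReal.ofReal (4 * h ^ 2) := by
    refine (hf.hausdorffMeasure_image_le (by norm_num) _).trans_eq ?_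
    have h2 : (μH[2] : Measure (Fin 2 → ℝ)) = volume := by
      simpa using hausdorffMeasure_pi_real (ι := Fin 2)
    rw [h2, Real.volume_Icc_pi]
    simp only [Pi.one_apply, Pi.zero_apply, sub_zero, ENNReal.ofReal_one, Finset.prod_const_one,
      mul_one]
    rw [ENNReal.rpow_ofNat, ENNReal.ofNNReal_toNNReal, ← ENNReal.ofReal_pow (by positivity)]
    congr 1
    ring
  rw [hs, Measure.smul_apply, ENNReal.smul_def, smul_eq_mul, mul_assoc,
    ENNReal.ofReal_mul s.coe_nonneg, ENNReal.ofReal_coe_nnreal]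
  exact mul_le_mul_right ((measure_mono hsub).trans hfin) _

namespace TetMesh

variable {Ω : Set E3} (M : TetMesh Ω)

/-- An enumeration of the vertices of an element. -/
def vert (T : M.Elem) (i : Fin 4) : E3 := ((T.1.equivFinOfCardEq (M.card_eq _ T.2)).symm i).1

lemma vert_injective (T : M.Elem) : Function.Injective (M.vert T) :=
  Subtype.val_injective.comp (Equiv.injective _)

lemma vert_mem (T : M.Elem) (i : Fin 4) : M.vert T i ∈ T.1 := Subtype.prop _

lemma range_vert (T : M.Elem) : range (M.vert T) = (T.1 : Set E3) := by
  refine Subset.antisymm (range_subset_iff.2 (M.vert_mem T)) fun x hx => ?_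
  exact ⟨T.1.equivFinOfCardEq (M.card_eq _ T.2) ⟨x, hx⟩, by simp [vert]⟩

lemma convexHull_range_vert (T : M.Elem) : convexHull ℝ (range (M.vert T)) = M.dom T := by
  rw [range_vert, dom]

variable {M}

lemma dist_le_meshSize {T : M.Elem} {x y : E3} (hx : x ∈ M.dom T) (hy : y ∈ M.dom T) :
    dist x y ≤ M.meshSize :=
  (dist_le_diam_of_mem (M.isCompact_dom T).isBounded hx hy).trans
    (le_ciSup (f := M.diam) (finite_range _).bddAbove T)

lemma norm_vert_sub_le (T : M.Elem) (i j : Fin 4) : ‖M.vert T i - M.vert T j‖ ≤ M.meshSize := by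
  rw [← dist_eq_norm]
  exact dist_le_meshSize (M.mem_dom_of_mem T (M.vert_mem T i))
    (M.mem_dom_of_mem T (M.vert_mem T j))

/-- The elements of a shape regular and quasi-uniform mesh contain balls whose radii are
proportional to the mesh size. -/
lemma exists_closedBall_subset {σ ρ : ℝ} (hσ : M.ShapeRegular σ) (hρ : M.QuasiUniform ρ)
    (T : M.Elem) : 0 < σ ∧ 0 < ρ ∧ 0 < M.meshSize ∧
      ∃ c, closedBall c (M.meshSize / (2 * σ * ρ)) ⊆ M.dom T := by
  obtain ⟨c, r, hr, hball, hdiam⟩ := hσ T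
  have hle := hρ T
  have h1 : r ≤ M.diam T := by
    have hd : dist (c + r • EuclideanSpace.single 0 1) c = r := by
      rw [dist_eq_norm, add_sub_cancel_left, norm_smul, Real.norm_of_nonneg hr.le]
      simp
    calc r = dist (c + r • EuclideanSpace.single 0 1) c := hd.symm
      _ ≤ M.diam T := dist_le_diam_of_mem (M.isCompact_dom T).isBounded
          (hball (mem_closedBall.2 hd.le)) (hball (mem_closedBall_self hr.le))
  have hd : 0 < M.diam T := hr.trans_le h1
  have hσ0 : 0 < σ := pos_of_mul_pos_left (hd.trans_le hdiam) (by positivity)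
  have hm : 0 < M.meshSize := hd.trans_le (le_ciSup (f := M.diam) (finite_range _).bddAbove T)
  have hρ0 : 0 < ρ := pos_of_mul_pos_left (hm.trans_le hle) hd.le
  refine ⟨hσ0, hρ0, hm, c, (closedBall_subset_closedBall ?_).trans hball⟩
  rw [div_le_iff₀ (by positivity)]
  calc M.meshSize ≤ ρ * M.diam T := hle
    _ ≤ ρ * (σ * (2 * r)) := mul_le_mul_of_nonneg_left hdiam hρ0.le
    _ = _ := by ring

variable {ω : Finset M.Elem}

lemma setIntegral_curl_le_curlNorm_sq (u : ω → VPoly) (T : ω) :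
    ∫ x in M.dom T.1, ‖evalV (curl (u T)) x‖ ^ 2 ≤ M.curlNorm ω u ^ 2 := by
  rw [curlNorm, Real.sq_sqrt (integral_nonneg fun x => by positivity)]
  have hsub : M.dom T.1 ⊆ M.region ω := fun x hx => (M.mem_region_iff ω x).2 ⟨T.1, T.2, hx⟩
  have hint : Integrable fun x => ‖M.glue ω (fun T => evalV (curl (u T))) x‖ ^ 2 :=
    (M.memLp_glue ω _ fun T => continuous_evalV _).integrable_norm_pow (by norm_num)
  calc _ = ∫ x in M.dom T.1, ‖M.glue ω (fun T => evalV (curl (u T))) x‖ ^ 2 := by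
        refine setIntegral_congr_ae (M.isClosed_dom T.1).measurableSet ?_
        filter_upwards [M.ae_notMem_frontier_dom T.1] with x hx hxT
        have : x ∈ interior (M.dom T.1) := by
          by_contra h
          exact hx ⟨subset_closure hxT, h⟩
        rw [M.glue_of_mem_interior _ T this]
    _ ≤ _ := setIntegral_mono_set hint.integrableOn
        (ae_of_all _ fun x => by positivity) hsub.eventuallyLE

lemma norm_polyL2_curl_le {σ ρ : ℝ} (hσ : M.ShapeRegular σ) (hρ : M.QuasiUniform ρ)
    (u : ω → VPoly) (T : ω) (i : Fin 3) :
    ‖polyL2 (curl (pullV (M.vert T.1) (u T)) i)‖ ≤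
      9 * √((2 * σ * ρ) ^ 3 / ballRatio) * M.meshSize ^ (1 / 2 : ℝ) * M.curlNorm ω u := by
  obtain ⟨hσ0, hρ0, hm, c, hball⟩ := exists_closedBall_subset hσ hρ T.1
  rw [← convexHull_range_vert] at hball
  have hb := ballRatio_pos
  have h1 := norm_polyL2_curl_pullV_sq_le (by positivity) hball
    (fun i => norm_vert_sub_le T.1 i.succ 0) (u T) i
  rw [convexHull_range_vert] at h1
  have h2 := h1.trans (mul_le_mul_of_nonneg_left (setIntegral_curl_le_curlNorm_sq u T)
    (by positivity))
  have hcn : 0 ≤ M.curlNorm ω u := Real.sqrt_nonneg _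
  refine le_of_sq_le_sq ?_ (by positivity)
  rw [mul_pow, mul_pow, mul_pow, Real.sq_sqrt (by positivity), ← Real.sqrt_eq_rpow,
    Real.sq_sqrt hm.le]
  refine le_of_mul_le_mul_left (h2.trans_eq ?_)
    (show 0 < ballRatio * (M.meshSize / (2 * σ * ρ)) ^ 3 by positivity)
  field_simp
  ring

lemma norm_trace_le {c A h : ℝ} (hc : 0 ≤ c) (hA : 0 ≤ A) (hh : 0 ≤ h) {v : ω → VPoly}
    (hv : ∀ T : ω, ∀ x ∈ M.dom T.1, ‖evalV (v T) x‖ ≤ A)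
    (hface : ∀ T : ω, ∀ a ∈ T.1.1, μHE[2] (face T.1.1 a) ≤ ENNReal.ofReal (c * h ^ 2)) :
    ‖M.trace ω v‖ ≤ ω.card * (4 * (√c * h * (2 * A))) := by
  classical
  have hB : 0 ≤ √c * h * (2 * A) := by positivity
  have hterm : ∀ T : ω, ∀ a ∈ T.1.1, AEStronglyMeasurable (fun x =>
      if face T.1.1 a ⊆ frontier Ω then (face T.1.1 a).indicator
        (fun y => tangential (outwardNormal T.1.1 a) (evalV (v T) y)) x else 0) μHE[2] ∧
      eLpNorm (fun x => if face T.1.1 a ⊆ frontier Ω then (face T.1.1 a).indicator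
        (fun y => tangential (outwardNormal T.1.1 a) (evalV (v T) y)) x else 0) 2 μHE[2] ≤
      ENNReal.ofReal (√c * h * (2 * A)) := by
    intro T a ha
    split_ifs with hf
    · have hK := (isCompact_face T.1.1 a).measurableSet
      have hcont := continuous_tangential_evalV (outwardNormal T.1.1 a) (v T)
      refine ⟨hcont.aestronglyMeasurable.indicator hK, ?_⟩
      rw [eLpNorm_indicator_eq_eLpNorm_restrict hK]
      refine (eLpNorm_le_of_ae_bound (C := 2 * A)
        ((ae_restrict_iff' hK).2 (ae_of_all _ fun x hx => ?_))).trans ?_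
      · refine (norm_tangential_le (norm_outwardNormal_le _ _) _).trans ?_
        exact mul_le_mul_of_nonneg_left
          (hv T x (convexHull_mono sdiff_subset hx)) zero_le_two
      · rw [Measure.restrict_apply_univ, ENNReal.ofReal_mul (p := √c * h) (by positivity)]
        refine mul_le_mul' ?_ le_rfl
        calc _ ≤ ENNReal.ofReal (c * h ^ 2) ^ (ENNReal.toReal 2)⁻¹ :=
              ENNReal.rpow_le_rpow (hface T a ha) (by simp)
          _ = ENNReal.ofReal (√(c * h ^ 2)) := by
              rw [Real.sqrt_eq_rpow, ENNReal.ofReal_rpow_of_nonneg (by positivity) (by simp)]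
              norm_num
          _ = _ := by rw [Real.sqrt_mul' _ (sq_nonneg h), Real.sqrt_sq hh]
    · exact ⟨aestronglyMeasurable_const, by simp⟩
  change ‖(M.memLp_traceFun ω v).toLp‖ ≤ _
  rw [Lp.norm_toLp]
  refine ENNReal.toReal_le_of_le_ofReal (by positivity) ?_
  have hfun : M.traceFun ω v = ∑ T : ω, ∑ a ∈ T.1.1, fun x =>
      if face T.1.1 a ⊆ frontier Ω then (face T.1.1 a).indicator
        (fun y => tangential (outwardNormal T.1.1 a) (evalV (v T) y)) x else 0 := by
    ext1 x
    simp only [traceFun, Finset.sum_apply]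
  calc eLpNorm (M.traceFun ω v) 2 (M.surfMeasure ω)
      ≤ eLpNorm (M.traceFun ω v) 2 μHE[2] := eLpNorm_mono_measure _ Measure.restrict_le_self
    _ ≤ ∑ T : ω, ∑ a ∈ T.1.1, ENNReal.ofReal (√c * h * (2 * A)) := by
        rw [hfun]
        refine (eLpNorm_sum_le (fun T _ => Finset.aestronglyMeasurable_sum _
          fun a ha => (hterm T a ha).1) (by norm_num)).trans (Finset.sum_le_sum fun T _ => ?_)
        exact (eLpNorm_sum_le (fun a ha => (hterm T a ha).1) (by norm_num)).trans
          (Finset.sum_le_sum fun a ha => (hterm T a ha).2)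
    _ = ENNReal.ofReal (ω.card * (4 * (√c * h * (2 * A)))) := by
        rw [Finset.sum_congr rfl fun T _ => by rw [Finset.sum_const, M.card_eq _ T.1.2]]
        rw [Finset.sum_const, Finset.card_univ, Fintype.card_coe, ← nsmul_eq_mul ω.card,
          ENNReal.ofReal_nsmul, ENNReal.ofReal_mul (p := 4) (by norm_num)]
        simp

end TetMesh

end EdgeElement

namespace EdgeElement
open Topology

namespace TetMesh

variable {Ω : Set E3} (M : TetMesh Ω)

/-! ### Labelled patches -/

/-- A numbering of the elements and of the vertices of a patch. -/
structure Labelling (ω : Finset M.Elem) (n m : ℕ) where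
  /-- The elements of the patch. -/
  elem : Fin n ≃ ω
  /-- The vertices of the patch. -/
  point : Fin m → E3
  point_injective : Function.Injective point
  /-- The numbers of the vertices of an element. -/
  idx : Fin n → Fin 4 → Fin m
  point_idx : ∀ s i, point (idx s i) = M.vert (elem s).1 i

lemma exists_labelling (ω : Finset M.Elem) :
    ∃ m ≤ 4 * ω.card, Nonempty (M.Labelling ω ω.card m) := by
  classical
  let W : Finset E3 := ω.biUnion fun T => T.1
  have hW : W.card ≤ 4 * ω.card := by
    refine Finset.card_biUnion_le.trans_eq ?_
    rw [Finset.sum_congr rfl fun T _ => M.card_eq _ T.2, Finset.sum_const, smul_eq_mul, mul_comm]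
  let e : Fin ω.card ≃ ω := ω.equivFin.symm
  let f : Fin W.card ≃ W := W.equivFin.symm
  have hmem : ∀ s i, M.vert (e s).1 i ∈ W := fun s i =>
    Finset.mem_biUnion.2 ⟨(e s).1, (e s).2, M.vert_mem _ i⟩
  exact ⟨W.card, hW, ⟨{
    elem := e
    point := fun j => (f j).1
    point_injective := Subtype.val_injective.comp f.injective
    idx := fun s i => f.symm ⟨_, hmem s i⟩
    point_idx := fun s i => by simp }⟩⟩

namespace Labelling

variable {M} {ω : Finset M.Elem} {n m : ℕ} (L : M.Labelling ω n m)

lemma idx_injective (s : Fin n) : Function.Injective (L.idx s) := fun i j hij =>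
  M.vert_injective (L.elem s).1 (by rw [← L.point_idx, ← L.point_idx, hij])

/-- The convex combination of the vertices with given weights. -/
def comb (g : Fin m → ℝ) : E3 := ∑ j, g j • L.point j

lemma sum_idx {s : Fin n} {g : Fin m → ℝ} (hg : ∀ j, g j ≠ 0 → j ∈ range (L.idx s)) :
    ∑ i, g (L.idx s i) = ∑ j, g j :=
  Fintype.sum_of_injective (L.idx s) (L.idx_injective s) _ _
    (fun j hj => by_contra fun h => hj (hg j h)) fun _ => rfl

lemma sum_idx_smul {s : Fin n} {g : Fin m → ℝ} (hg : ∀ j, g j ≠ 0 → j ∈ range (L.idx s)) :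
    ∑ i, g (L.idx s i) • M.vert (L.elem s).1 i = L.comb g :=
  Fintype.sum_of_injective (L.idx s) (L.idx_injective s) _ _
    (fun j hj => by
      have : g j = 0 := by_contra fun h => hj (hg j h)
      rw [this, zero_smul]) fun i => by rw [L.point_idx]

lemma simplexMap_refPoint_comp {s : Fin n} {g : Fin m → ℝ} (h1 : ∑ j, g j = 1)
    (hg : ∀ j, g j ≠ 0 → j ∈ range (L.idx s)) :
    simplexMap (M.vert (L.elem s).1) (refPoint (g ∘ L.idx s)) = L.comb g := by
  rw [simplexMap_refPoint (l := g ∘ L.idx s) _ ((L.sum_idx hg).trans h1)]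
  exact L.sum_idx_smul hg

lemma comb_mem {s t : Fin n} {g : Fin m → ℝ} (hg : g ∈ sharedWeights L.idx s t) :
    L.comb g ∈ M.dom (L.elem s).1 ∩ M.dom (L.elem t).1 := by
  have key : ∀ s, (∀ j, g j ≠ 0 → j ∈ range (L.idx s)) → L.comb g ∈ M.dom (L.elem s).1 := by
    intro s hs
    rw [← convexHull_range_vert, ← image_simplexMap, ← L.simplexMap_refPoint_comp hg.2.1 hs]
    exact mem_image_of_mem _ (refPoint_mem (fun i => hg.1 _) ((L.sum_idx hs).trans hg.2.1))
  exact ⟨key s fun j hj => (hg.2.2 j hj).1, key t fun j hj => (hg.2.2 j hj).2⟩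

lemma exists_sharedWeights {s t : Fin n} {x : E3}
    (hx : x ∈ M.dom (L.elem s).1 ∩ M.dom (L.elem t).1) :
    ∃ g ∈ sharedWeights L.idx s t, L.comb g = x := by
  classical
  let T := (L.elem s).1
  let b : T.1 → ℝ := fun a => M.bary T a x
  let g : Fin m → ℝ := fun j => if h : L.point j ∈ T.1 then b ⟨L.point j, h⟩ else 0
  have hrange : ∀ s j, L.point j ∈ (L.elem s).1.1 → j ∈ range (L.idx s) := by
    intro s j hj
    rw [← Finset.mem_coe, ← range_vert] at hj
    obtain ⟨i, hi⟩ := hj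
    exact ⟨i, L.point_injective (by rw [L.point_idx, hi])⟩
  have hgs : ∀ j, g j ≠ 0 → j ∈ range (L.idx s) := by
    intro j hj
    refine hrange s j ?_
    by_contra h
    exact hj (dif_neg h)
  have h0 : ∀ j, 0 ≤ g j := by
    intro j
    by_cases h : L.point j ∈ T.1
    · simp only [g, dif_pos h]; exact (M.mem_dom_iff T x).1 hx.1 _
    · simp only [g, dif_neg h]; exact le_rfl
  have hgv : ∀ i, g (L.idx s i) = b ((T.1.equivFinOfCardEq (M.card_eq _ T.2)).symm i) := by
    intro i
    have h : L.point (L.idx s i) ∈ T.1 := L.point_idx s i ▸ M.vert_mem T i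
    simp only [g, dif_pos h]
    congr 1
    exact Subtype.ext (L.point_idx s i)
  refine ⟨g, ⟨h0, ?_, fun j hj => ⟨hgs j hj, hrange t j ?_⟩⟩, ?_⟩
  · rw [← L.sum_idx hgs, Finset.sum_congr rfl fun i _ => hgv i, Equiv.sum_comp]
    exact M.sum_bary T x
  · by_cases h : L.point j ∈ T.1
    · refine M.mem_of_bary_pos hx.1 hx.2 (a := ⟨L.point j, h⟩) ?_
      refine lt_of_le_of_ne ((M.mem_dom_iff T x).1 hx.1 _) fun h' => hj ?_
      simp only [g, dif_pos h]
      exact h'.symm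
    · exact absurd (dif_neg h) hj
  · rw [← L.sum_idx_smul hgs]
    calc _ = ∑ i, b ((T.1.equivFinOfCardEq (M.card_eq _ T.2)).symm i) •
          ((T.1.equivFinOfCardEq (M.card_eq _ T.2)).symm i).1 :=
          Finset.sum_congr rfl fun i _ => by rw [hgv]; rfl
      _ = ∑ a, b a • a.1 := Equiv.sum_comp _ fun a : T.1 => b a • a.1
      _ = x := M.sum_bary_smul T x

lemma inner_evalV_pullV_refPoint {s : Fin n} {g₁ g₂ g₃ : Fin m → ℝ} (h₁ : ∑ j, g₁ j = 1)
    (h₂ : ∑ j, g₂ j = 1) (h₃ : ∑ j, g₃ j = 1) (hg₁ : ∀ j, g₁ j ≠ 0 → j ∈ range (L.idx s))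
    (hg₂ : ∀ j, g₂ j ≠ 0 → j ∈ range (L.idx s)) (hg₃ : ∀ j, g₃ j ≠ 0 → j ∈ range (L.idx s))
    (v : VPoly) :
    inner ℝ (evalV (pullV (M.vert (L.elem s).1) v) (refPoint (g₁ ∘ L.idx s)))
      (refPoint (g₂ ∘ L.idx s) - refPoint (g₃ ∘ L.idx s)) =
    inner ℝ (evalV v (L.comb g₁)) (L.comb g₂ - L.comb g₃) := by
  rw [inner_evalV_pullV, L.simplexMap_refPoint_comp h₁ hg₁, ← L.simplexMap_refPoint_comp h₂ hg₂,
    ← L.simplexMap_refPoint_comp h₃ hg₃, map_sub, simplexMap, simplexMap, add_sub_add_left_eq_sub]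

/-- A family of polynomial fields belongs to the reference space if and only if their tangential
components are continuous. -/
lemma pullV_mem_refSpace_iff {k : ℕ} {v : ω → VPoly}
    (hv : ∀ s, pullV (M.vert (L.elem s).1) (v (L.elem s)) ∈ shapeSpace k) :
    (fun s => pullV (M.vert (L.elem s).1) (v (L.elem s))) ∈ refSpace k L.idx ↔
    ∀ T T' : ω, ∀ p ∈ M.dom T.1 ∩ M.dom T'.1, ∀ y ∈ M.dom T.1 ∩ M.dom T'.1,
      ∀ z ∈ M.dom T.1 ∩ M.dom T'.1,
      inner ℝ (evalV (v T) p) (y - z) = inner ℝ (evalV (v T') p) (y - z) := by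
  rw [mem_refSpace]
  constructor
  · rintro ⟨-, h⟩ T T' p hp y hy z hz
    obtain ⟨s, rfl⟩ := L.elem.surjective T
    obtain ⟨t, rfl⟩ := L.elem.surjective T'
    obtain ⟨g₁, h₁, rfl⟩ := L.exists_sharedWeights hp
    obtain ⟨g₂, h₂, rfl⟩ := L.exists_sharedWeights hy
    obtain ⟨g₃, h₃, rfl⟩ := L.exists_sharedWeights hz
    have := h s t g₁ h₁ g₂ h₂ g₃ h₃
    rwa [L.inner_evalV_pullV_refPoint h₁.2.1 h₂.2.1 h₃.2.1 (fun j hj => (h₁.2.2 j hj).1)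
        (fun j hj => (h₂.2.2 j hj).1) (fun j hj => (h₃.2.2 j hj).1),
      L.inner_evalV_pullV_refPoint h₁.2.1 h₂.2.1 h₃.2.1 (fun j hj => (h₁.2.2 j hj).2)
        (fun j hj => (h₂.2.2 j hj).2) (fun j hj => (h₃.2.2 j hj).2)] at this
  · refine fun h => ⟨hv, fun s t g₁ h₁ g₂ h₂ g₃ h₃ => ?_⟩
    rw [L.inner_evalV_pullV_refPoint h₁.2.1 h₂.2.1 h₃.2.1 (fun j hj => (h₁.2.2 j hj).1)
        (fun j hj => (h₂.2.2 j hj).1) (fun j hj => (h₃.2.2 j hj).1),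
      L.inner_evalV_pullV_refPoint h₁.2.1 h₂.2.1 h₃.2.1 (fun j hj => (h₁.2.2 j hj).2)
        (fun j hj => (h₂.2.2 j hj).2) (fun j hj => (h₃.2.2 j hj).2)]
    exact h _ _ _ (L.comb_mem h₁) _ (L.comb_mem h₂) _ (L.comb_mem h₃)

end Labelling

/-! ### Potentials -/

/-- A polynomial whose gradient is orthogonal to the directions of a convex set is constant on
that set. -/
lemma evalS_eq_of_inner_grad_eq_zero {d : Poly} {S : Set E3} (hS : Convex ℝ S)
    (h : ∀ x ∈ S, ∀ y ∈ S, ∀ z ∈ S, inner ℝ (evalV (grad d) x) (y - z) = 0) {p q : E3}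
    (hp : p ∈ S) (hq : q ∈ S) : evalS d p = evalS d q := by
  let γ : ℝ → E3 := fun t => q + t • (p - q)
  have hγ : ∀ t, HasDerivAt γ (p - q) t := fun t => by
    have := ((hasDerivAt_id t).smul_const (p - q)).const_add q
    rwa [one_smul] at this
  have hd : ∀ t, HasDerivAt (evalS d ∘ γ) (inner ℝ (evalV (grad d) (γ t)) (p - q)) t := fun t => by
    rw [← fderiv_evalS_eq_inner]
    exact (((contDiff_evalS d (n := 1)).differentiable (by norm_num)
      (γ t)).hasFDerivAt).comp_hasDerivAt t (hγ t)
  have hmem : ∀ t ∈ Icc (0 : ℝ) 1, γ t ∈ S := fun t ht =>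
    hS.add_smul_sub_mem hq hp ht
  have := constant_of_has_deriv_right_zero (f := evalS d ∘ γ) (a := 0) (b := 1)
    (fun t _ => (hd t).continuousAt.continuousWithinAt)
    (fun t ht => by
      have h1 := (hd t).hasDerivWithinAt (s := Ici t)
      rwa [h _ (hmem t ⟨ht.1, ht.2.le⟩) p hp q hq] at h1) 1 (by simp)
  simpa [γ] using this

variable {M}

/-- On a simply connected patch, curl free elements of the reference space are gradients of
continuous piecewise polynomials. -/
lemma exists_potential {k n m : ℕ} {ω : Finset M.Elem} (hω : IsSimplyConnected (M.region ω))
    (L : M.Labelling ω n m)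
    (hL : ∀ s, Function.Bijective (simplexLin (M.vert (L.elem s).1))) {z : Fin n → VPoly}
    (hz : z ∈ refSpace k L.idx) (hz0 : ∀ s, curl (z s) = 0) :
    ∃ ψ ∈ M.lagrangeSpace k ω, ∀ s, pullV (M.vert (L.elem s).1) (grad (ψ (L.elem s))) = z s := by
  classical
  have hpot : ∀ s, ∃ φ : Poly, pullV (M.vert (L.elem s).1) (grad φ) = z s ∧
      φ.totalDegree ≤ k + 1 := by
    intro s
    obtain ⟨φ', hφ', hdeg'⟩ := exists_grad_eq (z s) ((curl_eq_zero_iff _).1 (hz0 s))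
    obtain ⟨φ, hφ, hdeg⟩ := exists_pullS_eq _ (hL s) φ'
    exact ⟨φ, by rw [← grad_pullS, hφ, hφ'],
      hdeg.trans (hdeg'.trans ((mem_refSpace.1 hz).1 s).2)⟩
  choose φ hφ hdeg using hpot
  let Φ : ω → Poly := fun T => φ (L.elem.symm T)
  have hΦ : ∀ s, pullV (M.vert (L.elem s).1) (grad (Φ (L.elem s))) = z s := fun s => by
    simp only [Φ, Equiv.symm_apply_apply, hφ]
  have hz' : (fun s => pullV (M.vert (L.elem s).1) (grad (Φ (L.elem s)))) ∈ refSpace k L.idx := by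
    rwa [funext hΦ]
  rw [L.pullV_mem_refSpace_iff (v := fun T => grad (Φ T)) ((mem_refSpace.1 hz').1)] at hz'
  let F : M.Elem → Poly := fun T => if h : T ∈ ω then Φ ⟨T, h⟩ else 0
  have hF : ∀ T : ω, F T.1 = Φ T := fun T => dif_pos T.2
  obtain ⟨κ, hκ⟩ := M.exists_const_of_isSimplyConnected hω (fun T => evalS (F T)) (by
    intro T hT T' hT' p hp q hq
    rw [hF ⟨T, hT⟩, hF ⟨T', hT'⟩]
    have := evalS_eq_of_inner_grad_eq_zero (d := Φ ⟨T, hT⟩ - Φ ⟨T', hT'⟩)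
      ((M.convex_dom T).inter (M.convex_dom T')) (fun x hx y hy w hw => by
        rw [map_sub, map_sub, Pi.sub_apply, inner_sub_left, sub_eq_zero]
        exact hz' ⟨T, hT⟩ ⟨T', hT'⟩ x hx y hy w hw) hp hq
    simp only [map_sub, Pi.sub_apply] at this
    linarith)
  have hC : ∀ (p : Poly) (c : ℝ) (x : E3), evalS (p + MvPolynomial.C c) x = evalS p x + c :=
    fun p c x => by simp [evalS_apply]
  refine ⟨fun T => Φ T + MvPolynomial.C (κ T.1), M.mem_lagrangeSpace (fun T => ?_)
    (fun T T' p hp => ?_), fun s => ?_⟩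
  · exact (MvPolynomial.totalDegree_add _ _).trans (max_le (hdeg _) (by simp))
  · rw [hC, hC, ← hF, ← hF]
    exact hκ T.1 T.2 T'.1 T'.2 p hp
  · have : grad (Φ (L.elem s) + MvPolynomial.C (κ (L.elem s).1)) = grad (Φ (L.elem s)) := by
      ext1 i
      simp [grad]
    rw [this, hΦ]

lemma norm_sub_surfProj_le (k : ℕ) (ω : Finset M.Elem) (v : ω → VPoly) {ψ : ω → Poly}
    (hψ : ψ ∈ M.lagrangeSpace k ω) :
    ‖M.trace ω v - M.surfProj k ω (M.trace ω v)‖ ≤ ‖M.trace ω fun T => v T - grad (ψ T)‖ := by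
  have hmem : M.surfGrad ω ψ ∈ M.gradTraceSpace k ω := Submodule.mem_map_of_mem hψ
  have heq : (M.trace ω fun T => v T - grad (ψ T)) = M.trace ω v - M.surfGrad ω ψ := by
    rw [surfGrad, LinearMap.comp_apply, ← map_sub]
    rfl
  rw [surfProj, Submodule.starProjection_minimal, heq]
  exact ciInf_le ⟨0, forall_mem_range.2 fun _ => norm_nonneg _⟩
    (⟨_, hmem⟩ : M.gradTraceSpace k ω)

end TetMesh

end EdgeElement

end

open EdgeElement TetMesh in
theorem lemma3p3 (Ω : Set EdgeElement.E3) (hΩ : EdgeElement.IsLipschitzDomain Ω)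
    (k : ℕ) (σ ρ : ℝ) (N : ℕ) :
    ∃ C : ℝ, 0 < C ∧
      ∀ (M : EdgeElement.TetMesh Ω), M.ShapeRegular σ → M.QuasiUniform ρ →
      ∀ 𝒲 : Finset (Finset M.Elem), M.IsolatedPatches N 𝒲 →
      ∀ ω ∈ 𝒲, ∀ u ∈ M.edgeSpace k,
        ‖M.trace ω (fun T => u T.1) - M.surfProj k ω (M.trace ω (fun T => u T.1))‖ ≤
          C * M.meshSize ^ (1 / 2 : ℝ) * M.curlNorm ω (fun T => u T.1) := by
  obtain ⟨Cr, hCr, href⟩ := exists_uniform_curl_free_approx k N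
  obtain ⟨c, hc, hface⟩ := exists_face_measure_le
  set K : ℝ := N * (4 * (√c * (2 * (2 * σ * ρ * (3 * (Cr *
    (9 * √((2 * σ * ρ) ^ 3 / ballRatio)))))))) with hK
  refine ⟨|K| + 1, by positivity, fun M hσ hρ 𝒲 h𝒲 ω hω u hu => ?_⟩
  have hsc := h𝒲.simplyConnected ω hω
  obtain ⟨x₀, hx₀⟩ := hsc.nonempty
  obtain ⟨T₀, -, -⟩ := (M.mem_region_iff ω x₀).1 hx₀
  obtain ⟨hσ0, hρ0, hm, -⟩ := exists_closedBall_subset hσ hρ T₀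
  obtain ⟨m, hmN, ⟨L⟩⟩ := M.exists_labelling ω
  have hωN := h𝒲.card_le ω hω
  have hr : 0 < M.meshSize / (2 * σ * ρ) := by positivity
  have hball : ∀ T : M.Elem, ∃ x, Metric.closedBall x (M.meshSize / (2 * σ * ρ)) ⊆
      convexHull ℝ (range (M.vert T)) := fun T => by
    rw [convexHull_range_vert]
    exact (exists_closedBall_subset hσ hρ T).2.2.2
  have hbij : ∀ T : M.Elem, Function.Bijective (simplexLin (M.vert T)) := fun T =>
    simplexLin_bijective hr (hball T).choose_spec
  have hshape : ∀ s, pullV (M.vert (L.elem s).1) (u (L.elem s).1) ∈ shapeSpace k := fun s =>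
    pullV_mem_shapeSpace _ (nedelec_subset_shapeSpace k (hu.1 _))
  have hmem := (L.pullV_mem_refSpace_iff (v := fun T => u T.1) hshape).2
    fun T T' p hp y hy z hz => by
      rw [← sub_eq_zero, ← inner_sub_left]
      exact inner_jump_eq_zero hΩ hu hp hy hz
  obtain ⟨z, hz, hz0, hzu⟩ := href _ hωN m (hmN.trans (by omega)) L.idx _ hmem
  obtain ⟨ψ, hψ, hψz⟩ := exists_potential hsc L (fun s => hbij _) hz hz0
  set R : ℝ := 9 * √((2 * σ * ρ) ^ 3 / ballRatio) * M.meshSize ^ (1 / 2 : ℝ) *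
    M.curlNorm ω (fun T => u T.1) with hR
  have hcn : 0 ≤ M.curlNorm ω (fun T => u T.1) := Real.sqrt_nonneg _
  have hR0 : 0 ≤ R := by positivity
  have happrox := hzu R hR0 fun s i => norm_polyL2_curl_le hσ hρ (fun T => u T.1) (L.elem s) i
  have hbound : ∀ T : ω, ∀ x ∈ M.dom T.1, ‖evalV (u T.1 - grad (ψ T)) x‖ ≤
      2 * σ * ρ * (3 * (Cr * R)) / M.meshSize := by
    intro T x hx
    obtain ⟨s, rfl⟩ := L.elem.surjective T
    rw [← convexHull_range_vert, ← image_simplexMap] at hx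
    obtain ⟨y, hy, rfl⟩ := hx
    have h1 := mul_norm_le_sum_abs_inner hr (hball (L.elem s).1).choose_spec
      (evalV (u (L.elem s).1 - grad (ψ (L.elem s))) (simplexMap (M.vert (L.elem s).1) y))
    have h2 : ∀ i : Fin 3, |inner ℝ (evalV (u (L.elem s).1 - grad (ψ (L.elem s)))
        (simplexMap (M.vert (L.elem s).1) y)) (M.vert (L.elem s).1 i.succ -
        M.vert (L.elem s).1 0)| ≤ Cr * R := by
      intro i
      rw [← evalV_pullV_apply, map_sub, hψz]
      exact happrox s y hy i
    have h3 := h1.trans (Finset.sum_le_sum fun i _ => h2 i)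
    rw [Finset.sum_const, Finset.card_univ, Fintype.card_fin, nsmul_eq_mul, div_mul_eq_mul_div,
      div_le_iff₀ (by positivity)] at h3
    rw [le_div_iff₀ hm]
    push_cast at h3
    linarith
  have hA : 0 ≤ 2 * σ * ρ * (3 * (Cr * R)) / M.meshSize := by positivity
  have htr := norm_trace_le hc hA hm.le hbound fun T a ha =>
    hface T.1.1 a M.meshSize (M.card_eq _ T.1.2) ha fun x hx y hy =>
      dist_le_meshSize (M.mem_dom_of_mem T.1 hx) (M.mem_dom_of_mem T.1 hy)
  refine (norm_sub_surfProj_le k ω _ hψ).trans (htr.trans ?_)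
  calc _ ≤ (N : ℝ) * (4 * (√c * M.meshSize *
        (2 * (2 * σ * ρ * (3 * (Cr * R)) / M.meshSize)))) := by
        gcongr
    _ = K * (M.meshSize ^ (1 / 2 : ℝ) * M.curlNorm ω (fun T => u T.1)) := by
        rw [hK, hR]
        field_simp
    _ ≤ (|K| + 1) * (M.meshSize ^ (1 / 2 : ℝ) * M.curlNorm ω (fun T => u T.1)) := by
        gcongr
        exact (le_abs_self K).trans (by linarith)
    _ = _ := by ring
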